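/- Let $E$ be an imaginary quadratic field with positive involution $x\mapsto\bar x$, let $\mathfrak V$ be an $E$-vector space of dimension $g\ge 1$ with a non-degenerate alternating $\mathbb Q$-bilinear form $(\,,)$ such that $(bv,w)=(v,\bar b w)$ for $b\in E$, and let $G$ be the unitary similitude group over $\mathbb Q$: for a $\mathbb Q$-algebra $R$, $G(R)$ consists of the $c\in(\operatorname{End}_E(\mathfrak V)\otimes R)^\times$ such that, for some $\mu\in R^\times$, $(cv,cw)=\mu\,(v,w)$ for all $v,w\in\mathfrak V\otimes R$. Let $\mathcal V_{0,\mathbb Q}=\mathfrak V^\vee$ be the dual of the standard representation of $G$ and $V_0=\mathcal V_{0,\mathbb Q}\otimes_{\mathbb Q}E$. Let $O\subset E$ be an order (any subring spanning $E$ over $\mathbb Q$, for instance a $\mathbb Z_{(p)}$-order). For $s\ge1$ let $E(A)_s\otimes\mathbb Q$ be the $\mathbb Q$-algebra of endomorphisms of $\wedge^\bullet\mathcal V_{0,\mathbb Q}^s$ generated by the functorial actions of $M_s(\mathbb Z)$ and of $O$. A homogeneous projector of degree $t$ is an idempotent $q\in E(A)_s\otimes\mathbb Q$ with image contained in $\wedge^t\mathcal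 V_{0,\mathbb Q}^s$. $\operatorname{Rep}^a_{\mathbb Q}(G)$ is the class of representations of $G$ over $\mathbb Q$ isomorphic to a finite direct sum of images of homogeneous projectors (with varying $s\ge 1$), and $\operatorname{Rep}^a_E(G)$ is the class of representations of $G_E$ isomorphic to $W\otimes_{\mathbb Q}E$ with $W\in\operatorname{Rep}^a_{\mathbb Q}(G)$. Let $i\ne j$ be the two embeddings $E\to E$, and $V_0=V_1\oplus V_2$, where $z\in E$ acts by $i(z)$ on $V_1$ and by $j(z)$ on $V_2$. The action on $V_1$, in a chosen basis, and the multiplier $\nu$ of the action on $V_0$ (the inverse of $\mu$) identify $G_E$ with $GL_g\times\mathbb G_m$. The irreducible representation of $G_E$ of highest weight $(a_1,\dots,a_g;c)$, with $a_1\ge\dots\ge a_g$ and $c\equiv\sum a_l \pmod 2$, is the one with highest weight $(t,\nu)\mapsto \prod_l t_l^{a_l}\cdot\nu^{(c-\sum a_l)/2}$ with respect to the upper triangular Borel subgroup; thus $V_1$ and $V_2$ have highest weights $(1,0,\dots,0;1)$ and $(0,\dots,0,-1;1)$. Let $a=(a_1,\dots,a_g;c)$ with $a_1\ge\dots\ge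 a_g\ge0$ and $c=\sum a_l=s$, and let $a^*=(-a_g,\dots,-a_1;c)$. Then the irreducible representations $V(a)$ and $V(a^*)$ of highest weights $a$ and $a^*$ exist, and $V(a)\oplus V(a^*)$ belongs to $\operatorname{Rep}^a_E(G)$. More precisely, if $s\ge1$, there are an idempotent $C_a\in\mathbb Q[\mathfrak S_s]$ (acting on $\wedge^\bullet\mathcal V_{0,\mathbb Q}^s$ through permutation matrices), a projector $q\in E(A)_s\otimes\mathbb Q$ which commutes with $\mathfrak S_s$ and whose image on $\wedge^\bullet V_0^s$ is $V_0^{\otimes s}$, and an element $q'$ of the centre of $E(A)_s\otimes\mathbb Q$ whose restriction to $V_0^{\otimes s}$ is a projector onto $V_1^{\otimes s}\oplus V_2^{\otimes s}$, such that $C_aq'q\in E(A)_s\otimes\mathbb Q$ is a homogeneous projector of degree $s$ whose image on $\wedge^\bullet V_0^s$ is isomorphic to $V(a)\oplus V(a^*)$ as a representation of $G_E$, with $V(a)$ corresponding to $C_aV_1^{\otimes s}$ and $V(a^*)$ to $C_aV_2^{\otimes s}$. -/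

import Mathlib

open scoped TensorProduct

universe u v w

noncomputable section

/-! # Affine groups as functors of points, and their representations -/

/-- A group functor on commutative `k`-algebras. An affine group scheme over `k` is considered
through its functor of points. -/
structure GroupFunctor (k : Type w) [CommRing k] where
  pts : ∀ (R : Type u) [CommRing R] [Algebra k R], Type u
  grp : ∀ (R : Type u) [CommRing R] [Algebra k R], Group (pts R)
  map : ∀ {R S : Type u} [CommRing R] [Algebra k R] [CommRing S] [Algebra k S],
    (R →ₐ[k] S) → pts R →* pts S
  map_id : ∀ (R : Type u) [CommRing R] [Algebra k R] (g : pts R), map (AlgHom.id k R) g = g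
  map_comp : ∀ {R S T : Type u} [CommRing R] [Algebra k R] [CommRing S] [Algebra k S]
    [CommRing T] [Algebra k T] (f' : S →ₐ[k] T) (f : R →ₐ[k] S) (g : pts R),
    map (f'.comp f) g = map f' (map f g)

attribute [instance] GroupFunctor.grp

/-- Base change of a group functor from `k` to a `k`-algebra `K`: a `K`-algebra is regarded as a
`k`-algebra. -/
def GroupFunctor.baseChange {k : Type w} [CommRing k] (G : GroupFunctor.{u, w} k)
    (K : Type v) [CommRing K] [Algebra k K] : GroupFunctor.{u, v} K where
  pts R _ _ :=
    letI : Algebra k R := Algebra.compHom R (algebraMap k K)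
    G.pts R
  grp R _ _ :=
    letI : Algebra k R := Algebra.compHom R (algebraMap k K)
    G.grp R
  map {R S} _ _ _ _ f :=
    letI : Algebra k R := Algebra.compHom R (algebraMap k K)
    letI : Algebra k S := Algebra.compHom S (algebraMap k K)
    G.map (AlgHom.mk f.toRingHom fun r => f.commutes (algebraMap k K r))
  map_id R _ _ g :=
    letI : Algebra k R := Algebra.compHom R (algebraMap k K)
    G.map_id R g
  map_comp {R S T} _ _ _ _ _ _ f' f g :=
    letI : Algebra k R := Algebra.compHom R (algebraMap k K)
    letI : Algebra k S := Algebra.compHom S (algebraMap k K)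
    letI : Algebra k T := Algebra.compHom T (algebraMap k K)
    G.map_comp (AlgHom.mk f'.toRingHom fun r => f'.commutes (algebraMap k K r))
      (AlgHom.mk f.toRingHom fun r => f.commutes (algebraMap k K r)) g

/-- An (algebraic) representation of the group functor `G` over `k` on the `k`-module `V`:
an action of `G(R)` on `R ⊗ V` by `R`-linear maps, for every `k`-algebra `R`, natural in `R`. -/
structure AlgRep {k : Type w} [CommRing k] (G : GroupFunctor.{u, w} k)
    (V : Type v) [AddCommGroup V] [Module k V] where
  act : ∀ (R : Type u) [CommRing R] [Algebra k R], G.pts R →* Module.End R (R ⊗[k] V)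
  natural : ∀ {R S : Type u} [CommRing R] [Algebra k R] [CommRing S] [Algebra k S]
    (f : R →ₐ[k] S) (g : G.pts R) (x : R ⊗[k] V),
    f.toLinearMap.rTensor V (act R g x) = act S (G.map f g) (f.toLinearMap.rTensor V x)

namespace AlgRep

section General

variable {k : Type w} [CommRing k] {G : GroupFunctor.{u, w} k}
variable {V : Type v} [AddCommGroup V] [Module k V]
variable {V' : Type*} [AddCommGroup V'] [Module k V']

/-- A `k`-linear map is a morphism of representations. -/
def IsEquivariant (ρ : AlgRep G V) (ρ' : AlgRep G V') (f : V →ₗ[k] V') : Prop :=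
  ∀ (R : Type u) [CommRing R] [Algebra k R] (g : G.pts R) (x : R ⊗[k] V),
    f.baseChange R (ρ.act R g x) = ρ'.act R g (f.baseChange R x)

/-- Two representations are isomorphic. -/
def IsIso (ρ : AlgRep G V) (ρ' : AlgRep G V') : Prop :=
  ∃ f : V ≃ₗ[k] V', IsEquivariant ρ ρ' f.toLinearMap

/-- A submodule is a subrepresentation. -/
def IsStable (ρ : AlgRep G V) (W : Submodule k V) : Prop :=
  ∀ (R : Type u) [CommRing R] [Algebra k R] (g : G.pts R),
    W.baseChange R ≤ (W.baseChange R).comap (ρ.act R g)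

/-- Irreducible representations. -/
def IsIrreducible (ρ : AlgRep G V) : Prop :=
  Nontrivial V ∧ ∀ W : Submodule k V, ρ.IsStable W → W = ⊥ ∨ W = ⊤

lemma prodRight_rTensor {R S : Type u} [CommRing R] [Algebra k R] [CommRing S] [Algebra k S]
    (f : R →ₐ[k] S) (x : R ⊗[k] (V × V')) :
    TensorProduct.prodRight k S S V V' (f.toLinearMap.rTensor (V × V') x) =
      (f.toLinearMap.rTensor V (TensorProduct.prodRight k R R V V' x).1,
        f.toLinearMap.rTensor V' (TensorProduct.prodRight k R R V V' x).2) := by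
  induction x with
  | zero => simp only [map_zero, Prod.fst_zero, Prod.snd_zero, Prod.mk_zero_zero]
  | tmul r v => simp
  | add x y hx hy => simp only [map_add, hx, hy, Prod.fst_add, Prod.snd_add, Prod.mk_add_mk]

/-- The direct sum of two representations. -/
def prod (ρ : AlgRep G V) (ρ' : AlgRep G V') : AlgRep G (V × V') where
  act R _ _ :=
    { toFun := fun g => (TensorProduct.prodRight k R R V V').symm.conj
        (LinearMap.prodMap (ρ.act R g) (ρ'.act R g))
      map_one' := by
        refine LinearMap.ext fun x => ?_
        apply (TensorProduct.prodRight k R R V V').injective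
        simp [LinearEquiv.conj_apply]
      map_mul' := fun g h => by
        refine LinearMap.ext fun x => ?_
        simp [LinearEquiv.conj_apply] }
  natural {R S} _ _ _ _ f g x := by
    apply (TensorProduct.prodRight k S S V V').injective
    rw [prodRight_rTensor]
    simp [LinearEquiv.conj_apply, prodRight_rTensor, natural]

lemma piRight_rTensor (s : ℕ) {R S : Type u} [CommRing R] [Algebra k R] [CommRing S]
    [Algebra k S] (f : R →ₐ[k] S) (x : R ⊗[k] (Fin s → V)) (j : Fin s) :
    TensorProduct.piRight k S S (fun _ : Fin s => V) (f.toLinearMap.rTensor (Fin s → V) x) j =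
      f.toLinearMap.rTensor V (TensorProduct.piRight k R R (fun _ : Fin s => V) x j) := by
  induction x with
  | zero => simp
  | tmul r v => simp
  | add x y hx hy => simp only [map_add, hx, hy, Pi.add_apply]

/-- The direct sum `V ^ s` of `s` copies of a representation. -/
def pow (ρ : AlgRep G V) (s : ℕ) : AlgRep G (Fin s → V) where
  act R _ _ :=
    { toFun := fun g => (TensorProduct.piRight k R R (fun _ : Fin s => V)).symm.conj
        (LinearMap.compLeft (ρ.act R g) (Fin s))
      map_one' := by
        refine LinearMap.ext fun x => ?_
        apply (TensorProduct.piRight k R R (fun _ : Fin s => V)).injective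
        ext j
        simp [LinearEquiv.conj_apply]
      map_mul' := fun g h => by
        refine LinearMap.ext fun x => ?_
        apply (TensorProduct.piRight k R R (fun _ : Fin s => V)).injective
        ext j
        simp [LinearEquiv.conj_apply] }
  natural {R S} _ _ _ _ f g x := by
    apply (TensorProduct.piRight k S S (fun _ : Fin s => V)).injective
    ext j
    rw [piRight_rTensor]
    simp only [MonoidHom.coe_mk, OneHom.coe_mk, LinearEquiv.conj_apply, LinearMap.comp_apply,
      LinearEquiv.coe_coe, LinearEquiv.symm_symm, LinearEquiv.apply_symm_apply,
      LinearMap.compLeft_apply, Function.comp_apply, natural, piRight_rTensor]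

section Exterior

variable (k V)
variable (R : Type u) [CommRing R] [Algebra k R]

/-- The canonical map `R ⊗ V → R ⊗ ∧V`. -/
def extι : R ⊗[k] V →ₗ[R] R ⊗[k] ExteriorAlgebra k V :=
  (ExteriorAlgebra.ι k).baseChange R

variable {k V R}

lemma extι_swap (x y : R ⊗[k] V) :
    extι k V R x * extι k V R y + extι k V R y * extι k V R x = 0 := by
  induction x with
  | zero => simp
  | add a b ha hb =>
    simp only [map_add, add_mul, mul_add]
    calc _ = (extι k V R a * extι k V R y + extι k V R y * extι k V R a) +
          (extι k V R b * extι k V R y + extι k V R y * extι k V R b) := by abel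
      _ = 0 := by rw [ha, hb, add_zero]
  | tmul r a =>
    induction y with
    | zero => simp
    | add c d hc hd =>
      simp only [map_add, add_mul, mul_add]
      calc _ = (extι k V R (r ⊗ₜ a) * extι k V R c + extι k V R c * extι k V R (r ⊗ₜ a)) +
            (extι k V R (r ⊗ₜ a) * extι k V R d + extι k V R d * extι k V R (r ⊗ₜ a)) := by abel
        _ = 0 := by rw [hc, hd, add_zero]
    | tmul t c =>
      simp only [extι, LinearMap.baseChange_tmul, Algebra.TensorProduct.tmul_mul_tmul]
      rw [mul_comm t r, ← TensorProduct.tmul_add, ExteriorAlgebra.ι_add_mul_swap,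
        TensorProduct.tmul_zero]

lemma extι_sq (x : R ⊗[k] V) : extι k V R x * extι k V R x = 0 := by
  induction x with
  | zero => simp
  | tmul r a =>
    simp [extι]
  | add a b ha hb =>
    simp only [map_add, add_mul, mul_add]
    calc _ = extι k V R a * extι k V R a + extι k V R b * extι k V R b +
          (extι k V R a * extι k V R b + extι k V R b * extι k V R a) := by abel
      _ = 0 := by rw [ha, hb, extι_swap, add_zero, add_zero]

lemma extEnd_commute (φ : ExteriorAlgebra k V →ₐ[k] R ⊗[k] ExteriorAlgebra k V) (r : R)
    (y : ExteriorAlgebra k V) :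
    Commute (Algebra.ofId R (R ⊗[k] ExteriorAlgebra k V) r) (φ y) :=
  Algebra.commutes r _

/-- The algebra endomorphism of `R ⊗ ∧V = ∧(R ⊗ V)` induced by an endomorphism of `R ⊗ V`. -/
def extEnd (f : Module.End R (R ⊗[k] V)) :
    R ⊗[k] ExteriorAlgebra k V →ₐ[R] R ⊗[k] ExteriorAlgebra k V :=
  Algebra.TensorProduct.lift (Algebra.ofId R _)
    (ExteriorAlgebra.lift k
      ⟨((extι k V R ∘ₗ f).restrictScalars k) ∘ₗ TensorProduct.mk k R V 1,
        fun _ => extι_sq _⟩)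
    (extEnd_commute _)

lemma extEnd_extι (f : Module.End R (R ⊗[k] V)) (x : R ⊗[k] V) :
    extEnd f (extι k V R x) = extι k V R (f x) := by
  induction x with
  | zero => simp
  | add a b ha hb => simp only [map_add, ha, hb]
  | tmul r a =>
    have h : r ⊗ₜ[k] a = r • ((1 : R) ⊗ₜ[k] a) := by simp [TensorProduct.smul_tmul']
    rw [h, map_smul, map_smul, map_smul, map_smul]
    congr 1
    have h1 : (1 : R) ⊗ₜ[k] (1 : ExteriorAlgebra k V) = 1 := rfl
    simp [extEnd, extι, h1]

lemma ext_algHom {A : Type*} [Ring A] [Algebra R A]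
    {φ ψ : R ⊗[k] ExteriorAlgebra k V →ₐ[R] A}
    (h : ∀ x, φ (extι k V R x) = ψ (extι k V R x)) : φ = ψ := by
  let _ : Algebra k A := Algebra.compHom A (algebraMap k R)
  have : IsScalarTower k R A := IsScalarTower.of_algebraMap_eq fun _ => rfl
  refine Algebra.TensorProduct.ext (Subsingleton.elim _ _) ?_
  apply ExteriorAlgebra.hom_ext
  ext v
  simpa [extι] using h (1 ⊗ₜ v)

lemma extEnd_one : extEnd (1 : Module.End R (R ⊗[k] V)) = AlgHom.id R _ :=
  ext_algHom fun x => by simp [extEnd_extι]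

lemma extEnd_mul (f g : Module.End R (R ⊗[k] V)) :
    extEnd (f * g) = (extEnd f).comp (extEnd g) :=
  ext_algHom fun x => by simp [extEnd_extι]

lemma extι_rTensor {S : Type u} [CommRing S] [Algebra k S] (f : R →ₐ[k] S) (x : R ⊗[k] V) :
    Algebra.TensorProduct.map f (AlgHom.id k (ExteriorAlgebra k V)) (extι k V R x) =
      extι k V S (f.toLinearMap.rTensor V x) := by
  induction x with
  | zero => simp
  | tmul r v => simp [extι]
  | add x y hx hy => simp only [map_add, hx, hy]

/-- The exterior algebra `∧V` of a representation. -/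
def exterior (ρ : AlgRep G V) : AlgRep G (ExteriorAlgebra k V) where
  act R _ _ :=
    { toFun := fun g => (extEnd (ρ.act R g)).toLinearMap
      map_one' := by rw [map_one, extEnd_one]; rfl
      map_mul' := fun g h => by rw [map_mul, extEnd_mul]; rfl }
  natural {R S} _ _ _ _ f g x := by
    have key : ((Algebra.TensorProduct.map f (AlgHom.id k (ExteriorAlgebra k V))).comp
          ((extEnd (ρ.act R g)).restrictScalars k)) =
        ((extEnd (ρ.act S (G.map f g))).restrictScalars k).comp
          (Algebra.TensorProduct.map f (AlgHom.id k (ExteriorAlgebra k V))) := by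
      refine Algebra.TensorProduct.ext ?_ ?_
      · ext r
        have h1 : (r ⊗ₜ[k] (1 : ExteriorAlgebra k V)) = algebraMap R _ r := rfl
        have h2 : (f r ⊗ₜ[k] (1 : ExteriorAlgebra k V)) = algebraMap S _ (f r) := rfl
        simp only [AlgHom.comp_apply, Algebra.TensorProduct.includeLeft_apply,
          AlgHom.restrictScalars_apply, Algebra.TensorProduct.map_tmul, map_one]
        rw [h1, AlgHom.commutes, h2, AlgHom.commutes, ← h1, ← h2]
        simp
      · apply ExteriorAlgebra.hom_ext
        ext v
        have h1 : ((1 : R) ⊗ₜ[k] ExteriorAlgebra.ι k v) = extι k V R (1 ⊗ₜ v) := rfl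
        simp only [LinearMap.comp_apply, AlgHom.toLinearMap_apply, AlgHom.comp_apply,
          Algebra.TensorProduct.includeRight_apply, AlgHom.restrictScalars_apply]
        rw [h1, extEnd_extι, extι_rTensor, extι_rTensor, extEnd_extι, ρ.natural]
    exact DFunLike.congr_fun key x

end Exterior

/-- Base change `K ⊗ V` of a representation from `k` to a `k`-algebra `K`: for a `K`-algebra `R`,
`G(R)` acts on `R ⊗[K] (K ⊗[k] V) = R ⊗[k] V`. -/
def baseChange (ρ : AlgRep G V) (K : Type u) [CommRing K] [Algebra k K] :
    AlgRep (G.baseChange K) (K ⊗[k] V) where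
  act R _ _ :=
    letI : Algebra k R := Algebra.compHom R (algebraMap k K)
    haveI : IsScalarTower k K R := IsScalarTower.of_algebraMap_eq fun _ => rfl
    { toFun := fun g =>
        (TensorProduct.AlgebraTensorModule.cancelBaseChange k K R R V).symm.conj (ρ.act R g)
      map_one' := by
        refine LinearMap.ext fun x => ?_
        have h : ρ.act R (1 : G.pts R) = 1 := map_one _
        exact (congrArg (fun z => (TensorProduct.AlgebraTensorModule.cancelBaseChange
          k K R R V).symm.conj z x) h).trans (by simp [LinearEquiv.conj_apply])
      map_mul' := fun g h => by
        refine LinearMap.ext fun x => ?_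
        have h' : ρ.act R ((show G.pts R from g) * (show G.pts R from h)) =
          ρ.act R g * ρ.act R h := map_mul _ _ _
        exact (congrArg (fun z => (TensorProduct.AlgebraTensorModule.cancelBaseChange
          k K R R V).symm.conj z x) h').trans (by simp [LinearEquiv.conj_apply]) }
  natural {R S} _ _ _ _ f g x := by
    let _ : Algebra k R := Algebra.compHom R (algebraMap k K)
    have : IsScalarTower k K R := IsScalarTower.of_algebraMap_eq fun _ => rfl
    let _ : Algebra k S := Algebra.compHom S (algebraMap k K)
    have : IsScalarTower k K S := IsScalarTower.of_algebraMap_eq fun _ => rfl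
    let f' : R →ₐ[k] S := AlgHom.mk f.toRingHom fun r => f.commutes (algebraMap k K r)
    have key : ∀ y : R ⊗[K] (K ⊗[k] V),
        TensorProduct.AlgebraTensorModule.cancelBaseChange k K S S V
          (f.toLinearMap.rTensor (K ⊗[k] V) y) =
        f'.toLinearMap.rTensor V
          (TensorProduct.AlgebraTensorModule.cancelBaseChange k K R R V y) := by
      intro y
      induction y with
      | zero => simp
      | add a b ha hb => simp only [map_add, ha, hb]
      | tmul r z =>
        induction z with
        | zero => simp
        | add a b ha hb => simp only [TensorProduct.tmul_add, map_add, ha, hb]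
        | tmul c v => simp [f']
    apply (TensorProduct.AlgebraTensorModule.cancelBaseChange k K S S V).injective
    rw [key]
    have := ρ.natural f' g (TensorProduct.AlgebraTensorModule.cancelBaseChange k K R R V x)
    simp only [MonoidHom.coe_mk, OneHom.coe_mk, LinearEquiv.conj_apply, LinearMap.comp_apply,
      LinearEquiv.coe_coe, LinearEquiv.symm_symm, LinearEquiv.apply_symm_apply, key]
    exact this

end General

end AlgRep

/-! # The unitary group -/

/-- The (rational) data defining the unitary group: a positive involution `conj` of `E`, and a
non-degenerate alternating form on the `E`-vector space `𝔙` for which `conj` is the adjunction. -/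
structure UnitaryDatum (E : Type u) (𝔙 : Type v) [Field E] [CharZero E] [AddCommGroup 𝔙]
    [Module E 𝔙] [Module ℚ 𝔙] where
  conj : E ≃ₐ[ℚ] E
  conj_conj : ∀ x, conj (conj x) = x
  conj_pos : ∀ x, x ≠ 0 → 0 < Algebra.trace ℚ E (x * conj x)
  form : LinearMap.BilinForm ℚ 𝔙
  form_alt : form.IsAlt
  form_nondegenerate : form.Nondegenerate
  form_smul : ∀ (b : E) (v w : 𝔙), form (b • v) w = form v (conj b • w)

namespace UnitaryDatum

variable {E : Type u} {𝔙 : Type u} [Field E] [CharZero E] [AddCommGroup 𝔙]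
  [Module E 𝔙] [Module ℚ 𝔙] [IsScalarTower ℚ E 𝔙]

section Group

variable (E 𝔙)
variable (R : Type u) [CommRing R] [Algebra ℚ R]

/-- `E`-linear endomorphisms of `𝔙`, regarded as `ℚ`-linear ones. -/
def restrict : Module.End E 𝔙 →ₐ[ℚ] Module.End ℚ 𝔙 where
  toFun c := c.restrictScalars ℚ
  map_one' := rfl
  map_mul' _ _ := rfl
  map_zero' := rfl
  map_add' _ _ := rfl
  commutes' _ := rfl

lemma std_commute (r : R) (c : Module.End E 𝔙) :
    Commute (Algebra.ofId R (Module.End R (R ⊗[ℚ] 𝔙)) r)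
      (((Module.End.baseChangeHom ℚ R 𝔙).comp (restrict E 𝔙)) c) :=
  Algebra.commutes r _

/-- The action of `R ⊗ C`, with `C = End_E(𝔙)`, on `R ⊗ 𝔙`. -/
def std : R ⊗[ℚ] Module.End E 𝔙 →ₐ[R] Module.End R (R ⊗[ℚ] 𝔙) :=
  Algebra.TensorProduct.lift (Algebra.ofId R _)
    ((Module.End.baseChangeHom ℚ R 𝔙).comp (restrict E 𝔙))
    (std_commute E 𝔙 R)

/-- The transposed action of `R ⊗ C`, with `C = End_E(𝔙)`, on `R ⊗ 𝔙ᵛ`. -/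
def transpose : R ⊗[ℚ] Module.End E 𝔙 →ₗ[R] Module.End R (R ⊗[ℚ] Module.Dual ℚ 𝔙) :=
  LinearMap.liftBaseChange R
    ((Module.End.baseChangeHom ℚ R (Module.Dual ℚ 𝔙)).toLinearMap ∘ₗ
      Module.Dual.transpose (R := ℚ) (M := 𝔙) (M' := 𝔙) ∘ₗ (restrict E 𝔙).toLinearMap)

variable {E 𝔙 R}

lemma std_tmul (r t : R) (c : Module.End E 𝔙) (v : 𝔙) :
    std E 𝔙 R (r ⊗ₜ c) (t ⊗ₜ v) = (r * t) ⊗ₜ c v := by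
  rw [std, Algebra.TensorProduct.lift_tmul, Algebra.ofId_apply, ← Algebra.smul_def,
    LinearMap.smul_apply]
  change r • (LinearMap.baseChange R (restrict E 𝔙 c)) (t ⊗ₜ v) = _
  rw [LinearMap.baseChange_tmul, TensorProduct.smul_tmul', smul_eq_mul]
  rfl

lemma transpose_tmul (r t : R) (c : Module.End E 𝔙) (φ : Module.Dual ℚ 𝔙) :
    transpose E 𝔙 R (r ⊗ₜ c) (t ⊗ₜ φ) = (r * t) ⊗ₜ (φ ∘ₗ restrict E 𝔙 c) := by
  rw [transpose, LinearMap.liftBaseChange_tmul, LinearMap.smul_apply]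
  change r • (LinearMap.baseChange R (Module.Dual.transpose (R := ℚ) (restrict E 𝔙 c)))
    (t ⊗ₜ φ) = _
  rw [LinearMap.baseChange_tmul, TensorProduct.smul_tmul', smul_eq_mul]
  rfl

lemma transpose_one : transpose E 𝔙 R 1 = 1 := by
  refine LinearMap.ext fun x => ?_
  induction x with
  | zero => simp
  | add a b ha hb => simp only [map_add, ha, hb]
  | tmul t φ =>
    have h1 : (1 : R ⊗[ℚ] Module.End E 𝔙) = 1 ⊗ₜ 1 := rfl
    rw [h1, transpose_tmul, one_mul]
    rfl

lemma transpose_mul (x y : R ⊗[ℚ] Module.End E 𝔙) :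
    transpose E 𝔙 R (x * y) = transpose E 𝔙 R y * transpose E 𝔙 R x := by
  induction x with
  | zero => simp
  | add a b ha hb => simp only [map_add, add_mul, mul_add, ha, hb]
  | tmul r c =>
    induction y with
    | zero => simp
    | add a b ha hb => simp only [map_add, add_mul, mul_add, ha, hb]
    | tmul t d =>
      refine LinearMap.ext fun z => ?_
      induction z with
      | zero => simp
      | add a b ha hb => simp only [map_add, ha, hb]
      | tmul w φ =>
        rw [Algebra.TensorProduct.tmul_mul_tmul, Module.End.mul_apply, transpose_tmul,
          transpose_tmul, transpose_tmul, ← mul_assoc, mul_comm r t]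
        rfl

lemma std_natural {S : Type u} [CommRing S] [Algebra ℚ S] (f : R →ₐ[ℚ] S)
    (c : R ⊗[ℚ] Module.End E 𝔙) (x : R ⊗[ℚ] 𝔙) :
    f.toLinearMap.rTensor 𝔙 (std E 𝔙 R c x) =
      std E 𝔙 S (Algebra.TensorProduct.map f (AlgHom.id ℚ _) c) (f.toLinearMap.rTensor 𝔙 x) := by
  induction c with
  | zero => simp
  | add a b ha hb => simp only [map_add, LinearMap.add_apply, ha, hb]
  | tmul r c =>
    induction x with
    | zero => simp
    | add a b ha hb => simp only [map_add, ha, hb]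
    | tmul t v => simp [std_tmul]

lemma transpose_natural {S : Type u} [CommRing S] [Algebra ℚ S] (f : R →ₐ[ℚ] S)
    (c : R ⊗[ℚ] Module.End E 𝔙) (x : R ⊗[ℚ] Module.Dual ℚ 𝔙) :
    f.toLinearMap.rTensor _ (transpose E 𝔙 R c x) =
      transpose E 𝔙 S (Algebra.TensorProduct.map f (AlgHom.id ℚ _) c)
        (f.toLinearMap.rTensor _ x) := by
  induction c with
  | zero => simp
  | add a b ha hb => simp only [map_add, LinearMap.add_apply, ha, hb]
  | tmul r c =>
    induction x with
    | zero => simp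
    | add a b ha hb => simp only [map_add, ha, hb]
    | tmul t v => simp [transpose_tmul]

variable (D : UnitaryDatum E 𝔙)

/-- The unit `c` of `R ⊗ C` is a similitude of `R ⊗ 𝔙`, of multiplier `μ`. -/
def IsSimilitude (c : (R ⊗[ℚ] Module.End E 𝔙)ˣ) (μ : Rˣ) : Prop :=
  ∀ x y : R ⊗[ℚ] 𝔙, D.form.baseChange R (std E 𝔙 R c x) (std E 𝔙 R c y) =
    μ * D.form.baseChange R x y

lemma form_natural {S : Type u} [CommRing S] [Algebra ℚ S] (f : R →ₐ[ℚ] S) (x y : R ⊗[ℚ] 𝔙) :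
    D.form.baseChange S (f.toLinearMap.rTensor 𝔙 x) (f.toLinearMap.rTensor 𝔙 y) =
      f (D.form.baseChange R x y) := by
  induction x with
  | zero => simp
  | add a b ha hb => simp only [map_add, LinearMap.add_apply, ha, hb]
  | tmul r v =>
    induction y with
    | zero => simp
    | add a b ha hb => simp only [map_add, ha, hb]
    | tmul t w => simp

lemma IsSimilitude.map {S : Type u} [CommRing S] [Algebra ℚ S] (f : R →ₐ[ℚ] S)
    {c : (R ⊗[ℚ] Module.End E 𝔙)ˣ} {μ : Rˣ} (h : D.IsSimilitude c μ) :
    D.IsSimilitude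
      (Units.map (Algebra.TensorProduct.map f (AlgHom.id ℚ (Module.End E 𝔙)) : _ →* _) c)
      (Units.map (f : R →* S) μ) := by
  intro x y
  induction x with
  | zero => simp
  | add a b ha hb => simp only [map_add, LinearMap.add_apply, ha, hb, mul_add]
  | tmul r v =>
    induction y with
    | zero => simp
    | add a b ha hb => simp only [map_add, ha, hb, mul_add]
    | tmul t w =>
      have e : ∀ (r : S) (v : 𝔙), r ⊗ₜ[ℚ] v =
          r • f.toLinearMap.rTensor 𝔙 ((1 : R) ⊗ₜ[ℚ] v) := by
        intro r v
        simp [TensorProduct.smul_tmul']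
      have e' : ((Units.map (Algebra.TensorProduct.map f
          (AlgHom.id ℚ (Module.End E 𝔙)) : _ →* _) c : (S ⊗[ℚ] Module.End E 𝔙)ˣ) :
          S ⊗[ℚ] Module.End E 𝔙) = Algebra.TensorProduct.map f (AlgHom.id ℚ _) (c : _) := rfl
      have e'' : ((Units.map (f : R →* S) μ : Sˣ) : S) = f μ := rfl
      rw [e r v, e t w, e', e'']
      simp only [map_smul, LinearMap.smul_apply]
      rw [← std_natural, ← std_natural, form_natural, form_natural, h, map_mul]
      simp only [smul_eq_mul]
      ring

variable (R)

/-- `G(R)`: the units `c` of `R ⊗ C` such that `(cv, cw) = μ (v, w)` for some `μ ∈ Rˣ`. -/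
def similitudes : Subgroup (R ⊗[ℚ] Module.End E 𝔙)ˣ where
  carrier := {c | ∃ μ : Rˣ, D.IsSimilitude c μ}
  one_mem' := ⟨1, fun x y => by simp⟩
  mul_mem' := by
    rintro c d ⟨μ, hc⟩ ⟨μ', hd⟩
    refine ⟨μ * μ', fun x y => ?_⟩
    have := hc (std E 𝔙 R d x) (std E 𝔙 R d y)
    rw [hd] at this
    simpa [mul_assoc] using this
  inv_mem' := by
    rintro c ⟨μ, hc⟩
    refine ⟨μ⁻¹, fun x y => ?_⟩
    have e : ∀ z, std E 𝔙 R (c : _) (std E 𝔙 R ((c⁻¹ : (R ⊗[ℚ] Module.End E 𝔙)ˣ) : _) z) = z := by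
      intro z
      rw [← Module.End.mul_apply, ← map_mul, Units.mul_inv, map_one, Module.End.one_apply]
    have := hc (std E 𝔙 R ((c⁻¹ : (R ⊗[ℚ] Module.End E 𝔙)ˣ) : _) x)
      (std E 𝔙 R ((c⁻¹ : (R ⊗[ℚ] Module.End E 𝔙)ˣ) : _) y)
    rw [e, e] at this
    rw [this, ← mul_assoc, Units.inv_mul, one_mul]

/-- The unitary similitude group `G` over `ℚ`. -/
def group : GroupFunctor.{u, 0} ℚ where
  pts R _ _ := D.similitudes R
  grp R _ _ := inferInstance
  map {R S} _ _ _ _ f :=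
    ((Units.map (Algebra.TensorProduct.map f
      (AlgHom.id ℚ (Module.End E 𝔙)) : _ →* _)).comp (D.similitudes R).subtype).codRestrict
      (D.similitudes S) (fun c => by
        obtain ⟨μ, hμ⟩ := c.2
        exact ⟨_, hμ.map D f⟩)
  map_id R _ _ c := by
    refine Subtype.ext (Units.ext ?_)
    change Algebra.TensorProduct.map (AlgHom.id ℚ R) (AlgHom.id ℚ (Module.End E 𝔙)) _ = _
    rw [Algebra.TensorProduct.map_id]
    rfl
  map_comp {R S T} _ _ _ _ _ _ f' f c := by
    refine Subtype.ext (Units.ext ?_)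
    change Algebra.TensorProduct.map (f'.comp f) (AlgHom.id ℚ (Module.End E 𝔙)) _ =
      Algebra.TensorProduct.map f' (AlgHom.id ℚ (Module.End E 𝔙))
        (Algebra.TensorProduct.map f (AlgHom.id ℚ (Module.End E 𝔙)) _)
    rw [← AlgHom.comp_apply, ← Algebra.TensorProduct.map_comp, AlgHom.id_comp]

/-- `G` over `E`. -/
abbrev groupE : GroupFunctor.{u, u} E := D.group.baseChange E

/-- The representation `𝒱₀ ⊗ ℚ` of `G`: the dual of the standard representation. -/
def dualRep : AlgRep D.group (Module.Dual ℚ 𝔙) where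
  act R _ _ :=
    { toFun := fun c => transpose E 𝔙 R ((c.1⁻¹ : (R ⊗[ℚ] Module.End E 𝔙)ˣ) : _)
      map_one' := by
        change transpose E 𝔙 R (((1 : (R ⊗[ℚ] Module.End E 𝔙)ˣ)⁻¹ :
          (R ⊗[ℚ] Module.End E 𝔙)ˣ) : _) = 1
        rw [inv_one, Units.val_one, transpose_one]
      map_mul' := fun c d => by
        change transpose E 𝔙 R (((c.1 * d.1)⁻¹ : (R ⊗[ℚ] Module.End E 𝔙)ˣ) : _) = _
        rw [mul_inv_rev, Units.val_mul, transpose_mul] }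
  natural {R S} _ _ _ _ f c x := by
    have := transpose_natural f ((c.1⁻¹ : (R ⊗[ℚ] Module.End E 𝔙)ˣ) : R ⊗[ℚ] Module.End E 𝔙) x
    refine this.trans ?_
    rfl

/-- The representation `∧ (𝒱₀ ⊗ ℚ) ^ s` of `G`. -/
abbrev extRep (s : ℕ) :
    AlgRep D.group (ExteriorAlgebra ℚ (Fin s → Module.Dual ℚ 𝔙)) :=
  (D.dualRep.pow s).exterior

end Group

/-! ## The algebra `E(A)_s ⊗ ℚ` and the representations it cuts out -/

section Algebra

variable (𝔙) in
/-- The exterior algebra `∧ (𝒱₀ ⊗ ℚ) ^ s`. -/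
abbrev Ext (s : ℕ) : Type u := ExteriorAlgebra ℚ (Fin s → Module.Dual ℚ 𝔙)

variable (𝔙) in
/-- The action of `M_s(ℤ)` on `∧ (𝒱₀ ⊗ ℚ) ^ s`. -/
def matrixAct (s : ℕ) (m : Matrix (Fin s) (Fin s) ℤ) : Module.End ℚ (Ext 𝔙 s) :=
  (ExteriorAlgebra.map (LinearMap.pi fun l => ∑ l' : Fin s, m l l' •
    (LinearMap.proj l' : (Fin s → Module.Dual ℚ 𝔙) →ₗ[ℚ] Module.Dual ℚ 𝔙))).toLinearMap

variable (𝔙) in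
/-- The action `u(z)` of `z ∈ E` on `𝒱₀ ⊗ ℚ`. -/
def scalarAct (z : E) : Module.End ℚ (Module.Dual ℚ 𝔙) :=
  Module.Dual.transpose (R := ℚ) (Algebra.lsmul ℚ ℚ 𝔙 z)

variable (𝔙) in
/-- The action of `z ∈ E` on `∧ (𝒱₀ ⊗ ℚ) ^ s`. -/
def scalarExtAct (s : ℕ) (z : E) : Module.End ℚ (Ext 𝔙 s) :=
  (ExteriorAlgebra.map (LinearMap.compLeft (scalarAct 𝔙 z) (Fin s))).toLinearMap

variable (𝔙) in
/-- The algebra `E(A)_s ⊗ ℚ`, as an algebra of endomorphisms of `∧ (𝒱₀ ⊗ ℚ) ^ s`: the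
`ℚ`-subalgebra generated by the actions of `M_s(ℤ)` and of the order `O` of `E`. -/
def EA (O : Subring E) (s : ℕ) : Subalgebra ℚ (Module.End ℚ (Ext 𝔙 s)) :=
  Algebra.adjoin ℚ (Set.range (matrixAct 𝔙 s) ∪ scalarExtAct 𝔙 s '' (O : Set E))

variable (𝔙) in
/-- `q` is a homogeneous projector of degree `t` in `E(A)_s ⊗ ℚ`. -/
def IsHomogeneousProjector (O : Subring E) (s t : ℕ) (q : Module.End ℚ (Ext 𝔙 s)) : Prop :=
  q ∈ EA 𝔙 O s ∧ IsIdempotentElem q ∧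
    LinearMap.range q ≤ ⋀[ℚ]^t (Fin s → Module.Dual ℚ 𝔙)

lemma matrixAct_one (s : ℕ) : matrixAct 𝔙 s 1 = 1 := by
  have : (LinearMap.pi fun l => ∑ l' : Fin s, (1 : Matrix (Fin s) (Fin s) ℤ) l l' •
    (LinearMap.proj l' : (Fin s → Module.Dual ℚ 𝔙) →ₗ[ℚ] Module.Dual ℚ 𝔙)) = LinearMap.id := by
    refine LinearMap.ext fun v => funext fun l => ?_
    simp [Matrix.one_apply, ite_smul]
  rw [matrixAct, this, ExteriorAlgebra.map_id]
  rfl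

lemma matrixAct_mul (s : ℕ) (m n : Matrix (Fin s) (Fin s) ℤ) :
    matrixAct 𝔙 s (m * n) = matrixAct 𝔙 s m * matrixAct 𝔙 s n := by
  rw [matrixAct, matrixAct, matrixAct, Module.End.mul_eq_comp, ← AlgHom.comp_toLinearMap,
    ExteriorAlgebra.map_comp_map]
  congr 2
  refine LinearMap.ext fun v => funext fun l => ?_
  simp only [LinearMap.pi_apply, LinearMap.sum_apply, LinearMap.smul_apply, LinearMap.proj_apply,
    LinearMap.comp_apply, Matrix.mul_apply, Finset.sum_smul, Finset.smul_sum, mul_smul]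
  exact Finset.sum_comm

variable (𝔙) in
/-- The action of `ℚ[𝔖_s]` on `∧ (𝒱₀ ⊗ ℚ) ^ s`, through permutation matrices. -/
def symAct (s : ℕ) : MonoidAlgebra ℚ (Equiv.Perm (Fin s)) →ₐ[ℚ] Module.End ℚ (Ext 𝔙 s) :=
  MonoidAlgebra.lift ℚ _ _
    { toFun := fun σ => matrixAct 𝔙 s (σ⁻¹.permMatrix ℤ)
      map_one' := by rw [inv_one, Matrix.permMatrix_one, matrixAct_one]
      map_mul' := fun σ τ => by rw [mul_inv_rev, Matrix.permMatrix_mul, matrixAct_mul] }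

variable (D : UnitaryDatum E 𝔙)

/-- `Rep^a_ℚ(G)`: representations isomorphic to a finite direct sum of images `im q`, where `q` is
a homogeneous projector of some `E(A)_s ⊗ ℚ`, `s ≥ 1`, and `im q` is viewed as a
subrepresentation of `∧ (𝒱₀ ⊗ ℚ) ^ s`. -/
def IsAttainable (O : Subring E) {W : Type v} [AddCommGroup W] [Module ℚ W]
    (ρ : AlgRep D.group W) : Prop :=
  ∃ (n : ℕ) (s t : Fin n → ℕ) (q : ∀ m, Module.End ℚ (Ext 𝔙 (s m))),
    (∀ m, 1 ≤ s m ∧ IsHomogeneousProjector 𝔙 O (s m) (t m) (q m)) ∧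
    ∃ f : W ≃ₗ[ℚ] (∀ m, LinearMap.range (q m)), ∀ m,
      AlgRep.IsEquivariant ρ (D.extRep (s m))
        ((LinearMap.range (q m)).subtype ∘ₗ LinearMap.proj m ∘ₗ f.toLinearMap)

/-- `Rep^a_E(G)`: representations isomorphic to `W ⊗ E` with `W` in `Rep^a_ℚ(G)`. -/
def IsAttainableE (O : Subring E) {V : Type v} [AddCommGroup V] [Module E V]
    (ρ : AlgRep D.groupE V) : Prop :=
  ∃ (W : Type u) (_ : AddCommGroup W) (_ : Module ℚ W) (ρW : AlgRep D.group W),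
    D.IsAttainable O ρW ∧ AlgRep.IsIso ρ (ρW.baseChange E)

end Algebra

/-! ## `V₀ = V₁ ⊕ V₂`, tensor powers, and highest weights -/

section Weights

variable (𝔙) in
/-- `V₀ = 𝒱₀ ⊗ E`. -/
abbrev V0 (E : Type u) [Field E] [CharZero E] : Type u := E ⊗[ℚ] Module.Dual ℚ 𝔙

variable (𝔙) in
/-- The subspace of `V₀` on which `u(z)` has eigenvalue `i(z)` for all `z ∈ E`. -/
def eigenPart (i : E →ₐ[ℚ] E) : Submodule E (V0 𝔙 E) :=
  ⨅ z : E, LinearMap.ker ((scalarAct 𝔙 z).baseChange E - i z • LinearMap.id)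

/-- The subspace `W ^ ⊗ s` of `V₀ ^ ⊗ s ⊆ ∧ V₀ ^ s = E ⊗ ∧ (𝒱₀ ⊗ ℚ) ^ s`, for a subspace `W` of
`V₀`: it is spanned by the products `w₁ ∧ ⋯ ∧ w_s`, where `w_l ∈ W` is placed in the `l`-th copy
of `V₀` in `V₀ ^ s`. -/
def tensorPart (s : ℕ) (W : Submodule E (V0 𝔙 E)) : Submodule E (E ⊗[ℚ] Ext 𝔙 s) :=
  Submodule.span E {x | ∃ w : Fin s → V0 𝔙 E, (∀ l, w l ∈ W) ∧
    x = (List.ofFn fun l => (ExteriorAlgebra.ι ℚ ∘ₗ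
      LinearMap.single ℚ (fun _ : Fin s => Module.Dual ℚ 𝔙) l).baseChange E (w l)).prod}

variable (D : UnitaryDatum E 𝔙)

/-- The multiplier of `x ∈ G(R)` on `𝔙` is `μ`, for an `E`-algebra `R`. -/
def HasMultiplier {R : Type u} [CommRing R] [Algebra E R] (x : D.groupE.pts R) (μ : Rˣ) : Prop :=
  letI : Algebra ℚ R := Algebra.compHom R (algebraMap ℚ E)
  D.IsSimilitude (show D.similitudes R from x).1 μ

/-- The isomorphism `G_E ≅ GL_g × 𝔾_m` attached to a basis `b` of an eigenspace `V₁` of `V₀` is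
given by the action on `V₁` and the multiplier `ν` of the action on `V₀` (the inverse of the
multiplier on `𝔙`). This says that `x` corresponds to an upper triangular matrix with
diagonal `t`, and to `ν`; i.e. that `x` is in the standard Borel subgroup, with image `(t, ν)` in
the torus. -/
def IsUpperTriangular {g : ℕ} {V₁ : Submodule E (V0 𝔙 E)} (b : Module.Basis (Fin g) E V₁)
    {R : Type u} [CommRing R] [Algebra E R] (x : D.groupE.pts R) (t : Fin g → Rˣ) (ν : Rˣ) :
    Prop :=
  D.HasMultiplier x ν⁻¹ ∧ ∀ l : Fin g,
    (D.dualRep.baseChange E).act R x (1 ⊗ₜ (b l : V0 𝔙 E)) - (t l : R) • (1 ⊗ₜ (b l : V0 𝔙 E)) ∈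
      Submodule.span R ((fun l' : Fin g => (1 : R) ⊗ₜ[E] (b l' : V0 𝔙 E)) '' {l' | l' < l})

/-- The representation `V` of `G_E` is the irreducible representation of highest weight
`(a₁, …, a_g; c)`: it is finite-dimensional and irreducible, and has a non-zero vector on which the
standard Borel subgroup acts through the weight `(t, ν) ↦ t₁ ^ a₁ ⋯ t_g ^ a_g ν ^ n`, where
`c = ∑ a_l + 2 n`. In this normalization the scalars act by `x ↦ x ^ c`, since a scalar `x` of `V₀`
has multiplier `ν = x ^ 2`. -/
def IsIrreducibleOfHighestWeight {g : ℕ} {V₁ : Submodule E (V0 𝔙 E)}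
    (b : Module.Basis (Fin g) E V₁) {V : Type v} [AddCommGroup V] [Module E V]
    (ρ : AlgRep D.groupE V) (a : Fin g → ℤ) (c : ℤ) : Prop :=
  Module.Finite E V ∧ ρ.IsIrreducible ∧
    ∃ n : ℤ, c = (∑ l, a l) + 2 * n ∧ ∃ v : V, v ≠ 0 ∧
      ∀ (R : Type u) [CommRing R] [Algebra E R] (x : D.groupE.pts R) (t : Fin g → Rˣ) (ν : Rˣ),
        D.IsUpperTriangular b x t ν →
        ρ.act R x (1 ⊗ₜ v) = (((∏ l, t l ^ a l) * ν ^ n : Rˣ) : R) • (1 ⊗ₜ v)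

end Weights

end UnitaryDatum

end

/-!
Over `E` the standard representation splits as `V₀ = V₁ ⊕ V₂`, and a point of `G_E` is determined
by the matrix `A` of its action on `V₁` and its multiplier `ν` on `V₀`; on `V₂`, in the dual basis,
it acts through `ν` times the contragredient of `A`. This gives the parametrization of `G_E` by
`GL_g × 𝔾_m` (`UnitaryDatum.Frame.param`, `Frame.act_basis`, `Frame.isUpperTriangular_iff`). Every
invertible matrix thus occurs in the action on `V₁`, and in the action on `V₂`.

Let `C` be the rational multiple of the Young symmetrizer of `a` which is idempotent
(`IsTableau.exists_idempotent`). Inside the exterior algebra of `V₀ ^ s` the symmetric group acts on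
`V₀ ^ ⊗ s` through the usual permutations twisted by the sign, so that rows and columns of the
diagram are exchanged in the definition of `C`. That `C V₁ ^ ⊗ s` and `C V₂ ^ ⊗ s` are irreducible
is Schur–Weyl duality, in a form adapted to representations of group functors: a stable subspace
is preserved by the points over rings of formal power series, and the coefficient of `∏ T_i` in the
action of `1 + ∑ T_i e_i` is a symmetrized tensor product of elementary matrices
(`TensorCoord.range_le_of_stable`). The column antisymmetrization of the tensor with entry `l` in
row `l` is a vector of highest weight `a`, since among the fillings which are injective on columns
it has the smallest entries (`TensorCoord.prod_mul_symmetrizer_single_row`); for `V₂`, with the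
order of the basis reversed, the same vector has weight `a*`.

An irreducible representation of `G_E` is determined by its highest weight
(`AlgRep.isIso_of_haveCommonWeight`), so that nothing depends on the chosen models. A one-parameter
subgroup of the torus provides a non-zero linear form invariant under the lower unipotent matrices
(`AlgRep.exists_unipotent_invariant_form`). By the Gauss decomposition, the matrix coefficient of a
highest weight vector against such a form is determined on the power series points near the
identity, hence everywhere, by the weight and the value at the identity (`AlgRep.matrixCoeff_eq`).
For two irreducible representations of the same highest weight, the pairs of vectors with equal
matrix coefficients therefore form the graph of an isomorphism.

The projector onto `V₀ ^ ⊗ s` is a polynomial in the action of a diagonal matrix whose entries are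
distinct primes, which has a separate eigenvalue on each multihomogeneous type
(`UnitaryDatum.exists_tensor_projector`). The projector onto `V₁ ^ ⊗ s ⊕ V₂ ^ ⊗ s` is a rational
polynomial in the action of an element `z` of the order, chosen such that the eigenvalues `z ^ s`
and its conjugate differ from the eigenvalues on the mixed parts of `V₀ ^ ⊗ s`; this action commutes
with all generators (`SqrtGenerator.exists_central_projector`). For `s = 0` both representations are
trivial, and their sum is given by two copies of `∧⁰`.
-/

noncomputable section

/-! ### Young symmetrizers -/

/-- `row` and `col` number the elements of `X` by the boxes of the Young diagram with rows of
lengths `a`: the box of `x` is in row `row x` and in column `col x`, both counted from zero. -/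
structure IsTableau {X : Type*} {g : ℕ} (a : Fin g → ℕ) (row : X → Fin g) (col : X → ℕ) :
    Prop where
  inj : ∀ x y, row x = row y → col x = col y → x = y
  exists_box : ∀ l k, k < a l → ∃ x, row x = l ∧ col x = k
  col_lt : ∀ x, col x < a (row x)

namespace IsTableau

open Equiv

variable {X : Type*} [Fintype X] [DecidableEq X] {g : ℕ} {a : Fin g → ℕ} {row : X → Fin g}
  {col : X → ℕ}

lemma card_row_col_lt (h : IsTableau a row col) (l : Fin g) (j : ℕ) :
    (Finset.univ.filter fun x => row x = l ∧ col x < j).card = min (a l) j := by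
  rw [← Finset.card_range (min (a l) j)]
  refine Finset.card_bij (fun x _ => col x) ?_ ?_ ?_
  · intro x hx
    obtain ⟨-, rfl, hj⟩ := Finset.mem_filter.1 hx
    exact Finset.mem_range.2 (lt_min (h.col_lt x) hj)
  · intro x hx y hy hxy
    exact h.inj x y (((Finset.mem_filter.1 hx).2.1).trans ((Finset.mem_filter.1 hy).2.1).symm) hxy
  · intro k hk
    obtain ⟨hk, hj⟩ := lt_min_iff.1 (Finset.mem_range.1 hk)
    obtain ⟨x, hx, rfl⟩ := h.exists_box l k hk
    exact ⟨x, by simp [hx, hj], rfl⟩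

lemma card_row (h : IsTableau a row col) (l : Fin g) :
    (Finset.univ.filter fun x => row x = l).card = a l := by
  have := h.card_row_col_lt l (a l)
  rw [min_self] at this
  rw [← this]
  congr 1
  ext x
  simp only [Finset.mem_filter, Finset.mem_univ, true_and, iff_self_and]
  rintro rfl
  exact h.col_lt x

/-- If no two elements of a row are moved by `σ` into the same column, then `σ` moves the elements
of each row into columns which meet that row: the number of elements in the first `j` columns
is the largest possible, row by row. -/
lemma col_perm_lt (h : IsTableau a row col) (σ : Perm X)
    (hσ : ∀ x y, row x = row y → col (σ x) = col (σ y) → x = y) (x : X) :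
    col (σ x) < a (row x) := by
  set j := a (row x) with hj
  -- row by row, at most as many elements are moved into the first `j` columns as lie there
  have hle : ∀ l, (Finset.univ.filter fun x => row x = l ∧ col (σ x) < j).card ≤
      (Finset.univ.filter fun x => row x = l ∧ col x < j).card := by
    intro l
    rw [h.card_row_col_lt]
    refine le_min ?_ ?_
    · rw [← h.card_row l]
      exact Finset.card_le_card fun y hy => by
        simp only [Finset.mem_filter, Finset.mem_univ, true_and] at hy ⊢
        exact hy.1
    · conv_rhs => rw [← Finset.card_range j]
      refine Finset.card_le_card_of_injOn (fun y => col (σ y)) ?_ ?_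
      · intro y hy
        have := (Finset.mem_filter.1 hy).2.2
        simpa using this
      · intro y hy z hz hyz
        have hy := (Finset.mem_filter.1 hy).2.1
        have hz := (Finset.mem_filter.1 hz).2.1
        exact hσ y z (hy.trans hz.symm) hyz
  -- in total the two numbers agree, since `σ` is a bijection
  have hsum : ∑ l, (Finset.univ.filter fun x => row x = l ∧ col (σ x) < j).card =
      ∑ l, (Finset.univ.filter fun x => row x = l ∧ col x < j).card := by
    have e : ∀ f : X → ℕ, ∑ l, (Finset.univ.filter fun x => row x = l ∧ f x < j).card =
        (Finset.univ.filter fun x => f x < j).card := by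
      intro f
      rw [Finset.card_eq_sum_card_fiberwise (f := row) (t := Finset.univ) (fun _ _ => by simp)]
      refine Finset.sum_congr rfl fun l _ => congrArg _ ?_
      ext y
      simp [and_comm]
    rw [e, e]
    exact Finset.card_bij (fun y _ => σ y) (fun y hy => by simpa using hy)
      (fun y _ z _ hyz => σ.injective hyz)
      fun y hy => ⟨σ.symm y, by simpa using hy, by simp⟩
  have heq := (Finset.sum_eq_sum_iff_of_le fun l _ => hle l).1 hsum (row x) (Finset.mem_univ _)
  have hr := h.card_row (row x)
  rw [h.card_row_col_lt, ← hj, min_self] at heq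
  have hsub : (Finset.univ.filter fun y => row y = row x ∧ col (σ y) < j) =
      Finset.univ.filter fun y => row y = row x := by
    refine Finset.eq_of_subset_of_card_le (fun y hy => ?_) (hr.trans (hj ▸ heq.symm)).le
    simp only [Finset.mem_filter, Finset.mem_univ, true_and] at hy ⊢
    exact hy.1
  have : x ∈ Finset.univ.filter fun y => row y = row x ∧ col (σ y) < j := by
    rw [hsub]
    simp
  exact (Finset.mem_filter.1 this).2.2

/-- The permutations which preserve the fibres of a map; for the maps `row` and `col` these are
the row group and the column group. -/
def fiberPerms {α : Type*} [DecidableEq α] (f : X → α) : Finset (Perm X) :=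
  Finset.univ.filter fun σ => ∀ x, f (σ x) = f x

lemma mem_fiberPerms {α : Type*} [DecidableEq α] {f : X → α} {σ : Perm X} :
    σ ∈ fiberPerms f ↔ ∀ x, f (σ x) = f x := by simp [fiberPerms]

lemma mul_mem_fiberPerms {α : Type*} [DecidableEq α] {f : X → α} {σ τ : Perm X}
    (hσ : σ ∈ fiberPerms f) (hτ : τ ∈ fiberPerms f) : σ * τ ∈ fiberPerms f := by
  rw [mem_fiberPerms] at *
  intro x
  rw [Perm.mul_apply, hσ, hτ]

lemma inv_mem_fiberPerms {α : Type*} [DecidableEq α] {f : X → α} {σ : Perm X}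
    (hσ : σ ∈ fiberPerms f) : σ⁻¹ ∈ fiberPerms f := by
  rw [mem_fiberPerms] at *
  intro x
  rw [← hσ (σ⁻¹ x), Perm.inv_def, Equiv.apply_symm_apply]

lemma swap_mem_fiberPerms {α : Type*} [DecidableEq α] {f : X → α} {x y : X} (h : f x = f y) :
    swap x y ∈ fiberPerms f := by
  rw [mem_fiberPerms]
  intro z
  rw [swap_apply_def]
  split_ifs with h1 h2
  · rw [h1, h]
  · rw [h2, h]
  · rfl

lemma eq_one_of_mem (h : IsTableau a row col) {σ : Perm X} (hr : σ ∈ fiberPerms row)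
    (hc : σ ∈ fiberPerms col) : σ = 1 :=
  Perm.ext fun x => h.inj _ _ (mem_fiberPerms.1 hr x) (mem_fiberPerms.1 hc x)

/-- A permutation which does not move two elements of a row into the same column is the product
of a column permutation and a row permutation. -/
lemma exists_mul_of_col_inj (h : IsTableau a row col) (σ : Perm X)
    (hσ : ∀ x y, row x = row y → col (σ x) = col (σ y) → x = y) :
    ∃ q ∈ fiberPerms col, ∃ p ∈ fiberPerms row, σ = q * p := by
  choose p hp1 hp2 using fun x => h.exists_box (row x) (col (σ x)) (h.col_perm_lt σ hσ x)
  have hinj : Function.Injective p := by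
    intro x y hxy
    refine hσ x y ?_ ?_
    · rw [← hp1 x, hxy, hp1]
    · rw [← hp2 x, hxy, hp2]
  let π : Perm X := Equiv.ofBijective p (Finite.injective_iff_bijective.1 hinj)
  refine ⟨σ * π⁻¹, ?_, π, mem_fiberPerms.2 hp1, by simp⟩
  rw [mem_fiberPerms]
  intro x
  rw [Perm.mul_apply, ← hp2 (π⁻¹ x)]
  exact congrArg col (Equiv.apply_symm_apply π x)

variable (row col) in
/-- The sum of the column permutations times the signed sum of the row permutations. Columns are
symmetrized and rows are antisymmetrized: the symmetric group acts on tensors inside an exterior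
algebra with an additional sign, which exchanges the two. -/
def symmetrizer : MonoidAlgebra ℚ (Perm X) :=
  (∑ q ∈ fiberPerms col, MonoidAlgebra.single q 1) *
    ∑ p ∈ fiberPerms row, MonoidAlgebra.single p ((Perm.sign p : ℤ) : ℚ)

lemma single_mul_symmetrizer {q : Perm X} (hq : q ∈ fiberPerms col) :
    MonoidAlgebra.single q 1 * symmetrizer row col = symmetrizer row col := by
  have e : (MonoidAlgebra.single q 1 * ∑ q ∈ fiberPerms col, MonoidAlgebra.single q 1 :
      MonoidAlgebra ℚ (Perm X)) = ∑ q ∈ fiberPerms col, MonoidAlgebra.single q 1 := by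
    rw [Finset.mul_sum]
    refine Finset.sum_bij (fun q' _ => q * q') (fun q' hq' => mul_mem_fiberPerms hq hq')
      (fun _ _ _ _ e => mul_left_cancel e)
      (fun q' hq' => ⟨q⁻¹ * q', mul_mem_fiberPerms (inv_mem_fiberPerms hq) hq', by simp⟩)
      fun q' _ => by rw [MonoidAlgebra.single_mul_single, one_mul]
  rw [symmetrizer, ← mul_assoc, e]

lemma symmetrizer_mul_single {p : Perm X} (hp : p ∈ fiberPerms row) :
    symmetrizer row col * MonoidAlgebra.single p 1 =
      ((Perm.sign p : ℤ) : ℚ) • symmetrizer row col := by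
  have e : ((∑ p ∈ fiberPerms row, MonoidAlgebra.single p ((Perm.sign p : ℤ) : ℚ)) *
      MonoidAlgebra.single p 1 : MonoidAlgebra ℚ (Perm X)) = ((Perm.sign p : ℤ) : ℚ) •
        ∑ p ∈ fiberPerms row, MonoidAlgebra.single p ((Perm.sign p : ℤ) : ℚ) := by
    rw [Finset.sum_mul, Finset.smul_sum]
    refine Finset.sum_bij (fun p' _ => p' * p) (fun p' hp' => mul_mem_fiberPerms hp' hp)
      (fun _ _ _ _ e => mul_right_cancel e)
      (fun p' hp' => ⟨p' * p⁻¹, mul_mem_fiberPerms hp' (inv_mem_fiberPerms hp), by simp⟩)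
      fun p' _ => ?_
    rw [MonoidAlgebra.single_mul_single, mul_one, MonoidAlgebra.smul_single', Perm.sign_mul]
    congr 1
    rcases Int.units_eq_one_or (Perm.sign p) with e | e <;> simp [e]
  rw [symmetrizer, mul_assoc, e, mul_smul_comm]

/-- The elements with the symmetries of the Young symmetrizer are its multiples. -/
lemma eq_smul_symmetrizer (h : IsTableau a row col) (y : MonoidAlgebra ℚ (Perm X))
    (hq : ∀ q ∈ fiberPerms col, MonoidAlgebra.single q 1 * y = y)
    (hp : ∀ p ∈ fiberPerms row,
      y * MonoidAlgebra.single p 1 = ((Perm.sign p : ℤ) : ℚ) • y) :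
    (symmetrizer row col).coeff 1 • y = y.coeff 1 • symmetrizer row col := by
  have key : ∀ z : MonoidAlgebra ℚ (Perm X),
      (∀ q ∈ fiberPerms col, MonoidAlgebra.single q 1 * z = z) →
      (∀ p ∈ fiberPerms row,
        z * MonoidAlgebra.single p 1 = ((Perm.sign p : ℤ) : ℚ) • z) →
      ∀ q ∈ fiberPerms col, ∀ p ∈ fiberPerms row, ∀ σ,
        z.coeff (q * σ * p) = ((Perm.sign p : ℤ) : ℚ) * z.coeff σ := by
    intro z hzq hzp q hq p hp σ
    have e2 := congrArg (fun w => w.coeff (q * σ * p)) (hzp p⁻¹ (inv_mem_fiberPerms hp))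
    have e1 := congrArg (fun w => w.coeff (q * σ)) (hzq q hq)
    simp only [MonoidAlgebra.coeff_mul_single_apply, MonoidAlgebra.coeff_smul_apply, mul_one,
      MonoidAlgebra.coeff_single_mul_apply, one_mul, inv_mul_cancel_left, inv_inv,
      Perm.sign_inv, smul_eq_mul] at e1 e2
    have e3 := congrArg (fun w => w.coeff (q * σ)) (hzp p hp)
    simp only [MonoidAlgebra.coeff_mul_single_apply, MonoidAlgebra.coeff_smul_apply, mul_one,
      smul_eq_mul] at e3
    have e4 := congrArg (fun w => w.coeff (q * σ * p)) (hzp p hp)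
    simp only [MonoidAlgebra.coeff_mul_single_apply, MonoidAlgebra.coeff_smul_apply, mul_one,
      smul_eq_mul, mul_inv_cancel_right] at e4
    rw [e1, e4, ← mul_assoc]
    rcases Int.units_eq_one_or (Perm.sign p) with e | e <;> simp [e]
  have hs := key (symmetrizer row col) (fun q hq => single_mul_symmetrizer hq)
    (fun p hp => symmetrizer_mul_single hp)
  have hy := key y hq hp
  ext σ
  rw [MonoidAlgebra.coeff_smul_apply, MonoidAlgebra.coeff_smul_apply, smul_eq_mul, smul_eq_mul]
  by_cases hσ : ∀ x y, row x = row y → col (σ x) = col (σ y) → x = y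
  · obtain ⟨q, hq', p, hp', rfl⟩ := h.exists_mul_of_col_inj σ hσ
    have e1 := hs q hq' p hp' 1
    have e2 := hy q hq' p hp' 1
    rw [mul_one] at e1 e2
    rw [e1, e2]
    ring
  · -- otherwise a transposition in the row group is conjugate by `σ` to one in the column group
    push Not at hσ
    obtain ⟨x, x', hr, hc, hne⟩ := hσ
    have zero : ∀ z : MonoidAlgebra ℚ (Perm X),
        (∀ q ∈ fiberPerms col, ∀ p ∈ fiberPerms row, ∀ σ,
        z.coeff (q * σ * p) = ((Perm.sign p : ℤ) : ℚ) * z.coeff σ) → z.coeff σ = 0 := by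
      intro z hz
      have e := hz (swap (σ x) (σ x')) (swap_mem_fiberPerms hc) (swap x x')
        (swap_mem_fiberPerms hr) σ
      have e' : swap (σ x) (σ x') * σ * swap x x' = σ := by
        have e1 := swap_apply_apply σ x x'
        rw [e1]
        simp [mul_assoc]
      rw [e', Perm.sign_swap hne] at e
      simp only [Units.val_neg, Units.val_one, Int.cast_neg, Int.cast_one] at e
      linarith
    rw [zero _ hs, zero _ hy, mul_zero, mul_zero]

lemma symmetrizer_coeff_one (h : IsTableau a row col) : (symmetrizer row col).coeff 1 = 1 := by
  rw [symmetrizer, Finset.sum_mul, MonoidAlgebra.coeff_sum, Finset.sum_apply',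
    Finset.sum_eq_single 1]
  · rw [← MonoidAlgebra.one_def, one_mul, MonoidAlgebra.coeff_sum, Finset.sum_apply',
      Finset.sum_eq_single 1]
    · simp
    · intro p _ hp
      rw [MonoidAlgebra.coeff_single, Finsupp.single_apply, if_neg hp]
    · intro h1
      exact absurd (mem_fiberPerms.2 fun x => rfl) h1
  · intro q hq hq1
    rw [MonoidAlgebra.coeff_single_mul_apply, one_mul, mul_one, MonoidAlgebra.coeff_sum,
      Finset.sum_apply']
    refine Finset.sum_eq_zero fun p hp => ?_
    rw [MonoidAlgebra.coeff_single, Finsupp.single_apply, if_neg]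
    rintro rfl
    apply hq1
    rw [← inv_inv q, h.eq_one_of_mem hp (inv_mem_fiberPerms hq), inv_one]
  · intro h1
    exact absurd (mem_fiberPerms.2 fun x => rfl) h1

/-- The coefficient at the identity is a trace form. -/
lemma coeff_mul_comm_one (x y : MonoidAlgebra ℚ (Perm X)) :
    (x * y).coeff 1 = (y * x).coeff 1 := by
  induction x using MonoidAlgebra.induction_linear with
  | zero => simp
  | add x₁ x₂ h₁ h₂ => simp [add_mul, mul_add, h₁, h₂]
  | single σ r =>
    rw [MonoidAlgebra.coeff_single_mul_apply, MonoidAlgebra.coeff_mul_single_apply, mul_one,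
      one_mul, mul_comm]

/-- An element with non-zero coefficient at the identity does not have square zero: left
multiplication by it has non-zero trace. -/
lemma mul_self_ne_zero (x : MonoidAlgebra ℚ (Perm X)) (hx : x.coeff 1 ≠ 0) : x * x ≠ 0 := by
  intro h0
  have hn : IsNilpotent (LinearMap.mulLeft ℚ x) := ⟨2, by
    rw [pow_two, Module.End.mul_eq_comp, ← LinearMap.mulLeft_mul, h0, LinearMap.mulLeft_zero_eq_zero]⟩
  have ht := (LinearMap.isNilpotent_trace_of_isNilpotent hn).eq_zero
  rw [LinearMap.trace_eq_matrix_trace ℚ (MonoidAlgebra.basis (Perm X) ℚ), Matrix.trace] at ht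
  have hd : ∀ σ, Matrix.diag (LinearMap.toMatrix (MonoidAlgebra.basis (Perm X) ℚ)
      (MonoidAlgebra.basis (Perm X) ℚ) (LinearMap.mulLeft ℚ x)) σ = x.coeff 1 := by
    intro σ
    rw [Matrix.diag_apply, LinearMap.toMatrix_apply, LinearMap.mulLeft_apply]
    have e1 : MonoidAlgebra.basis (Perm X) ℚ σ = MonoidAlgebra.single σ 1 := by simp
    have e2 : ∀ y : MonoidAlgebra ℚ (Perm X),
        (MonoidAlgebra.basis (Perm X) ℚ).repr y σ = y.coeff σ := fun y => rfl
    rw [e1, e2, MonoidAlgebra.coeff_mul_single_apply, mul_inv_cancel, mul_one]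
  rw [Finset.sum_congr rfl fun σ _ => hd σ, Finset.sum_const, nsmul_eq_mul] at ht
  have : ((Finset.univ : Finset (Perm X)).card : ℚ) ≠ 0 := by
    exact_mod_cast Finset.card_ne_zero.2 ⟨1, Finset.mem_univ _⟩
  exact (mul_ne_zero this hx) ht

/-- A multiple of the Young symmetrizer is a primitive idempotent. -/
theorem exists_idempotent (h : IsTableau a row col) :
    ∃ n : ℚ, n ≠ 0 ∧ IsIdempotentElem (n • symmetrizer row col) ∧
      ∀ σ : Perm X, (n • symmetrizer row col) * MonoidAlgebra.single σ 1 *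
        (n • symmetrizer row col) =
        ((n • symmetrizer row col).coeff σ⁻¹ / n) • (n • symmetrizer row col) := by
  -- `c x c` has the symmetries of `c`
  have key : ∀ x, symmetrizer row col * x * symmetrizer row col =
      (symmetrizer row col * x * symmetrizer row col).coeff 1 • symmetrizer row col := by
    intro x
    have := h.eq_smul_symmetrizer (symmetrizer row col * x * symmetrizer row col)
      (fun q hq => by rw [← mul_assoc, ← mul_assoc, single_mul_symmetrizer hq])
      (fun p hp => by rw [mul_assoc, symmetrizer_mul_single hp, mul_smul_comm])
    rwa [h.symmetrizer_coeff_one, one_smul] at this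
  set c := symmetrizer row col with hc
  set m := (c * c).coeff 1 with hm
  have hcc : c * c = m • c := by simpa using key 1
  have hm0 : m ≠ 0 := by
    rintro hm0
    rw [hm0, zero_smul] at hcc
    exact mul_self_ne_zero c (by rw [hc, h.symmetrizer_coeff_one]; exact one_ne_zero) hcc
  refine ⟨m⁻¹, inv_ne_zero hm0, ?_, fun σ => ?_⟩
  · rw [IsIdempotentElem, smul_mul_smul_comm, hcc, smul_smul]
    congr 1
    field_simp
  · have e1 : (c * MonoidAlgebra.single σ 1 * c).coeff 1 = m * c.coeff σ⁻¹ := by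
      rw [coeff_mul_comm_one, ← mul_assoc, hcc, smul_mul_assoc, MonoidAlgebra.coeff_smul_apply,
        MonoidAlgebra.coeff_mul_single_apply, one_mul, mul_one, smul_eq_mul]
    rw [smul_mul_assoc, smul_mul_smul_comm, key, e1, MonoidAlgebra.coeff_smul_apply, smul_eq_mul,
      smul_smul, smul_smul]
    congr 1
    field_simp

end IsTableau

/-! ### Tensor powers in coordinates -/

namespace TensorCoord

open Equiv

section Coeff

variable {X K : Type*} [Fintype X] [DecidableEq X] [Field K]

/-- The coefficient of `∏ T_i` in a product of affine linear forms is the permanent of their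
linear parts. -/
lemma coeff_prod_affine (c : X → K) (d : X → X → K) :
    MvPolynomial.coeff (∑ i, Finsupp.single i 1)
      (∏ l, (MvPolynomial.C (c l) + ∑ i, MvPolynomial.C (d l i) * MvPolynomial.X i)) =
      ∑ σ : Perm X, ∏ l, d l (σ l) := by
  let e : Option X → X →₀ ℕ := fun o => o.elim 0 fun i => Finsupp.single i 1
  let r : X → Option X → K := fun l o => o.elim (c l) (d l)
  have h1 : ∀ l, (MvPolynomial.C (c l) + ∑ i, MvPolynomial.C (d l i) * MvPolynomial.X i) =
      ∑ o : Option X, MvPolynomial.monomial (e o) (r l o) := by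
    intro l
    rw [Fintype.sum_option]
    refine congrArg₂ (· + ·) rfl (Finset.sum_congr rfl fun i _ => ?_)
    rw [MvPolynomial.C_mul_X_eq_monomial]
    rfl
  have h2 : ∀ f : X → Option X, ∏ l, MvPolynomial.monomial (e (f l)) (r l (f l)) =
      MvPolynomial.monomial (∑ l, e (f l)) (∏ l, r l (f l)) := by
    intro f
    exact (MvPolynomial.monomial_sum_prod _ _ _).symm
  rw [Finset.prod_congr rfl fun l _ => h1 l, Finset.prod_univ_sum, MvPolynomial.coeff_sum]
  rw [Fintype.piFinset_univ]
  symm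
  refine Fintype.sum_of_injective (fun (σ : Perm X) l => some (σ l)) ?_ _ _ ?_ ?_
  · intro σ τ h
    ext l
    exact Option.some_injective _ (congrFun h l)
  · intro f hf
    rw [h2, MvPolynomial.coeff_monomial, if_neg]
    intro h
    apply hf
    have hcount : ∀ i, ∑ l, (e (f l)) i = 1 := by
      intro i
      have := DFunLike.congr_fun h i
      simpa [Finsupp.single_apply] using this
    have hex : ∀ i, ∃ l, f l = some i := by
      intro i
      by_contra hne
      push Not at hne
      have : ∑ l, (e (f l)) i = 0 := by
        refine Finset.sum_eq_zero fun l _ => ?_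
        cases hl : f l with
        | none => rfl
        | some j =>
          have hji : j ≠ i := by
            rintro rfl
            exact hne l hl
          exact Finsupp.single_eq_of_ne hji.symm
      rw [hcount] at this
      exact one_ne_zero this
    choose m hm using hex
    have hinj : Function.Injective m := by
      intro i j hij
      have := hm j
      rw [← hij, hm i] at this
      exact Option.some_injective _ this
    let π : Perm X := Equiv.ofBijective m (Finite.injective_iff_bijective.1 hinj)
    refine ⟨π⁻¹, funext fun l => ?_⟩
    exact (hm (π⁻¹ l)).symm.trans (congrArg f (Equiv.apply_symm_apply π l))
  · intro σ
    rw [h2, MvPolynomial.coeff_monomial, if_pos]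
    · rfl
    · exact Equiv.sum_comp σ fun i => Finsupp.single i 1

end Coeff

variable (X ι K : Type*) [Fintype X] [DecidableEq X] [Fintype ι] [DecidableEq ι]
  [Field K] [Algebra ℚ K]

/-- The action of `ℚ[𝔖]` on the space of functions on `X → ι`, i.e. on the tensor power of
`ι → K`, by permutation of the factors and multiplication by the sign. -/
def signedPerm : MonoidAlgebra ℚ (Perm X) →ₐ[ℚ] Module.End K ((X → ι) → K) :=
  MonoidAlgebra.lift ℚ _ _
    { toFun := fun σ => ((Perm.sign σ : ℤ) : K) •
        LinearMap.funLeft K K fun κ : X → ι => κ ∘ σ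
      map_one' := by
        ext
        simp
      map_mul' := fun σ τ => by
        refine LinearMap.ext fun f => funext fun κ => ?_
        simp only [Perm.sign_mul, Units.val_mul, Int.cast_mul, Perm.coe_mul, LinearMap.smul_apply,
          Pi.smul_apply, LinearMap.funLeft_apply, Module.End.mul_apply, smul_eq_mul,
          Function.comp_assoc]
        ring }

variable {X ι K}

lemma signedPerm_single (σ : Perm X) (r : ℚ) (f : (X → ι) → K) (κ : X → ι) :
    signedPerm X ι K (MonoidAlgebra.single σ r) f κ =
      algebraMap ℚ K r * (((Perm.sign σ : ℤ) : K) * f (κ ∘ σ)) := by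
  rw [signedPerm, MonoidAlgebra.lift_single, ← algebraMap_smul K r, LinearMap.smul_apply,
    Pi.smul_apply, smul_eq_mul]
  rfl

lemma signedPerm_apply (x : MonoidAlgebra ℚ (Perm X)) (f : (X → ι) → K) :
    signedPerm X ι K x f = ∑ σ, algebraMap ℚ K (x.coeff σ) •
      signedPerm X ι K (MonoidAlgebra.single σ 1) f := by
  have hx : x = ∑ σ, MonoidAlgebra.single σ (x.coeff σ) := by
    ext τ
    rw [MonoidAlgebra.coeff_sum, Finset.sum_apply', Finset.sum_eq_single τ]
    · simp
    · intro σ _ h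
      simp [h]
    · simp
  conv_lhs => rw [hx]
  rw [map_sum, LinearMap.sum_apply]
  refine Finset.sum_congr rfl fun σ _ => funext fun κ => ?_
  rw [signedPerm_single, Pi.smul_apply, signedPerm_single]
  simp

/-- A subspace of the tensor power which is stable under all invertible matrices over the ring
of formal power series is stable under the symmetrizations of tensor products of elementary
matrices `e_i`: apply the matrix `1 + ∑ T_i e_i` and extract the coefficient of `∏ T_i`. The
stability and the conclusion are expressed by the linear forms `ξ` vanishing on the subspace. -/
lemma sum_perm_eq_zero (W : Submodule K ((X → ι) → K))
    (hW : ∀ A : Matrix ι ι (MvPowerSeries X K), IsUnit A.det → ∀ w ∈ W,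
      ∀ ξ : ((X → ι) → K) →ₗ[K] K, (∀ w ∈ W, ξ w = 0) →
      ∑ κ, ∑ κ', algebraMap K (MvPowerSeries X K) (ξ (Pi.single κ' 1) * w κ) *
        ∏ x, A (κ' x) (κ x) = 0)
    {w : (X → ι) → K} (hw : w ∈ W) {ξ : ((X → ι) → K) →ₗ[K] K} (hξ : ∀ w ∈ W, ξ w = 0)
    (p r : X → ι) :
    ∑ σ : Perm X, ξ (Pi.single (p ∘ σ) 1) * w (r ∘ σ) = 0 := by
  let A : Matrix ι ι (MvPolynomial X K) := 1 + ∑ i, (MvPolynomial.X i : MvPolynomial X K) •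
    Matrix.single (p i) (r i) 1
  have hA : ∀ k k', A k k' = MvPolynomial.C ((1 : Matrix ι ι K) k k') +
      ∑ i, MvPolynomial.C (Matrix.single (p i) (r i) (1 : K) k k') * MvPolynomial.X i := by
    intro k k'
    simp only [A, Matrix.add_apply, Matrix.sum_apply, Matrix.smul_apply, smul_eq_mul]
    refine congrArg₂ (· + ·) ?_ (Finset.sum_congr rfl fun i _ => ?_)
    · rw [Matrix.one_apply, Matrix.one_apply]
      split_ifs <;> simp
    · rw [mul_comm, Matrix.single_apply, Matrix.single_apply]
      split_ifs <;> simp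
  let φ : MvPolynomial X K →+* MvPowerSeries X K := MvPolynomial.coeToMvPowerSeries.ringHom
  let B : Matrix ι ι (MvPowerSeries X K) := φ.mapMatrix A
  have hB : IsUnit B.det := by
    rw [MvPowerSeries.isUnit_iff_constantCoeff]
    have : MvPowerSeries.constantCoeff B.det = 1 := by
      rw [RingHom.map_det, ← Matrix.det_one (n := ι) (R := K)]
      congr 1
      ext k k'
      change MvPowerSeries.coeff 0 ((A k k' : MvPolynomial X K) : MvPowerSeries X K) = _
      rw [MvPolynomial.coeff_coe, hA, ← MvPolynomial.constantCoeff_eq]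
      simp
    rw [this]
    exact isUnit_one
  have key := congrArg (MvPowerSeries.coeff (∑ i : X, Finsupp.single i 1)) (hW B hB w hw ξ hξ)
  have hcoeff : ∀ κ κ' : X → ι, MvPowerSeries.coeff (∑ i : X, Finsupp.single i 1)
      (algebraMap K (MvPowerSeries X K) (ξ (Pi.single κ' 1) * w κ) *
        ∏ x, B (κ' x) (κ x)) = ∑ σ : Perm X, if κ' = p ∘ σ ∧ κ = r ∘ σ then
          ξ (Pi.single (p ∘ σ) 1) * w (r ∘ σ) else 0 := by
    intro κ κ'
    have e1 : ∏ x, B (κ' x) (κ x) = φ (∏ x, A (κ' x) (κ x)) := by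
      rw [map_prod]
      rfl
    rw [e1, ← Algebra.smul_def, MvPowerSeries.coeff_smul]
    change _ * MvPowerSeries.coeff _ ((∏ x, A (κ' x) (κ x) : MvPolynomial X K) :
      MvPowerSeries X K) = _
    rw [MvPolynomial.coeff_coe, Finset.prod_congr rfl fun x _ => hA (κ' x) (κ x),
      coeff_prod_affine, Finset.mul_sum]
    refine Finset.sum_congr rfl fun σ _ => ?_
    split_ifs with h
    · obtain ⟨rfl, rfl⟩ := h
      rw [Finset.prod_eq_one, mul_one]
      intro x _
      simp
    · have : ∃ x, ¬ (p (σ x) = κ' x ∧ r (σ x) = κ x) := by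
        by_contra hne
        push Not at hne
        exact h ⟨funext fun x => ((hne x).1).symm, funext fun x => ((hne x).2).symm⟩
      obtain ⟨x, hx⟩ := this
      rw [Finset.prod_eq_zero (Finset.mem_univ x), mul_zero]
      rw [Matrix.single_apply, if_neg hx]
  rw [map_zero, map_sum] at key
  simp only [map_sum, hcoeff] at key
  rw [← key]
  symm
  calc _ = ∑ κ : X → ι, ∑ σ : Perm X, ∑ κ' : X → ι, (if κ' = p ∘ σ ∧ κ = r ∘ σ then
          ξ (Pi.single (p ∘ σ) 1) * w (r ∘ σ) else 0) :=
        Finset.sum_congr rfl fun κ _ => Finset.sum_comm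
    _ = ∑ σ : Perm X, ∑ κ : X → ι, ∑ κ' : X → ι, (if κ' = p ∘ σ ∧ κ = r ∘ σ then
          ξ (Pi.single (p ∘ σ) 1) * w (r ∘ σ) else 0) := Finset.sum_comm
    _ = _ := by
      refine Finset.sum_congr rfl fun σ _ => ?_
      rw [Finset.sum_eq_single (r ∘ σ), Finset.sum_eq_single (p ∘ σ)]
      · simp
      · intro κ' _ h
        rw [if_neg]
        exact fun h' => h h'.1
      · simp
      · intro κ _ h
        exact Finset.sum_eq_zero fun κ' _ => if_neg fun h' => h h'.2
      · simp

/-- Schur–Weyl duality for a primitive idempotent `C` of `ℚ[𝔖]`: the image of `C` in the tensor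
power is irreducible. For `w = C w` and any `y`, the symmetrization of the operator
`z ↦ f (z) C y` maps `w` to a multiple of `C y`. -/
theorem range_le_of_stable (C : MonoidAlgebra ℚ (Perm X)) (n : ℚ) (hn : n ≠ 0)
    (hC : IsIdempotentElem C)
    (hprim : ∀ σ : Perm X, C * MonoidAlgebra.single σ 1 * C = (C.coeff σ⁻¹ / n) • C)
    (W : Submodule K ((X → ι) → K))
    (hW : ∀ A : Matrix ι ι (MvPowerSeries X K), IsUnit A.det → ∀ w ∈ W,
      ∀ ξ : ((X → ι) → K) →ₗ[K] K, (∀ w ∈ W, ξ w = 0) →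
      ∑ κ, ∑ κ', algebraMap K (MvPowerSeries X K) (ξ (Pi.single κ' 1) * w κ) *
        ∏ x, A (κ' x) (κ x) = 0)
    (hWC : W ≤ LinearMap.range (signedPerm X ι K C)) (hW0 : W ≠ ⊥) :
    LinearMap.range (signedPerm X ι K C) ≤ W := by
  obtain ⟨w, hw, hw0⟩ := W.ne_bot_iff.1 hW0
  have hCw : signedPerm X ι K C w = w := by
    obtain ⟨z, rfl⟩ := hWC hw
    rw [← Module.End.mul_apply, ← map_mul, hC.eq]
  rintro _ ⟨y₀, rfl⟩
  by_contra hy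
  obtain ⟨ξ, hξ1, hξ2⟩ := Submodule.exists_le_ker_of_notMem hy
  -- the symmetrized elementary tensors, applied to an arbitrary `y`
  have h1 : ∀ y : (X → ι) → K, ∑ σ : Perm X,
      ξ (signedPerm X ι K (MonoidAlgebra.single σ⁻¹ 1) y) •
        signedPerm X ι K (MonoidAlgebra.single σ 1) w = 0 := by
    intro y
    ext r
    have hlin : ∀ y, (∑ σ : Perm X,
        w (r ∘ σ) • ((((Perm.sign σ : ℤ) : K)) • (ξ ∘ₗ signedPerm X ι K
          (MonoidAlgebra.single σ⁻¹ 1))) : ((X → ι) → K) →ₗ[K] K) y = 0 := by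
      intro y
      rw [show (∑ σ : Perm X, w (r ∘ σ) • ((((Perm.sign σ : ℤ) : K)) • (ξ ∘ₗ signedPerm X ι K
          (MonoidAlgebra.single σ⁻¹ 1))) : ((X → ι) → K) →ₗ[K] K) = 0 from ?_,
        LinearMap.zero_apply]
      refine LinearMap.pi_ext' fun p => LinearMap.ext_ring ?_
      simp only [LinearMap.comp_apply, LinearMap.sum_apply, LinearMap.smul_apply,
        LinearMap.zero_apply, LinearMap.single_apply, smul_eq_mul]
      rw [← sum_perm_eq_zero W hW hw (fun w hw => hξ2 hw) p r]
      refine Finset.sum_congr rfl fun σ _ => ?_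
      have e : signedPerm X ι K (MonoidAlgebra.single σ⁻¹ 1) (Pi.single p 1) =
          ((Perm.sign σ : ℤ) : K) • Pi.single (p ∘ σ) 1 := by
        ext κ
        rw [signedPerm_single, Pi.smul_apply, smul_eq_mul, map_one, one_mul, Perm.sign_inv,
          Pi.single_apply, Pi.single_apply]
        congr 2
        refine propext ⟨fun h => ?_, fun h => ?_⟩
        · rw [← h]
          ext x
          simp
        · rw [h]
          ext x
          simp
      rw [e, map_smul, smul_eq_mul]
      rcases Int.units_eq_one_or (Perm.sign σ) with e | e <;> simp [e, mul_comm]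
    rw [Finset.sum_apply, Pi.zero_apply, ← hlin y, LinearMap.sum_apply]
    refine Finset.sum_congr rfl fun σ _ => ?_
    rw [Pi.smul_apply, signedPerm_single]
    simp only [LinearMap.comp_apply, LinearMap.smul_apply, smul_eq_mul, map_one]
    ring
  -- apply `C`: since `w = C w`, each `C σ w` is the multiple of `w` given by the primitivity of `C`
  have h2 := congrArg (signedPerm X ι K C) (h1 (signedPerm X ι K C y₀))
  rw [map_zero, map_sum] at h2
  have h3 : ∀ σ : Perm X, signedPerm X ι K C (ξ (signedPerm X ι K (MonoidAlgebra.single σ⁻¹ 1)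
      (signedPerm X ι K C y₀)) • signedPerm X ι K (MonoidAlgebra.single σ 1) w) =
      (algebraMap ℚ K (n⁻¹) * (algebraMap ℚ K (C.coeff σ⁻¹) * ξ (signedPerm X ι K
        (MonoidAlgebra.single σ⁻¹ 1) (signedPerm X ι K C y₀)))) • w := by
    intro σ
    have e : signedPerm X ι K C (signedPerm X ι K (MonoidAlgebra.single σ 1) w) =
        algebraMap ℚ K (C.coeff σ⁻¹ / n) • w := by
      conv_lhs => rw [← hCw]
      rw [← Module.End.mul_apply, ← Module.End.mul_apply, ← map_mul, ← map_mul, hprim, map_smul,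
        ← algebraMap_smul K (C.coeff σ⁻¹ / n), LinearMap.smul_apply, hCw]
    rw [map_smul, e, smul_smul, div_eq_mul_inv, map_mul]
    congr 1
    ring
  rw [Finset.sum_congr rfl fun σ _ => h3 σ, ← Finset.sum_smul, ← Finset.mul_sum] at h2
  -- the scalar in front of `w` is `n⁻¹ ξ (C y₀)`, because `C` is idempotent
  have h4 : ∑ σ : Perm X, algebraMap ℚ K (C.coeff σ⁻¹) * ξ (signedPerm X ι K
      (MonoidAlgebra.single σ⁻¹ 1) (signedPerm X ι K C y₀)) = ξ (signedPerm X ι K C y₀) := by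
    refine (Equiv.sum_comp (Equiv.inv (Perm X)) fun σ => algebraMap ℚ K (C.coeff σ) *
      ξ (signedPerm X ι K (MonoidAlgebra.single σ 1) (signedPerm X ι K C y₀))).trans ?_
    have := congrArg ξ (signedPerm_apply C (signedPerm X ι K C y₀))
    rw [← Module.End.mul_apply, ← map_mul, hC.eq, map_sum] at this
    rw [this]
    exact Finset.sum_congr rfl fun σ _ => by rw [map_smul, smul_eq_mul]
  rw [h4] at h2
  rcases smul_eq_zero.1 h2 with h | h
  · rcases mul_eq_zero.1 h with h | h
    · exact inv_ne_zero hn ((map_eq_zero _).1 h)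
    · exact hξ1 h
  · exact hw0 h

end TensorCoord

namespace TensorCoord

open Equiv IsTableau

variable {X K : Type*} [Fintype X] [DecidableEq X] [Field K] [Algebra ℚ K]
  {g : ℕ} {a : Fin g → ℕ} {row : X → Fin g} {col : X → ℕ}

/-- The highest weight vector of the image of the Young symmetrizer: the columns of the tensor
with entry `l` in row `l` are antisymmetrized. -/
lemma symmetrizer_single_row (κ : X → Fin g) :
    signedPerm X (Fin g) K (symmetrizer row col) (Pi.single row 1) κ =
      (fiberPerms row).card * ∑ q ∈ fiberPerms col,
        ((Perm.sign q : ℤ) : K) * if κ ∘ q = row then 1 else 0 := by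
  have h1 : signedPerm X (Fin g) K (∑ p ∈ fiberPerms row,
      MonoidAlgebra.single p ((Perm.sign p : ℤ) : ℚ)) (Pi.single row 1) =
      ((fiberPerms row).card : K) • Pi.single row 1 := by
    rw [map_sum, LinearMap.sum_apply, Nat.cast_smul_eq_nsmul, ← Finset.sum_const]
    refine Finset.sum_congr rfl fun p hp => funext fun κ => ?_
    rw [signedPerm_single, Pi.single_apply, Pi.single_apply]
    have e : κ ∘ p = row ↔ κ = row := by
      have hr : row ∘ p = row := funext (mem_fiberPerms.1 hp)
      refine ⟨fun h => ?_, fun h => by rw [h, hr]⟩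
      ext x
      have e1 := congrFun h (p⁻¹ x)
      have e2 := congrFun hr (p⁻¹ x)
      simp only [Function.comp_apply, Perm.inv_def, Equiv.apply_symm_apply] at e1 e2
      rw [e1, e2]
    simp only [e]
    rcases Int.units_eq_one_or (Perm.sign p) with e | e <;> simp [e]
  rw [symmetrizer, map_mul, Module.End.mul_apply, h1, map_smul, Pi.smul_apply, smul_eq_mul,
    map_sum, LinearMap.sum_apply, Finset.sum_apply]
  refine congrArg _ (Finset.sum_congr rfl fun q _ => ?_)
  rw [signedPerm_single, map_one, one_mul, Pi.single_apply]

lemma symmetrizer_single_row_ne_zero (h : IsTableau a row col) :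
    signedPerm X (Fin g) K (symmetrizer row col) (Pi.single row 1) ≠ 0 := by
  have : CharZero K := algebraRat.charZero K
  intro h0
  have := congrFun h0 row
  rw [symmetrizer_single_row, Finset.sum_eq_single 1] at this
  · simp only [Perm.coe_one, Function.comp_id, if_true, Perm.sign_one, Units.val_one,
      Int.cast_one, mul_one, Pi.zero_apply, Nat.cast_eq_zero, Finset.card_eq_zero] at this
    have h1 : (1 : Perm X) ∈ fiberPerms row := mem_fiberPerms.2 fun _ => rfl
    rw [this] at h1
    simp at h1
  · intro q hq hq1
    rw [if_neg, mul_zero]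
    intro hr
    exact hq1 (h.eq_one_of_mem (mem_fiberPerms.2 fun x => congrFun hr x) hq)
  · intro h1
    exact absurd (mem_fiberPerms.2 fun _ => rfl) h1

/-- The filling of a tableau which is injective on columns and has entries at most `l` in row `l`
has entries equal to `l` in row `l`. -/
lemma eq_row_of_le (h : IsTableau a row col) (ha : Antitone a) (κ : X → Fin g)
    (hle : ∀ x, κ x ≤ row x) (hinj : ∀ x y, col x = col y → κ x = κ y → x = y) : κ = row := by
  have key : ∀ l : ℕ, ∀ x, (row x : ℕ) = l → κ x = row x := by
    intro l
    induction l using Nat.strong_induction_on with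
    | _ l ih =>
      intro x hx
      by_contra hne
      have hlt : κ x < row x := lt_of_le_of_ne (hle x) hne
      obtain ⟨y, hy1, hy2⟩ := h.exists_box (κ x) (col x)
        ((h.col_lt x).trans_le (ha hlt.le))
      have hy := ih (κ x : ℕ) (by rw [← hx]; exact hlt) y (by rw [hy1])
      have := hinj x y hy2.symm (by rw [hy, hy1])
      rw [← this] at hy1
      exact hne hy1.symm
  exact funext fun x => key _ x rfl

/-- An upper triangular matrix acts on the column antisymmetrization through its diagonal. -/
lemma sum_colPerms_mul_prod {R : Type*} [CommRing R] [Algebra ℚ R] (h : IsTableau a row col)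
    (ha : Antitone a) (A : Matrix (Fin g) (Fin g) R) (hA : ∀ l' l, l < l' → A l' l = 0)
    (κ : X → Fin g) :
    ∑ q ∈ fiberPerms col, ((Perm.sign q : ℤ) : R) * ∏ x, A (κ (q x)) (row x) =
      (∏ l, A l l ^ a l) *
        ∑ q ∈ fiberPerms col, ((Perm.sign q : ℤ) : R) * if κ ∘ q = row then 1 else 0 := by
  by_cases hinj : ∀ x y, col x = col y → κ x = κ y → x = y
  · rw [Finset.mul_sum]
    refine Finset.sum_congr rfl fun q hq => ?_
    split_ifs with hκ
    · have e : ∏ x, A (κ (q x)) (row x) = ∏ l, A l l ^ a l := by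
        have e1 : ∏ x, A (κ (q x)) (row x) = ∏ x, A (row x) (row x) :=
          Finset.prod_congr rfl fun x _ => by rw [← congrFun hκ x]; rfl
        rw [e1, ← Finset.prod_fiberwise_of_maps_to (g := row) (t := Finset.univ)
          (fun _ _ => Finset.mem_univ _)]
        refine Finset.prod_congr rfl fun l _ => ?_
        rw [← h.card_row l]
        exact Finset.prod_eq_pow_card fun x hx => by rw [(Finset.mem_filter.1 hx).2]
      rw [e, mul_one, mul_comm]
    · -- the filling `κ ∘ q` has an entry which is too large for its row
      have : ∃ x, row x < κ (q x) := by
        by_contra hne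
        push Not at hne
        refine hκ (eq_row_of_le h ha (κ ∘ q) hne fun x y hxy e => ?_)
        have hc := mem_fiberPerms.1 hq
        exact q.injective (hinj _ _ (by rw [hc, hc, hxy]) e)
      obtain ⟨x, hx⟩ := this
      rw [Finset.prod_eq_zero (Finset.mem_univ x) (hA _ _ hx), mul_zero, mul_zero]
  · -- a transposition in the column group fixes `κ`, so that both sums are their own negatives
    push Not at hinj
    obtain ⟨y, z, hc, hκ, hne⟩ := hinj
    have hτ := swap_mem_fiberPerms hc
    have hκτ : ∀ x, κ (swap y z x) = κ x := by
      intro x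
      rw [swap_apply_def]
      split_ifs with h1 h2
      · rw [h1, hκ]
      · rw [h2, hκ]
      · rfl
    have zero : ∀ f : (X → Fin g) → R,
        ∑ q ∈ fiberPerms col, ((Perm.sign q : ℤ) : R) * f (κ ∘ q) = 0 := by
      intro f
      have e : ∑ q ∈ fiberPerms col, ((Perm.sign q : ℤ) : R) * f (κ ∘ q) =
          -∑ q ∈ fiberPerms col, ((Perm.sign q : ℤ) : R) * f (κ ∘ q) := by
        rw [← Finset.sum_neg_distrib]
        refine Finset.sum_bij (fun q _ => swap y z * q) (fun q hq => mul_mem_fiberPerms hτ hq)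
          (fun _ _ _ _ e => mul_left_cancel e)
          (fun q hq => ⟨swap y z * q, mul_mem_fiberPerms hτ hq, by simp [← mul_assoc]⟩)
          fun q _ => ?_
        have e1 : κ ∘ (swap y z * q : Perm X) = κ ∘ q := funext fun x => hκτ _
        rw [e1, Perm.sign_mul, Perm.sign_swap hne]
        simp
      have h2 : (2 : ℚ) • ∑ q ∈ fiberPerms col, ((Perm.sign q : ℤ) : R) * f (κ ∘ q) = 0 := by
        rw [two_smul]
        nth_rewrite 2 [e]
        exact add_neg_cancel _
      have h3 := congrArg (fun r => (2⁻¹ : ℚ) • r) h2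
      simpa [smul_smul] using h3
    exact (zero fun f => ∏ x, A (f x) (row x)).trans
      (by rw [zero fun f => if f = row then 1 else 0, mul_zero])

/-- An upper triangular matrix acts on the highest weight vector through its diagonal. -/
lemma prod_mul_symmetrizer_single_row {R : Type*} [CommRing R] [Algebra ℚ R] [Algebra K R]
    (h : IsTableau a row col)
    (ha : Antitone a) (A : Matrix (Fin g) (Fin g) R) (hA : ∀ l' l, l < l' → A l' l = 0)
    (κ' : X → Fin g) :
    ∑ κ, algebraMap K R
        (signedPerm X (Fin g) K (symmetrizer row col) (Pi.single row 1) κ) *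
          ∏ x, A (κ' x) (κ x) =
      (∏ l, A l l ^ a l) * algebraMap K R
        (signedPerm X (Fin g) K (symmetrizer row col) (Pi.single row 1) κ') := by
  have e1 : ∀ κ : X → Fin g, algebraMap K R
      (signedPerm X (Fin g) K (symmetrizer row col) (Pi.single row 1) κ) =
      (fiberPerms row).card * ∑ q ∈ fiberPerms col,
        ((Perm.sign q : ℤ) : R) * if κ ∘ q = row then 1 else 0 := by
    intro κ
    rw [symmetrizer_single_row, map_mul, map_natCast, map_sum]
    refine congrArg _ (Finset.sum_congr rfl fun q _ => ?_)
    rw [map_mul, map_intCast]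
    split_ifs <;> simp
  rw [e1, mul_left_comm, ← sum_colPerms_mul_prod h ha A hA, Finset.mul_sum]
  simp only [e1, Finset.mul_sum, Finset.sum_mul]
  rw [Finset.sum_comm]
  refine Finset.sum_congr rfl fun q _ => ?_
  have e2 : ∀ κ : X → Fin g, κ ∘ q = row ↔ κ = row ∘ (q⁻¹ : Perm X) := by
    intro κ
    refine ⟨fun h => ?_, fun h => ?_⟩
    · rw [← h]
      ext x
      simp
    · rw [h]
      ext x
      simp
  rw [Finset.sum_eq_single (row ∘ (q⁻¹ : Perm X))]
  · rw [if_pos ((e2 _).2 rfl), mul_one, mul_assoc]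
    congr 2
    rw [← Equiv.prod_comp q]
    simp
  · intro κ _ hκ
    rw [if_neg fun h' => hκ ((e2 κ).1 h')]
    simp
  · simp

end TensorCoord

/-! ### Representations of group functors over a field -/

namespace AlgRep

section Morphisms

variable {k : Type w} [CommRing k] {G : GroupFunctor.{u, w} k}
variable {V : Type*} [AddCommGroup V] [Module k V] {V' : Type*} [AddCommGroup V'] [Module k V']
variable {V'' : Type*} [AddCommGroup V''] [Module k V'']
variable {ρ : AlgRep G V} {ρ' : AlgRep G V'} {ρ'' : AlgRep G V''}

lemma IsEquivariant.comp {f : V' →ₗ[k] V''} {f' : V →ₗ[k] V'} (h : IsEquivariant ρ' ρ'' f)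
    (h' : IsEquivariant ρ ρ' f') : IsEquivariant ρ ρ'' (f ∘ₗ f') := by
  intro R _ _ g x
  rw [LinearMap.baseChange_comp, LinearMap.comp_apply, LinearMap.comp_apply, h', h]

lemma IsEquivariant.add {f f' : V →ₗ[k] V'} (h : IsEquivariant ρ ρ' f)
    (h' : IsEquivariant ρ ρ' f') : IsEquivariant ρ ρ' (f + f') := by
  intro R _ _ g x
  rw [LinearMap.baseChange_add, LinearMap.add_apply, LinearMap.add_apply, h, h', map_add]

lemma IsEquivariant.smul (r : k) {f : V →ₗ[k] V'} (h : IsEquivariant ρ ρ' f) :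
    IsEquivariant ρ ρ' (r • f) := by
  intro R _ _ g x
  rw [LinearMap.baseChange_smul, LinearMap.smul_apply, LinearMap.smul_apply, h,
    ← algebraMap_smul R r, ← algebraMap_smul R r, map_smul]

lemma isEquivariant_id : IsEquivariant ρ ρ LinearMap.id := by
  intro R _ _ g x
  simp

lemma isEquivariant_fst : IsEquivariant (ρ.prod ρ') ρ (LinearMap.fst k V V') := by
  intro R _ _ g x
  have e : ∀ y : R ⊗[k] (V × V'), (LinearMap.fst k V V').baseChange R y =
      (TensorProduct.prodRight k R R V V' y).1 := by
    intro y
    induction y with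
    | zero => simp
    | add a b ha hb => simp only [map_add, ha, hb, Prod.fst_add]
    | tmul r v => simp
  rw [e, e]
  simp [prod, LinearEquiv.conj_apply]

lemma isEquivariant_snd : IsEquivariant (ρ.prod ρ') ρ' (LinearMap.snd k V V') := by
  intro R _ _ g x
  have e : ∀ y : R ⊗[k] (V × V'), (LinearMap.snd k V V').baseChange R y =
      (TensorProduct.prodRight k R R V V' y).2 := by
    intro y
    induction y with
    | zero => simp
    | add a b ha hb => simp only [map_add, ha, hb, Prod.snd_add]
    | tmul r v => simp
  rw [e, e]
  simp [prod, LinearEquiv.conj_apply]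

lemma isEquivariant_proj {s : ℕ} (j : Fin s) :
    IsEquivariant (ρ.pow s) ρ (LinearMap.proj j) := by
  intro R _ _ g x
  have e : ∀ y : R ⊗[k] (Fin s → V),
      (LinearMap.proj j : (Fin s → V) →ₗ[k] V).baseChange R y =
      TensorProduct.piRight k R R (fun _ : Fin s => V) y j := by
    intro y
    induction y with
    | zero => simp
    | add a b ha hb => simp only [map_add, ha, hb, Pi.add_apply]
    | tmul r v => simp
  rw [e, e]
  simp only [pow, MonoidHom.coe_mk, OneHom.coe_mk, LinearEquiv.conj_apply, LinearMap.comp_apply,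
    LinearEquiv.coe_coe, LinearEquiv.apply_symm_apply, LinearMap.compLeft_apply,
    Function.comp_apply]
  rfl

lemma isEquivariant_single {s : ℕ} (j : Fin s) :
    IsEquivariant ρ (ρ.pow s) (LinearMap.single k (fun _ : Fin s => V) j) := by
  intro R _ _ g x
  have e : ∀ y : R ⊗[k] V, TensorProduct.piRight k R R (fun _ : Fin s => V)
      ((LinearMap.single k (fun _ : Fin s => V) j).baseChange R y) = Pi.single j y := by
    intro y
    induction y with
    | zero => simp
    | add a b ha hb => simp only [map_add, ha, hb, Pi.single_add]
    | tmul r v =>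
      ext l
      rw [LinearMap.baseChange_tmul, TensorProduct.piRight_apply, TensorProduct.piRightHom_tmul]
      rcases eq_or_ne l j with rfl | h
      · simp
      · simp [h]
  apply (TensorProduct.piRight k R R (fun _ : Fin s => V)).injective
  rw [e]
  simp only [pow, MonoidHom.coe_mk, OneHom.coe_mk, LinearEquiv.conj_apply, LinearMap.comp_apply,
    LinearEquiv.coe_coe, LinearEquiv.apply_symm_apply]
  have e' : TensorProduct.piRight k R R (fun _ : Fin s => V)
      ((LinearMap.single k (fun _ : Fin s => V) j).baseChange R x) = Pi.single j x := e x
  ext l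
  rw [LinearMap.compLeft_apply, Function.comp_apply, LinearEquiv.symm_symm, e']
  rcases eq_or_ne l j with rfl | h
  · simp
  · simp [h]

lemma IsEquivariant.symm {f : V ≃ₗ[k] V'} (h : IsEquivariant ρ ρ' f.toLinearMap) :
    IsEquivariant ρ' ρ f.symm.toLinearMap := by
  intro R _ _ g x
  have e : ∀ y, f.symm.toLinearMap.baseChange R (f.toLinearMap.baseChange R y) = y := by
    intro y
    rw [← LinearMap.comp_apply, ← LinearMap.baseChange_comp]
    simp
  have e' : ∀ y, f.toLinearMap.baseChange R (f.symm.toLinearMap.baseChange R y) = y := by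
    intro y
    rw [← LinearMap.comp_apply, ← LinearMap.baseChange_comp]
    simp
  rw [← e (ρ.act R g _), h, e']

lemma IsEquivariant.baseChange {f : V →ₗ[k] V'} (h : IsEquivariant ρ ρ' f) (K : Type u)
    [CommRing K] [Algebra k K] :
    IsEquivariant (ρ.baseChange K) (ρ'.baseChange K) (f.baseChange K) := by
  intro R _ _ g x
  letI : Algebra k R := Algebra.compHom R (algebraMap k K)
  haveI : IsScalarTower k K R := IsScalarTower.of_algebraMap_eq fun _ => rfl
  rw [LinearMap.baseChange_baseChange]
  have h' := h R (show G.pts R from g)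
    (TensorProduct.AlgebraTensorModule.cancelBaseChange k K R R V x)
  simp only [AlgRep.baseChange, MonoidHom.coe_mk, OneHom.coe_mk, LinearEquiv.conj_apply,
    LinearMap.comp_apply, LinearEquiv.coe_coe, LinearEquiv.symm_symm,
    LinearEquiv.apply_symm_apply]
  exact congrArg _ h'

section BaseChange

variable {k : Type w} [CommRing k] {G : GroupFunctor.{u, w} k} (K : Type u) [CommRing K]
  [Algebra k K] {R : Type u} [CommRing R] [Algebra K R]

/-- Under `R ⊗_K (K ⊗_k V) = R ⊗_k V`, the vector `r • (1 ⊗ ξ)` is `r` times the image of `ξ`. -/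
lemma cancelBaseChange_smul_tmul {V : Type*} [AddCommGroup V] [Module k V] (r : R)
    (ξ : K ⊗[k] V) :
    letI : Algebra k R := Algebra.compHom R (algebraMap k K)
    haveI : IsScalarTower k K R := IsScalarTower.of_algebraMap_eq fun _ => rfl
    TensorProduct.AlgebraTensorModule.cancelBaseChange k K R R V (r • ((1 : R) ⊗ₜ[K] ξ)) =
      r • ((Algebra.ofId K R).restrictScalars k).toLinearMap.rTensor V ξ := by
  let : Algebra k R := Algebra.compHom R (algebraMap k K)
  have : IsScalarTower k K R := IsScalarTower.of_algebraMap_eq fun _ => rfl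
  rw [map_smul]
  congr 1
  induction ξ with
  | zero => rw [TensorProduct.tmul_zero, map_zero, map_zero]
  | add x y hx hy => rw [TensorProduct.tmul_add, map_add, map_add, hx, hy]
  | tmul r φ =>
    rw [TensorProduct.AlgebraTensorModule.cancelBaseChange_tmul, Algebra.smul_def, mul_one]
    rfl

/-- Under `R ⊗_K (K ⊗_k V) = R ⊗_k V`, the action of a point of the base change of `G` is its
action as a point of `G`. -/
lemma baseChange_act_one_tmul {V : Type*} [AddCommGroup V] [Module k V] (ρ : AlgRep G V)
    (x : (G.baseChange K).pts R) (ξ : K ⊗[k] V) :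
    letI : Algebra k R := Algebra.compHom R (algebraMap k K)
    haveI : IsScalarTower k K R := IsScalarTower.of_algebraMap_eq fun _ => rfl
    TensorProduct.AlgebraTensorModule.cancelBaseChange k K R R V
      ((ρ.baseChange K).act R x (1 ⊗ₜ ξ)) =
    ρ.act R (show G.pts R from x)
      (((Algebra.ofId K R).restrictScalars k).toLinearMap.rTensor V ξ) := by
  let : Algebra k R := Algebra.compHom R (algebraMap k K)
  have : IsScalarTower k K R := IsScalarTower.of_algebraMap_eq fun _ => rfl
  have h1 := cancelBaseChange_smul_tmul K (1 : R) ξ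
  rw [one_smul, one_smul] at h1
  rw [← h1]
  exact LinearEquiv.apply_symm_apply _ _

end BaseChange

end Morphisms

section Field

variable {K : Type w} [Field K] {G : GroupFunctor.{u, w} K}
variable {V : Type*} [AddCommGroup V] [Module K V] {V' : Type*} [AddCommGroup V'] [Module K V']

section Eval

variable (R : Type*) [CommRing R] [Algebra K R]

/-- The `R`-linear extension `R ⊗ V → R` of a linear form on `V`. -/
def ev (φ : V →ₗ[K] K) : R ⊗[K] V →ₗ[R] R :=
  (TensorProduct.AlgebraTensorModule.rid K R R).toLinearMap ∘ₗ φ.baseChange R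

variable {R}

@[simp]
lemma ev_tmul (φ : V →ₗ[K] K) (r : R) (v : V) : ev R φ (r ⊗ₜ v) = φ v • r := by
  simp [ev]

lemma ev_rTensor {S : Type*} [CommRing S] [Algebra K S] (f : R →ₐ[K] S) (φ : V →ₗ[K] K)
    (x : R ⊗[K] V) : ev S φ (f.toLinearMap.rTensor V x) = f (ev R φ x) := by
  induction x with
  | zero => simp
  | add a b ha hb => simp only [map_add, ha, hb]
  | tmul r v => simp

lemma ev_baseChange (f : V →ₗ[K] V') (φ : V' →ₗ[K] K) (x : R ⊗[K] V) :
    ev R φ (f.baseChange R x) = ev R (φ ∘ₗ f) x := by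
  simp [ev, LinearMap.baseChange_comp]

lemma ev_sub (φ ψ : V →ₗ[K] K) (x : R ⊗[K] V) : ev R (φ - ψ) x = ev R φ x - ev R ψ x := by
  simp [ev, LinearMap.baseChange_sub]

lemma eq_zero_of_ev {x : R ⊗[K] V} (h : ∀ φ : V →ₗ[K] K, ev R φ x = 0) : x = 0 := by
  let b := Module.Basis.ofVectorSpace K V
  have e : ∀ (y : R ⊗[K] V) i,
      (Algebra.TensorProduct.basis R b).repr y i = ev R (b.coord i) y := by
    intro y i
    induction y with
    | zero => simp
    | add y z hy hz => simp only [map_add, Finsupp.add_apply, hy, hz]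
    | tmul r v => simp [Algebra.smul_def, mul_comm]
  apply (Algebra.TensorProduct.basis R b).repr.injective
  ext i
  rw [map_zero, Finsupp.zero_apply, e, h]

lemma ev_eq_zero_of_mem {W : Submodule K V} {x : R ⊗[K] V} (hx : x ∈ W.baseChange R)
    {φ : V →ₗ[K] K} (hφ : ∀ w ∈ W, φ w = 0) : ev R φ x = 0 := by
  obtain ⟨y, rfl⟩ := hx
  rw [ev_baseChange]
  have : φ ∘ₗ W.subtype = 0 := LinearMap.ext fun w => hφ w w.2
  rw [this]
  simp [ev]

end Eval

section Stable

variable (ρ : AlgRep G V) (ρ' : AlgRep G V')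

lemma isStable_iff (W : Submodule K V) : ρ.IsStable W ↔
    ∀ (R : Type u) [CommRing R] [Algebra K R] (g : G.pts R), ∀ w ∈ W,
      ρ.act R g (1 ⊗ₜ w) ∈ W.baseChange R := by
  refine ⟨fun h R _ _ g w hw => h R g (Submodule.tmul_mem_baseChange_of_mem 1 hw),
    fun h R _ _ g => ?_⟩
  rw [Submodule.baseChange_eq_span, Submodule.span_le]
  rintro _ ⟨w, hw, rfl⟩
  rw [← Submodule.baseChange_eq_span]
  exact h R g w hw

variable {ρ ρ'}

lemma IsStable.map {f : V →ₗ[K] V'} (hf : IsEquivariant ρ ρ' f) {W : Submodule K V}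
    (hW : ρ.IsStable W) : ρ'.IsStable (W.map f) := by
  rw [isStable_iff]
  rintro R _ _ g _ ⟨w, hw, rfl⟩
  have e : (1 : R) ⊗ₜ[K] f w = f.baseChange R (1 ⊗ₜ w) := rfl
  rw [e, ← hf]
  obtain ⟨y, hy⟩ := (isStable_iff ρ W).1 hW R g w hw
  rw [← hy]
  refine ⟨(f.submoduleMap W).baseChange R y, ?_⟩
  rw [← LinearMap.comp_apply, ← LinearMap.comp_apply, ← LinearMap.baseChange_comp,
    ← LinearMap.baseChange_comp]
  rfl

lemma isStable_range {f : V →ₗ[K] V'} (hf : IsEquivariant ρ ρ' f) :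
    ρ'.IsStable (LinearMap.range f) := by
  rw [LinearMap.range_eq_map]
  refine IsStable.map hf ?_
  rw [isStable_iff]
  intro R _ _ g w _
  rw [Submodule.baseChange_top]
  trivial

variable (ρ)

/-- A linear projection onto a subspace. -/
def projection (W : Submodule K V) : V →ₗ[K] W :=
  Classical.choose (LinearMap.exists_leftInverse_of_injective W.subtype W.ker_subtype)

lemma projection_comp (W : Submodule K V) : projection W ∘ₗ W.subtype = LinearMap.id :=
  Classical.choose_spec (LinearMap.exists_leftInverse_of_injective W.subtype W.ker_subtype)

lemma projection_baseChange {R : Type*} [CommRing R] [Algebra K R] (W : Submodule K V)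
    {x : R ⊗[K] V} (hx : x ∈ W.baseChange R) :
    W.subtype.baseChange R ((projection W).baseChange R x) = x := by
  obtain ⟨y, rfl⟩ := hx
  rw [← LinearMap.comp_apply (LinearMap.baseChange R (projection W)),
    ← LinearMap.baseChange_comp, projection_comp, LinearMap.baseChange_id, LinearMap.id_apply]

/-- The representation on a stable subspace `W`; the restricted action on `R ⊗ W` is expressed
with a linear projection of the whole space onto `W`, on whose choice it does not depend. -/
def subrep (W : Submodule K V) (hW : ρ.IsStable W) : AlgRep G W where
  act R _ _ :=
    { toFun := fun g => (projection W).baseChange R ∘ₗ ρ.act R g ∘ₗ W.subtype.baseChange R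
      map_one' := by
        rw [map_one, Module.End.one_eq_id, LinearMap.id_comp, ← LinearMap.baseChange_comp,
          projection_comp, LinearMap.baseChange_id]
        rfl
      map_mul' := fun g h => by
        refine LinearMap.ext fun x => ?_
        have hx : ρ.act R h (W.subtype.baseChange R x) ∈ W.baseChange R := hW R h ⟨x, rfl⟩
        simp only [LinearMap.comp_apply, Module.End.mul_apply, map_mul,
          projection_baseChange W hx] }
  natural {R S} _ _ _ _ f g x := by
    simp only [MonoidHom.coe_mk, OneHom.coe_mk, LinearMap.comp_apply]
    rw [LinearMap.rTensor_baseChange, ρ.natural, LinearMap.rTensor_baseChange]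

variable {ρ}

lemma subrep_subtype (W : Submodule K V) (hW : ρ.IsStable W) :
    IsEquivariant (ρ.subrep W hW) ρ W.subtype := by
  intro R _ _ g x
  exact projection_baseChange W (hW R g ⟨x, rfl⟩)

/-- Criterion for the irreducibility of a stable subspace. -/
lemma subrep_isIrreducible (W : Submodule K V) (hW : ρ.IsStable W) (h0 : W ≠ ⊥)
    (h : ∀ U ≤ W, ρ.IsStable U → U ≠ ⊥ → W ≤ U) : (ρ.subrep W hW).IsIrreducible := by
  refine ⟨Submodule.nontrivial_iff_ne_bot.2 h0, fun U hU => ?_⟩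
  by_cases hU0 : U = ⊥
  · exact Or.inl hU0
  right
  have h1 : W ≤ U.map W.subtype := by
    refine h _ (Submodule.map_subtype_le _ _) (hU.map (subrep_subtype W hW)) ?_
    rw [← Submodule.map_bot W.subtype]
    exact (Submodule.map_injective_of_injective W.injective_subtype).ne hU0
  rw [eq_top_iff]
  rintro ⟨w, hw⟩ _
  obtain ⟨u, hu, e⟩ := h1 hw
  have : u = ⟨w, hw⟩ := Subtype.ext e
  rwa [← this]

end Stable

section Kernel

variable (ρ : AlgRep G V) (ψ : V →ₗ[K] K)

/-- The vectors all of whose translates are annihilated by a linear form. -/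
def translatesKer : Submodule K V where
  carrier := {w | ∀ (R : Type u) [CommRing R] [Algebra K R] (g : G.pts R),
    ev R ψ (ρ.act R g (1 ⊗ₜ w)) = 0}
  zero_mem' := fun R _ _ g => by simp
  add_mem' := fun {a b} ha hb R _ _ g => by
    rw [TensorProduct.tmul_add, map_add, map_add, ha, hb, add_zero]
  smul_mem' := fun c a ha R _ _ g => by
    have e : (1 : R) ⊗ₜ[K] (c • a) = algebraMap K R c • (1 ⊗ₜ a) := by
      rw [algebraMap_smul, TensorProduct.tmul_smul]
    rw [e, map_smul, map_smul, ha, smul_zero]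

/-- The kernel of the matrix coefficients of a linear form is stable: over `S ⊗ R`, the product of
a point over `S` and a point over `R` is again a point. -/
lemma isStable_translatesKer {K : Type u} [Field K] {G : GroupFunctor.{u, u} K} [Module K V]
    (ρ : AlgRep G V) (ψ : V →ₗ[K] K) : ρ.IsStable (ρ.translatesKer ψ) := by
  classical
  rw [isStable_iff]
  intro R _ _ g w hw
  let b := Module.Basis.ofVectorSpace K R
  have hx := TensorProduct.equivFinsuppOfBasisLeft_symm_apply b
    (TensorProduct.equivFinsuppOfBasisLeft b (ρ.act R g (1 ⊗ₜ w)))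
  rw [LinearEquiv.symm_apply_apply] at hx
  set c := TensorProduct.equivFinsuppOfBasisLeft b (ρ.act R g (1 ⊗ₜ w)) with hc
  have hmem : ∀ i, c i ∈ ρ.translatesKer ψ := by
    intro i S _ _ y
    let inl : S →ₐ[K] S ⊗[K] R := Algebra.TensorProduct.includeLeft
    let inr : R →ₐ[K] S ⊗[K] R := Algebra.TensorProduct.includeRight
    have h1 := hw (S ⊗[K] R) (G.map inl y * G.map inr g)
    have e1 : (1 : S ⊗[K] R) ⊗ₜ[K] w = inr.toLinearMap.rTensor V ((1 : R) ⊗ₜ w) := by simp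
    rw [map_mul, Module.End.mul_apply, e1, ← ρ.natural, hx, Finsupp.sum, map_sum, map_sum,
      map_sum] at h1
    have e2 : ∀ i, ev (S ⊗[K] R) ψ (ρ.act (S ⊗[K] R) (G.map inl y)
        (inr.toLinearMap.rTensor V (b i ⊗ₜ[K] c i))) =
        ev S ψ (ρ.act S y (1 ⊗ₜ c i)) ⊗ₜ b i := by
      intro i
      have e3 : inr.toLinearMap.rTensor V (b i ⊗ₜ[K] c i) =
          inr (b i) • inl.toLinearMap.rTensor V ((1 : S) ⊗ₜ c i) := by
        simp [TensorProduct.smul_tmul']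
      rw [e3, map_smul, ← ρ.natural, map_smul, ev_rTensor, smul_eq_mul]
      simp [inl, inr]
    rw [Finset.sum_congr rfl fun i _ => e2 i] at h1
    have h2 := TensorProduct.sum_tmul_basis_right_eq_zero b
      (Finsupp.onFinset c.support (fun i => ev S ψ (ρ.act S y (1 ⊗ₜ c i))) fun i hi => by
        rw [Finsupp.mem_support_iff]
        intro h0
        rw [h0] at hi
        simp at hi) (by
        rw [Finsupp.onFinset_sum]
        · exact h1
        · intro i
          exact TensorProduct.zero_tmul _ _)
    exact DFunLike.congr_fun h2 i
  rw [hx, Finsupp.sum]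
  exact Submodule.sum_mem _ fun i _ => Submodule.tmul_mem_baseChange_of_mem _ (hmem i)

end Kernel

end Field

end AlgRep

/-! ### Highest weight theory for a group with the points of `GL_g × 𝔾_m` -/

/-- Gauss decomposition of a matrix which is congruent to the identity modulo an ideal contained
in the Jacobson radical. -/
lemma Matrix.exists_lower_mul_upper {S : Type*} [CommRing S] (I : Ideal S)
    (hI : ∀ x ∈ I, IsUnit (1 + x)) : ∀ (n : ℕ) (A : Matrix (Fin n) (Fin n) S),
    (∀ i j, A i j - (1 : Matrix (Fin n) (Fin n) S) i j ∈ I) →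
    ∃ L U : Matrix (Fin n) (Fin n) S, (∀ i j, i < j → L i j = 0) ∧ (∀ i, L i i = 1) ∧
      (∀ i j, j < i → U i j = 0) ∧ A = L * U := by
  intro n
  induction n with
  | zero => exact fun A _ => ⟨1, 1, by simp, by simp, by simp, Matrix.ext fun i => i.elim0⟩
  | succ n ih =>
    intro A hA
    obtain ⟨a, ha⟩ : IsUnit (A 0 0) := by
      have := hI _ (hA 0 0)
      rwa [Matrix.one_apply_eq, add_sub_cancel] at this
    let B : Matrix (Fin n) (Fin n) S := Matrix.of fun i j =>
      A i.succ j.succ - A i.succ 0 * ((a⁻¹ : Sˣ) : S) * A 0 j.succ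
    have hB : ∀ i j, B i j - (1 : Matrix (Fin n) (Fin n) S) i j ∈ I := by
      intro i j
      have h1 := hA i.succ j.succ
      have h2 : A 0 j.succ ∈ I := by
        have := hA 0 j.succ
        rwa [Matrix.one_apply_ne (Fin.succ_ne_zero j).symm, sub_zero] at this
      have h3 : (1 : Matrix (Fin (n + 1)) (Fin (n + 1)) S) i.succ j.succ =
          (1 : Matrix (Fin n) (Fin n) S) i j := by
        simp [Matrix.one_apply]
      rw [h3] at h1
      have : B i j - (1 : Matrix (Fin n) (Fin n) S) i j =
          (A i.succ j.succ - (1 : Matrix (Fin n) (Fin n) S) i j) -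
            A i.succ 0 * ((a⁻¹ : Sˣ) : S) * A 0 j.succ := by
        simp only [B, Matrix.of_apply]
        ring
      rw [this]
      exact I.sub_mem h1 (I.mul_mem_left _ h2)
    obtain ⟨L, U, hL, hL1, hU, hLU⟩ := ih B hB
    let L' : Matrix (Fin (n + 1)) (Fin (n + 1)) S := Matrix.of (Fin.cons (Fin.cons 1 0)
      fun i => Fin.cons (A i.succ 0 * ((a⁻¹ : Sˣ) : S)) (L i))
    let U' : Matrix (Fin (n + 1)) (Fin (n + 1)) S := Matrix.of (Fin.cons (A 0)
      fun i => Fin.cons 0 (U i))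
    refine ⟨L', U', ?_, ?_, ?_, ?_⟩
    · intro i j hij
      induction j using Fin.cases with
      | zero => exact absurd hij (Fin.not_lt_zero i)
      | succ j =>
        induction i using Fin.cases with
        | zero => rfl
        | succ i => exact hL i j (Fin.succ_lt_succ_iff.1 hij)
    · intro i
      induction i using Fin.cases with
      | zero => rfl
      | succ i => exact hL1 i
    · intro i j hij
      induction i using Fin.cases with
      | zero => exact absurd hij (Fin.not_lt_zero j)
      | succ i =>
        induction j using Fin.cases with
        | zero => rfl
        | succ j => exact hU i j (Fin.succ_lt_succ_iff.1 hij)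
    · ext i j
      rw [Matrix.mul_apply, Fin.sum_univ_succ]
      induction i using Fin.cases with
      | zero => simp [L', U']
      | succ i =>
        induction j using Fin.cases with
        | zero => simp [L', U', ← ha]
        | succ j =>
          have h1 : B i j = ∑ k, L i k * U k j := by rw [hLU, Matrix.mul_apply]
          simp only [B, Matrix.of_apply, sub_eq_iff_eq_add'] at h1
          simpa [L', U'] using h1

/-- Homomorphisms, natural in `R`, of `GL_g(R) × Rˣ` onto the groups of `R`-points of `G`. -/
structure GLParam {K : Type u} [Field K] (G : GroupFunctor.{u, u} K) (g : ℕ) where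
  pt : ∀ (R : Type u) [CommRing R] [Algebra K R],
    Matrix.GeneralLinearGroup (Fin g) R × Rˣ →* G.pts R
  map_pt : ∀ {R S : Type u} [CommRing R] [Algebra K R] [CommRing S] [Algebra K S] (f : R →ₐ[K] S)
    (A : Matrix.GeneralLinearGroup (Fin g) R) (ν : Rˣ),
    G.map f (pt R (A, ν)) =
      pt S (Matrix.GeneralLinearGroup.map (f : R →+* S) A, Units.map (f : R →* S) ν)
  surjective : ∀ (R : Type u) [CommRing R] [Algebra K R], Function.Surjective (pt R)

namespace AlgRep

variable {K : Type u} [Field K] {G : GroupFunctor.{u, u} K} {g : ℕ} (P : GLParam G g)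
variable {V : Type*} [AddCommGroup V] [Module K V] {V' : Type*} [AddCommGroup V'] [Module K V']

lemma rTensor_smul {R S : Type*} [CommRing R] [Algebra K R] [CommRing S] [Algebra K S]
    (f : R →ₐ[K] S) (r : R) (y : R ⊗[K] V) :
    f.toLinearMap.rTensor V (r • y) = f r • f.toLinearMap.rTensor V y := by
  induction y with
  | zero => simp
  | add y z hy hz => simp only [smul_add, map_add, hy, hz]
  | tmul s v => simp [TensorProduct.smul_tmul']

open Polynomial LaurentPolynomial in
/-- A non-zero representation has a non-zero linear form which is invariant under lower unipotent
matrices: the lowest coefficient of the action of the one-parameter group `diag (T ^ l)`.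
Conjugation by this group contracts lower unipotent matrices to the identity as `T → 0`. -/
lemma exists_unipotent_invariant_form [Module.Finite K V] [Nontrivial V] (ρ : AlgRep G V) :
    ∃ ψ : V →ₗ[K] K, ψ ≠ 0 ∧ ∀ (R : Type u) [CommRing R] [Algebra K R]
      (A : Matrix.GeneralLinearGroup (Fin g) R), (∀ i j, i < j → A i j = 0) → (∀ i, A i i = 1) →
      ∀ x, ev R ψ (ρ.act R (P.pt R (A, 1)) x) = ev R ψ x := by
  classical
  let τ : ∀ (R : Type u) [CommRing R], Matrix.GeneralLinearGroup (Fin g) R[T;T⁻¹] := fun R _ =>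
    Matrix.GeneralLinearGroup.mk'' (Matrix.diagonal fun l => T (l : ℕ)) (by
      rw [Matrix.det_diagonal]
      exact (IsUnit.prod_univ_iff).2 fun l => isUnit_T _)
  let b := Module.finBasis K V
  let t : V →ₗ[K] K[T;T⁻¹] ⊗[K] V :=
    ((ρ.act K[T;T⁻¹] (P.pt _ (τ K, 1))).restrictScalars K) ∘ₗ TensorProduct.mk K _ V 1
  -- clear denominators: `T ^ m` times the action of the one-parameter group is polynomial
  have hden : ∃ (m : ℕ), ∀ i j, ∃ p : K[X],
      toLaurent p = T m * ev K[T;T⁻¹] (b.coord i) (t (b j)) := by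
    choose n p hp using fun i j => exists_T_pow (ev K[T;T⁻¹] (b.coord i) (t (b j)))
    refine ⟨∑ i, ∑ j, n i j, fun i j => ?_⟩
    have hle : n i j ≤ ∑ i, ∑ j, n i j :=
      (Finset.single_le_sum (f := fun j => n i j) (fun _ _ => Nat.zero_le _)
        (Finset.mem_univ j)).trans
        (Finset.single_le_sum (f := fun i => ∑ j, n i j) (fun _ _ => Nat.zero_le _)
          (Finset.mem_univ i))
    obtain ⟨d, hd⟩ := Nat.exists_eq_add_of_le hle
    refine ⟨p i j * X ^ d, ?_⟩
    rw [map_mul, hp, toLaurent_X_pow, mul_assoc, ← T_add, hd, mul_comm]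
    push_cast
    rfl
  obtain ⟨m, hm⟩ := hden
  choose p hp using hm
  let Z : V →ₗ[K] K[X] ⊗[K] V := b.constr K fun j => ∑ i, p i j ⊗ₜ b i
  have hZ : ∀ w, (toLaurentAlg (R := K)).toLinearMap.rTensor V (Z w) =
      (T m : K[T;T⁻¹]) • t w := by
    intro w
    have e : ((toLaurentAlg (R := K)).toLinearMap.rTensor V) ∘ₗ Z =
        (LinearMap.lsmul K[T;T⁻¹] _ (T m : K[T;T⁻¹])).restrictScalars K ∘ₗ t := by
      refine b.ext fun j => ?_
      have e1 : t (b j) = ∑ i, ev K[T;T⁻¹] (b.coord i) (t (b j)) ⊗ₜ b i := by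
        refine sub_eq_zero.1 (eq_zero_of_ev fun φ => ?_)
        have : φ = ∑ i, φ (b i) • b.coord i := by
          refine b.ext fun j => ?_
          simp
        have hev : ∀ y : K[T;T⁻¹] ⊗[K] V,
            ev K[T;T⁻¹] φ y = ∑ i, φ (b i) • ev K[T;T⁻¹] (b.coord i) y := by
          intro y
          induction y with
          | zero => simp
          | add y z hy hz => simp only [map_add, hy, hz, smul_add, Finset.sum_add_distrib]
          | tmul r v =>
            simp only [ev_tmul]
            conv_lhs => rw [this]
            simp only [LinearMap.sum_apply, LinearMap.smul_apply, Finset.sum_smul, smul_assoc]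
        rw [map_sub, hev, map_sum, sub_eq_zero]
        simp
      simp only [LinearMap.comp_apply, LinearMap.restrictScalars_apply, LinearMap.lsmul_apply]
      conv_rhs => rw [e1]
      simp only [Z, Module.Basis.constr_basis, map_sum, LinearMap.rTensor_tmul,
        AlgHom.toLinearMap_apply, toLaurentAlg_apply, hp, Finset.smul_sum,
        TensorProduct.smul_tmul', smul_eq_mul]
    exact LinearMap.congr_fun e w
  have hZ0 : ∃ N : ℕ, ∃ (φ : V →ₗ[K] K) (w : V), (ev K[X] φ (Z w)).coeff N ≠ 0 := by
    by_contra hne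
    push Not at hne
    obtain ⟨w, hw⟩ := exists_ne (0 : V)
    have h1 : Z w = 0 := eq_zero_of_ev fun φ => Polynomial.ext fun N => by
      rw [hne]
      simp
    have h2 := hZ w
    rw [h1, map_zero] at h2
    have h3 : t w = 0 := by
      have := congrArg (fun y => (T (-m : ℤ) : K[T;T⁻¹]) • y) h2
      beta_reduce at this
      rw [smul_zero, smul_smul, ← T_add, neg_add_cancel, T_zero, one_smul] at this
      exact this.symm
    have h4 : (1 : K[T;T⁻¹]) ⊗ₜ[K] w = 0 := by
      have e : ρ.act K[T;T⁻¹] ((P.pt _ (τ K, 1))⁻¹) (t w) = 1 ⊗ₜ w := by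
        change ρ.act _ _ (ρ.act _ _ _) = _
        rw [← Module.End.mul_apply, ← map_mul, inv_mul_cancel, map_one, Module.End.one_apply]
        rfl
      rw [← e, h3, map_zero]
    obtain ⟨φ, hφ⟩ : ∃ φ : V →ₗ[K] K, φ w ≠ 0 := by
      by_contra hne
      push Not at hne
      exact hw ((Module.forall_dual_apply_eq_zero_iff K w).1 hne)
    have h5 := congrArg (ev K[T;T⁻¹] φ) h4
    rw [ev_tmul, map_zero] at h5
    exact hφ ((smul_eq_zero.1 h5).resolve_right one_ne_zero)
  let N := Nat.find hZ0
  obtain ⟨φ, w₀, hw₀⟩ := Nat.find_spec hZ0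
  have hmin : ∀ n < N, ∀ (φ : V →ₗ[K] K) w, (ev K[X] φ (Z w)).coeff n = 0 := by
    intro n hn φ w
    by_contra h
    exact Nat.find_min hZ0 hn ⟨φ, w, h⟩
  -- the form `ψ` takes the coefficient at `T ^ N`, the lowest one which occurs
  let ψ : V →ₗ[K] K := lcoeff K N ∘ₗ (ev K[X] φ).restrictScalars K ∘ₗ Z
  refine ⟨ψ, fun h0 => hw₀ (LinearMap.congr_fun h0 w₀), fun R _ _ A hA hA1 x => ?_⟩
  -- the lowest term of the action
  have hζ : ∀ w, ∃ ζ : K[X] ⊗[K] V, Z w = (X ^ N : K[X]) • ζ := by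
    intro w
    have : ∀ i, ∃ q, ev K[X] (b.coord i) (Z w) = X ^ N * q := fun i =>
      X_pow_dvd_iff.2 fun n hn => hmin n hn _ _
    choose q hq using this
    refine ⟨∑ i, q i ⊗ₜ b i, sub_eq_zero.1 ?_⟩
    have hb : ∀ y : K[X] ⊗[K] V, y = ∑ i, ev K[X] (b.coord i) y ⊗ₜ b i := by
      intro y
      induction y with
      | zero => simp
      | add y z hy hz =>
        conv_lhs => rw [hy, hz]
        simp only [map_add, TensorProduct.add_tmul, Finset.sum_add_distrib]
      | tmul r v =>
        conv_lhs => rw [← b.sum_repr v, TensorProduct.tmul_sum]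
        refine Finset.sum_congr rfl fun i _ => ?_
        rw [ev_tmul, TensorProduct.tmul_smul, TensorProduct.smul_tmul']
        rfl
    rw [sub_eq_zero, hb (Z w), Finset.smul_sum]
    refine Finset.sum_congr rfl fun i _ => ?_
    rw [hq, TensorProduct.smul_tmul', smul_eq_mul]
  let ι : R →ₐ[K] R[T;T⁻¹] := (Algebra.ofId R _).restrictScalars K
  let fX : K[X] →ₐ[K] R[X] := Polynomial.mapAlgHom (Algebra.ofId K R)
  let fT : K[T;T⁻¹] →ₐ[K] R[T;T⁻¹] := AddMonoidAlgebra.mapAlgHom ℤ (Algebra.ofId K R)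
  let jR : R[X] →ₐ[K] R[T;T⁻¹] := (toLaurentAlg (R := R)).restrictScalars K
  have hfT : ∀ n : ℤ, fT (T n) = T n := by
    intro n
    simp only [fT, T]
    rw [AddMonoidAlgebra.mapAlgHom_single]
    simp
  have hcomp : fT.comp (toLaurentAlg (R := K)) = jR.comp fX := by
    refine Polynomial.algHom_ext ?_
    simp only [AlgHom.comp_apply, toLaurentAlg_apply, toLaurent_X, hfT, fX, jR,
      AlgHom.restrictScalars_apply]
    simp
  have hτ : Matrix.GeneralLinearGroup.map (fT : K[T;T⁻¹] →+* R[T;T⁻¹]) (τ K) = τ R := by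
    refine Matrix.GeneralLinearGroup.ext fun i j => ?_
    rw [Matrix.GeneralLinearGroup.map_apply]
    simp only [τ, Matrix.GeneralLinearGroup.val_mk'', Matrix.diagonal_apply]
    split_ifs
    · exact hfT _
    · exact map_zero _
  -- the action of the one-parameter group over `R`
  have hτZ : ∀ w, (T m : R[T;T⁻¹]) • ρ.act R[T;T⁻¹] (P.pt _ (τ R, 1)) (1 ⊗ₜ w) =
      jR.toLinearMap.rTensor V (fX.toLinearMap.rTensor V (Z w)) := by
    intro w
    have e1 := congrArg (fT.toLinearMap.rTensor V) (hZ w)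
    have e3 : fT.toLinearMap.rTensor V (t w) =
        ρ.act R[T;T⁻¹] (P.pt _ (τ R, 1)) (1 ⊗ₜ w) := by
      simp only [t, LinearMap.comp_apply, LinearMap.restrictScalars_apply,
        TensorProduct.mk_apply]
      rw [ρ.natural, P.map_pt, hτ, map_one]
      simp
    rw [rTensor_smul, hfT, e3] at e1
    rw [← e1, ← LinearMap.comp_apply (jR.toLinearMap.rTensor V), ← LinearMap.rTensor_comp,
      ← LinearMap.comp_apply, ← LinearMap.rTensor_comp]
    congr 2
    exact congrArg AlgHom.toLinearMap hcomp
  have hcoeff : ∀ f : R[X], (jR f).coeff (N : ℤ) = f.coeff N := fun f =>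
    Finsupp.mapDomain_apply Nat.castEmbedding.injective _ _
  -- the form `ψ` over `R`, as a coefficient
  have hi : ∀ η : R ⊗[K] V, ((T m : R[T;T⁻¹]) * ev R[T;T⁻¹] φ (ρ.act R[T;T⁻¹]
      (P.pt _ (τ R, 1)) (ι.toLinearMap.rTensor V η))).coeff (N : ℤ) = ev R ψ η := by
    intro η
    induction η with
    | zero => simp
    | add y z hy hz =>
      simp only [map_add, mul_add, AddMonoidAlgebra.coeff_add, Finsupp.add_apply, hy, hz]
    | tmul r v =>
      have e1 : ι.toLinearMap.rTensor V (r ⊗ₜ[K] v) = LaurentPolynomial.C r • ((1 : R[T;T⁻¹]) ⊗ₜ[K] v) := by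
        rw [LinearMap.rTensor_tmul, TensorProduct.smul_tmul', smul_eq_mul, mul_one]
        rfl
      rw [e1, map_smul, map_smul, smul_eq_mul, mul_left_comm, ← smul_eq_mul (T (m : ℤ)),
        ← map_smul, hτZ, ev_rTensor, ev_rTensor, ← LaurentPolynomial.smul_eq_C_mul,
        AddMonoidAlgebra.coeff_smul_apply, ev_tmul]
      have e2 : (jR (fX (ev K[X] φ (Z v)))).coeff (N : ℤ) =
          algebraMap K R ((ev K[X] φ (Z v)).coeff N) := by
        rw [hcoeff]
        simp [fX]
      rw [e2, smul_eq_mul, mul_comm, Algebra.smul_def]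
      rfl
  -- by the contraction, a lower unipotent matrix has no influence on the lowest term
  choose ζ hζ using hζ
  let f0 : R[X] →ₐ[K] R := (aeval (0 : R)).restrictScalars K
  have key : ∀ B : Matrix.GeneralLinearGroup (Fin g) R, (∀ i j, i < j → B i j = 0) →
      (∀ i, B i i = 1) → ∀ w, ev R ψ (ρ.act R (P.pt R (B, 1)) (1 ⊗ₜ w)) =
        ev R φ (f0.toLinearMap.rTensor V (fX.toLinearMap.rTensor V (ζ w))) := by
    intro B hB hB1 w
    -- the conjugate `u` of `B`, which is polynomial and equal to the identity at `X = 0`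
    let M : Matrix (Fin g) (Fin g) R[X] := Matrix.of fun l k =>
      if k ≤ l then Polynomial.C (B l k) * X ^ ((l : ℕ) - k) else 0
    have hM : M.det = 1 := by
      rw [Matrix.det_of_isLowerTriangular M]
      · exact Finset.prod_eq_one fun l _ => by simp [M, hB1]
      · intro l k hlk
        exact if_neg (not_le.2 hlk)
    let u : Matrix.GeneralLinearGroup (Fin g) R[X] :=
      Matrix.GeneralLinearGroup.mk'' M (by rw [hM]; exact isUnit_one)
    have hconj : τ R * Matrix.GeneralLinearGroup.map (ι : R →+* R[T;T⁻¹]) B =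
        Matrix.GeneralLinearGroup.map (jR : R[X] →+* R[T;T⁻¹]) u * τ R := by
      refine Matrix.GeneralLinearGroup.ext fun l k => ?_
      simp only [Matrix.GeneralLinearGroup.coe_mul, τ, Matrix.GeneralLinearGroup.val_mk'']
      rw [Matrix.diagonal_mul, Matrix.mul_diagonal]
      simp only [Matrix.GeneralLinearGroup.map_apply, u, Matrix.GeneralLinearGroup.val_mk'', M,
        Matrix.of_apply]
      change T ((l : ℕ) : ℤ) * LaurentPolynomial.C (B l k) = toLaurent _ * _
      split_ifs with h
      · rw [map_mul, toLaurent_C, toLaurent_X_pow, mul_assoc, ← T_add, mul_comm]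
        congr 2
        have : (k : ℕ) ≤ l := h
        omega
      · rw [hB l k (not_le.1 h), map_zero, map_zero, mul_zero, zero_mul]
    have hu0 : Matrix.GeneralLinearGroup.map (f0 : R[X] →+* R) u = 1 := by
      refine Matrix.GeneralLinearGroup.ext fun l k => ?_
      simp only [Matrix.GeneralLinearGroup.map_apply, u, Matrix.GeneralLinearGroup.val_mk'', M,
        Matrix.of_apply, Matrix.GeneralLinearGroup.coe_one]
      change aeval (0 : R) _ = _
      rcases lt_trichotomy k l with h | rfl | h
      · have : ((l : ℕ) - k) ≠ 0 := by
          have : (k : ℕ) < l := h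
          omega
        rw [if_pos h.le, Matrix.one_apply_ne h.ne', map_mul, map_pow, aeval_X, zero_pow this,
          mul_zero]
      · simp [hB1]
      · rw [if_neg (not_le.2 h), map_zero, Matrix.one_apply_ne h.ne]
    have e1 : ι.toLinearMap.rTensor V (ρ.act R (P.pt R (B, 1)) (1 ⊗ₜ w)) =
        ρ.act _ (P.pt _ (Matrix.GeneralLinearGroup.map (ι : R →+* R[T;T⁻¹]) B, 1)) (1 ⊗ₜ w) := by
      rw [ρ.natural, P.map_pt, map_one]
      simp
    have e2 : jR.toLinearMap.rTensor V (ρ.act R[X] (P.pt _ (u, 1))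
        (fX.toLinearMap.rTensor V (Z w))) = (T m : R[T;T⁻¹]) • ρ.act _ (P.pt _ (τ R, 1))
          (ι.toLinearMap.rTensor V (ρ.act R (P.pt R (B, 1)) (1 ⊗ₜ w))) := by
      rw [ρ.natural, ← hτZ, map_smul, P.map_pt, map_one, e1, ← Module.End.mul_apply,
        ← Module.End.mul_apply, ← map_mul, ← map_mul, ← map_mul, ← map_mul, Prod.mk_mul_mk,
        Prod.mk_mul_mk, hconj]
    rw [← hi, ← smul_eq_mul (T (m : ℤ)), ← map_smul, ← e2, ev_rTensor, hcoeff, hζ, rTensor_smul,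
      map_smul, map_smul]
    have e3 : fX (X ^ N) = X ^ N := by simp [fX]
    rw [e3, smul_eq_mul, coeff_X_pow_mul', if_pos le_rfl, Nat.sub_self, coeff_zero_eq_aeval_zero]
    change f0 _ = _
    rw [← ev_rTensor, ρ.natural, P.map_pt, hu0, map_one, ← Prod.one_eq_mk, map_one, map_one,
      Module.End.one_apply]
  have h1 := key 1 (fun i j h => Matrix.one_apply_ne h.ne) fun i => Matrix.one_apply_eq i
  rw [← Prod.one_eq_mk, map_one, map_one] at h1
  induction x with
  | zero => simp
  | add y z hy hz => simp only [map_add, hy, hz]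
  | tmul r v =>
    have e : r ⊗ₜ[K] v = r • ((1 : R) ⊗ₜ v) := by
      rw [TensorProduct.smul_tmul', smul_eq_mul, mul_one]
    rw [e, map_smul, map_smul, map_smul, key A hA hA1, ← h1, Module.End.one_apply]

end AlgRep

namespace AlgRep

variable {K : Type u} [Field K] {G : GroupFunctor.{u, u} K} {g : ℕ} (P : GLParam G g)
variable {V : Type*} [AddCommGroup V] [Module K V] {V' : Type*} [AddCommGroup V'] [Module K V']

/-- Upper triangular matrices act on `v` and on `v'` through the same weight. -/
def HaveCommonWeight (ρ : AlgRep G V) (ρ' : AlgRep G V') (v : V) (v' : V') : Prop :=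
  ∀ (R : Type u) [CommRing R] [Algebra K R] (A : Matrix.GeneralLinearGroup (Fin g) R) (ν : Rˣ),
    (∀ l' l, l < l' → A l' l = 0) → ∃ χ : R,
      ρ.act R (P.pt R (A, ν)) (1 ⊗ₜ v) = χ • (1 ⊗ₜ v) ∧
      ρ'.act R (P.pt R (A, ν)) (1 ⊗ₜ v') = χ • (1 ⊗ₜ v')

/-- The linear form `ψ` is invariant under lower unipotent matrices. -/
def IsUnipotentInvariant (ρ : AlgRep G V) (ψ : V →ₗ[K] K) : Prop :=
  ∀ (R : Type u) [CommRing R] [Algebra K R] (A : Matrix.GeneralLinearGroup (Fin g) R),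
    (∀ i j, i < j → A i j = 0) → (∀ i, A i i = 1) →
      ∀ x, ev R ψ (ρ.act R (P.pt R (A, 1)) x) = ev R ψ x

variable {P} {ρ : AlgRep G V} {ρ' : AlgRep G V'} {ψ : V →ₗ[K] K} {ψ' : V' →ₗ[K] K} {v : V} {v' : V'}

open PowerSeries in
/-- The matrix coefficient is determined on the big cell, which contains all power series points
reducing to the identity. -/
lemma matrixCoeff_eq_of_constantCoeff (hψ : IsUnipotentInvariant P ρ ψ)
    (hψ' : IsUnipotentInvariant P ρ' ψ') (h : ψ v = ψ' v') (hv : HaveCommonWeight P ρ ρ' v v')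
    {R : Type u} [CommRing R] [Algebra K R] (A : Matrix.GeneralLinearGroup (Fin g) R⟦X⟧)
    (hA : ∀ i j, constantCoeff (A i j) = (1 : Matrix (Fin g) (Fin g) R) i j) (ν : R⟦X⟧ˣ) :
    ev _ ψ (ρ.act _ (P.pt _ (A, ν)) (1 ⊗ₜ v)) = ev _ ψ' (ρ'.act _ (P.pt _ (A, ν)) (1 ⊗ₜ v')) := by
  obtain ⟨L, U, hL, hL1, hU, hLU⟩ := Matrix.exists_lower_mul_upper
    (RingHom.ker (constantCoeff (R := R))) (fun x hx => by
      rw [PowerSeries.isUnit_iff_constantCoeff, map_add, map_one, RingHom.mem_ker.1 hx, add_zero]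
      exact isUnit_one) g A.1 (fun i j => by
        have h1 := hA i j
        rw [RingHom.mem_ker, map_sub, h1, sub_eq_zero]
        by_cases hij : i = j
        · subst hij
          simp
        · simp [Matrix.one_apply_ne hij])
  have hLdet : L.det = 1 := by
    rw [Matrix.det_of_isLowerTriangular L fun i j hij => hL i j hij]
    exact Finset.prod_eq_one fun i _ => hL1 i
  have hUdet : IsUnit U.det := by
    have h1 : IsUnit A.1.det := (Matrix.isUnit_iff_isUnit_det _).1 A.isUnit
    rwa [hLU, Matrix.det_mul, hLdet, one_mul] at h1
  let L' := Matrix.GeneralLinearGroup.mk'' L (by rw [hLdet]; exact isUnit_one)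
  let U' := Matrix.GeneralLinearGroup.mk'' U hUdet
  have hA' : (A, ν) = (L', 1) * (U', ν) := by
    rw [Prod.mk_mul_mk, one_mul]
    congr 1
    exact Units.ext hLU
  obtain ⟨χ, h1, h2⟩ := hv R⟦X⟧ U' ν fun l' l hl => hU l' l hl
  rw [hA', map_mul, map_mul, map_mul, Module.End.mul_apply, Module.End.mul_apply,
    hψ _ L' (fun i j hij => hL i j hij) (fun i => hL1 i),
    hψ' _ L' (fun i j hij => hL i j hij) (fun i => hL1 i), h1, h2, map_smul, map_smul, ev_tmul,
    ev_tmul, h]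

open Polynomial in
/-- Matrix coefficients of highest weight vectors against forms invariant under lower unipotent
matrices are determined by their value at the identity: they can be compared along the path
`1 + X (A - 1)` from the identity to `A`, in the neighbourhood `R⟦X⟧` of the identity. -/
lemma matrixCoeff_eq (hψ : IsUnipotentInvariant P ρ ψ)
    (hψ' : IsUnipotentInvariant P ρ' ψ') (h : ψ v = ψ' v') (hv : HaveCommonWeight P ρ ρ' v v')
    {R : Type u} [CommRing R] [Algebra K R] (x : G.pts R) :
    ev _ ψ (ρ.act _ x (1 ⊗ₜ v)) = ev _ ψ' (ρ'.act _ x (1 ⊗ₜ v')) := by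
  obtain ⟨⟨A, ν⟩, rfl⟩ := P.surjective R x
  let M : Matrix (Fin g) (Fin g) R[X] := 1 + (X : R[X]) • (A.1 - 1).map C
  have hM1 : (evalRingHom (1 : R)).mapMatrix M = A.1 := by
    ext l k
    by_cases hlk : l = k
    · subst hlk
      simp [M]
    · simp [M, Matrix.one_apply_ne hlk]
  have hM0 : (constantCoeff (R := R)).mapMatrix M = 1 := by
    ext l k
    by_cases hlk : l = k
    · subst hlk
      simp [M]
    · simp [M, Matrix.one_apply_ne hlk]
  -- the path is a point over `S`, which embeds into `R⟦X⟧` and maps to `R` by `X ↦ 1`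
  let S := Localization.Away M.det
  let p : R[X] →ₐ[K] PowerSeries R :=
    { coeToPowerSeries.ringHom with
      commutes' := fun r => by
        change ((Polynomial.C (algebraMap K R r) : R[X]) : PowerSeries R) = _
        rw [Polynomial.coe_C, PowerSeries.algebraMap_apply] }
  have hp : ∀ f, PowerSeries.constantCoeff (p f) = constantCoeff f := fun f => by
    change PowerSeries.constantCoeff (f : PowerSeries R) = _
    simp
  have hpd : IsUnit (p M.det) := by
    rw [PowerSeries.isUnit_iff_constantCoeff, hp, RingHom.map_det, hM0, Matrix.det_one]
    exact isUnit_one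
  let e1 : R[X] →ₐ[K] R := (aeval (1 : R)).restrictScalars K
  have he1 : IsUnit (e1 M.det) := by
    have : e1 M.det = A.1.det := by
      rw [← hM1, ← RingHom.map_det]
      rfl
    rw [this]
    exact (Matrix.isUnit_iff_isUnit_det _).1 A.isUnit
  let φ : S →ₐ[K] PowerSeries R := IsLocalization.Away.liftAlgHom (f := p) M.det hpd
  let φ' : S →ₐ[K] R := IsLocalization.Away.liftAlgHom (f := e1) M.det he1
  have hφ : ∀ f : R[X], φ (algebraMap _ S f) = p f := fun f => IsLocalization.Away.lift_eq _ hpd f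
  have hφ' : ∀ f : R[X], φ' (algebraMap _ S f) = e1 f :=
    fun f => IsLocalization.Away.lift_eq _ he1 f
  have hinj : Function.Injective φ := by
    rw [injective_iff_map_eq_zero]
    intro z hz
    obtain ⟨n, f, hf⟩ := IsLocalization.Away.surj M.det z
    have h1 := congrArg φ hf
    rw [map_mul, hz, zero_mul, hφ] at h1
    have h2 : f = 0 := Polynomial.coe_injective R (h1.symm.trans (map_zero p).symm)
    rw [h2, map_zero, ← map_pow] at hf
    exact (IsLocalization.map_units S
      (⟨M.det ^ n, n, rfl⟩ : Submonoid.powers M.det)).mul_left_eq_zero.1 hf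
  let B : Matrix.GeneralLinearGroup (Fin g) S :=
    Matrix.GeneralLinearGroup.mk'' ((algebraMap R[X] S).mapMatrix M) (by
      rw [← RingHom.map_det]
      exact IsLocalization.map_units S (⟨M.det, 1, pow_one _⟩ : Submonoid.powers M.det))
  let c : R →ₐ[K] S := ((Algebra.ofId R[X] S).restrictScalars K).comp
    ((Algebra.ofId R R[X]).restrictScalars K)
  let ν' : Sˣ := Units.map (c : R →* S) ν
  -- the two matrix coefficients agree over the localization
  have hS : ev S ψ (ρ.act S (P.pt S (B, ν')) (1 ⊗ₜ v)) =
      ev S ψ' (ρ'.act S (P.pt S (B, ν')) (1 ⊗ₜ v')) := by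
    apply hinj
    rw [← ev_rTensor, ← ev_rTensor, ρ.natural, ρ'.natural, P.map_pt, LinearMap.rTensor_tmul,
      LinearMap.rTensor_tmul, AlgHom.toLinearMap_apply, map_one]
    refine matrixCoeff_eq_of_constantCoeff hψ hψ' h hv _ (fun l k => ?_) _
    rw [← hM0]
    change PowerSeries.constantCoeff (φ (algebraMap _ _ (M l k))) = _
    rw [hφ, hp]
    rfl
  have hB : Matrix.GeneralLinearGroup.map (φ' : S →+* R) B = A := by
    refine Matrix.GeneralLinearGroup.ext fun l k => ?_
    change φ' (algebraMap _ _ (M l k)) = _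
    rw [hφ']
    exact congrFun (congrFun hM1 l) k
  have hν : Units.map (φ' : S →* R) ν' = ν := by
    refine Units.ext ?_
    change φ' (algebraMap _ _ (Polynomial.C (ν : R))) = _
    rw [hφ']
    exact aeval_C _ _
  have h1 := congrArg φ' hS
  rw [← ev_rTensor, ← ev_rTensor, ρ.natural, ρ'.natural, P.map_pt, LinearMap.rTensor_tmul,
    LinearMap.rTensor_tmul, AlgHom.toLinearMap_apply, map_one, hB, hν] at h1
  exact h1

/-- In an irreducible representation the matrix coefficients of a non-zero form separate vectors. -/
lemma translatesKer_eq_bot (hρ : ρ.IsIrreducible) (hψ0 : ψ ≠ 0) : ρ.translatesKer ψ = ⊥ := by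
  refine (hρ.2 _ (isStable_translatesKer ρ ψ)).resolve_right fun htop => hψ0 ?_
  refine LinearMap.ext fun w => ?_
  have hw : w ∈ ρ.translatesKer ψ := htop ▸ Submodule.mem_top
  have := hw K 1
  rw [map_one, Module.End.one_apply, ev_tmul] at this
  simpa using this

lemma HaveCommonWeight.left (hv : HaveCommonWeight P ρ ρ' v v') :
    HaveCommonWeight P ρ ρ v v := fun R _ _ A ν hA => by
  obtain ⟨χ, h, -⟩ := hv R A ν hA
  exact ⟨χ, h, h⟩

lemma HaveCommonWeight.right (hv : HaveCommonWeight P ρ ρ' v v') :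
    HaveCommonWeight P ρ' ρ' v' v' := fun R _ _ A ν hA => by
  obtain ⟨χ, -, h⟩ := hv R A ν hA
  exact ⟨χ, h, h⟩

/-- A non-zero form which is invariant under lower unipotent matrices does not vanish on a highest
weight vector: otherwise all its matrix coefficients at this vector would vanish. -/
lemma form_highestWeight_ne_zero (hρ : ρ.IsIrreducible) (hψ0 : ψ ≠ 0)
    (hψ : IsUnipotentInvariant P ρ ψ) (hv0 : v ≠ 0) (hv : HaveCommonWeight P ρ ρ v v) :
    ψ v ≠ 0 := by
  intro h0
  have hz : IsUnipotentInvariant P ρ (0 : V →ₗ[K] K) := by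
    intro R _ _ A _ _ x
    simp [ev]
  have h1 : v ∈ ρ.translatesKer ψ := by
    intro R _ _ x
    rw [matrixCoeff_eq hψ hz (by simpa using h0) hv]
    simp [ev]
  rw [translatesKer_eq_bot hρ hψ0] at h1
  exact hv0 h1

/-- Irreducible representations with the same highest weight are isomorphic. The isomorphism has
as graph the subspace of the `(w, w')` with equal matrix coefficients. -/
theorem isIso_of_haveCommonWeight [Module.Finite K V] [Module.Finite K V'] (hρ : ρ.IsIrreducible)
    (hρ' : ρ'.IsIrreducible) (hv0 : v ≠ 0) (hv0' : v' ≠ 0)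
    (hv : HaveCommonWeight P ρ ρ' v v') : IsIso ρ ρ' := by
  have := hρ.1
  have := hρ'.1
  obtain ⟨ψ, hψ0, hψ⟩ := exists_unipotent_invariant_form P ρ
  obtain ⟨ψ₁, hψ₁0, hψ₁⟩ := exists_unipotent_invariant_form P ρ'
  have hψv := form_highestWeight_ne_zero hρ hψ0 hψ hv0 hv.left
  have hψ₁v := form_highestWeight_ne_zero hρ' hψ₁0 hψ₁ hv0' hv.right
  -- normalize the second form
  let r : K := ψ v / ψ₁ v'
  have hr : r ≠ 0 := div_ne_zero hψv hψ₁v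
  let ψ' : V' →ₗ[K] K := r • ψ₁
  have hψ'0 : ψ' ≠ 0 := smul_ne_zero hr hψ₁0
  have hev : ∀ (R : Type u) [CommRing R] [Algebra K R] (y : R ⊗[K] V'),
      ev R ψ' y = r • ev R ψ₁ y := by
    intro R _ _ y
    simp only [ev, ψ', LinearMap.baseChange_smul, LinearMap.comp_apply, LinearMap.smul_apply]
    rw [← algebraMap_smul R r, map_smul, algebraMap_smul]
  have hψ' : IsUnipotentInvariant P ρ' ψ' := by
    intro R _ _ A hA hA1 x
    rw [hev, hev, hψ₁ R A hA hA1]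
  have hvv : ψ v = ψ' v' := by
    simp only [ψ', r, LinearMap.smul_apply, smul_eq_mul]
    field_simp
  let Ψ : V × V' →ₗ[K] K := ψ ∘ₗ LinearMap.fst K V V' - ψ' ∘ₗ LinearMap.snd K V V'
  let N := (ρ.prod ρ').translatesKer Ψ
  have hN : ∀ w w', (w, w') ∈ N ↔ ∀ (R : Type u) [CommRing R] [Algebra K R] (x : G.pts R),
      ev R ψ (ρ.act R x (1 ⊗ₜ w)) = ev R ψ' (ρ'.act R x (1 ⊗ₜ w')) := by
    intro w w'
    refine forall_congr' fun R => forall_congr' fun _ => forall_congr' fun _ =>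
      forall_congr' fun x => ?_
    rw [ev_sub, sub_eq_zero, ← ev_baseChange, ← ev_baseChange, isEquivariant_fst,
      isEquivariant_snd]
    rfl
  have hNs : (ρ.prod ρ').IsStable N := isStable_translatesKer _ _
  have hvN : (v, v') ∈ N := (hN _ _).2 fun R _ _ x =>
    matrixCoeff_eq hψ hψ' hvv hv x
  have hi := subrep_subtype N hNs
  let p₁ : N →ₗ[K] V := LinearMap.fst K V V' ∘ₗ N.subtype
  let p₂ : N →ₗ[K] V' := LinearMap.snd K V V' ∘ₗ N.subtype
  have hp₁ : IsEquivariant ((ρ.prod ρ').subrep N hNs) ρ p₁ := isEquivariant_fst.comp hi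
  have hp₂ : IsEquivariant ((ρ.prod ρ').subrep N hNs) ρ' p₂ := isEquivariant_snd.comp hi
  have hs₁ : Function.Surjective p₁ := LinearMap.range_eq_top.1
    ((hρ.2 _ (isStable_range hp₁)).resolve_left fun h0 => hv0
      ((Submodule.eq_bot_iff _).1 h0 v ⟨⟨_, hvN⟩, rfl⟩))
  have hs₂ : Function.Surjective p₂ := LinearMap.range_eq_top.1
    ((hρ'.2 _ (isStable_range hp₂)).resolve_left fun h0 => hv0'
      ((Submodule.eq_bot_iff _).1 h0 v' ⟨⟨_, hvN⟩, rfl⟩))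
  have hi₁ : Function.Injective p₁ := by
    rw [injective_iff_map_eq_zero]
    rintro ⟨⟨w, w'⟩, hw⟩ (rfl : w = 0)
    have h1 : w' ∈ ρ'.translatesKer ψ' := fun R _ _ x => by
      have := (hN _ _).1 hw R x
      rw [← this]
      simp
    rw [translatesKer_eq_bot hρ' hψ'0, Submodule.mem_bot] at h1
    subst h1
    rfl
  have hi₂ : Function.Injective p₂ := by
    rw [injective_iff_map_eq_zero]
    rintro ⟨⟨w, w'⟩, hw⟩ (rfl : w' = 0)
    have h1 : w ∈ ρ.translatesKer ψ := fun R _ _ x => by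
      have := (hN _ _).1 hw R x
      rw [this]
      simp
    rw [translatesKer_eq_bot hρ hψ0, Submodule.mem_bot] at h1
    subst h1
    rfl
  let e₁ := LinearEquiv.ofBijective p₁ ⟨hi₁, hs₁⟩
  let e₂ := LinearEquiv.ofBijective p₂ ⟨hi₂, hs₂⟩
  have he₁ : IsEquivariant ((ρ.prod ρ').subrep N hNs) ρ e₁.toLinearMap := hp₁
  have he₂ : IsEquivariant ((ρ.prod ρ').subrep N hNs) ρ' e₂.toLinearMap := hp₂
  exact ⟨e₁.symm.trans e₂, he₂.comp he₁.symm⟩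

end AlgRep

/-! ### Points of the unitary similitude group -/

namespace UnitaryDatum

variable {E 𝔙 : Type u} [Field E] [CharZero E] [AddCommGroup 𝔙] [Module E 𝔙] [Module ℚ 𝔙]
  [IsScalarTower ℚ E 𝔙]

/-- A generator of the quadratic field `E` whose square is rational, and which therefore changes
sign under the non-trivial automorphism. -/
structure SqrtGenerator (D : UnitaryDatum E 𝔙) (i j : E →ₐ[ℚ] E) where
  δ : E
  norm : ℚ
  sq : δ * δ = algebraMap ℚ E norm
  ne_zero : δ ≠ 0
  exists_eq : ∀ z : E, ∃ x y : ℚ, z = algebraMap ℚ E x + algebraMap ℚ E y * δ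
  map_eq_neg : j δ = -i δ
  conj_neg : D.conj δ = -δ

variable {D : UnitaryDatum E 𝔙} {i j : E →ₐ[ℚ] E}

/-- The conditions on `δ` are symmetric in the two embeddings. -/
def SqrtGenerator.swap (Δ : SqrtGenerator D i j) : SqrtGenerator D j i where
  δ := Δ.δ
  norm := Δ.norm
  sq := Δ.sq
  ne_zero := Δ.ne_zero
  exists_eq := Δ.exists_eq
  map_eq_neg := by rw [Δ.map_eq_neg, neg_neg]
  conj_neg := Δ.conj_neg

section Idempotents

variable (Δ : SqrtGenerator D i j) (R : Type*) [CommRing R] [Algebra ℚ R] [Algebra E R]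
  [IsScalarTower ℚ E R]

/-- The idempotent of `R ⊗ E ⊆ R ⊗ End_E(𝔙)` on which `E` acts through `i`. -/
def SqrtGenerator.idem : R ⊗[ℚ] Module.End E 𝔙 :=
  algebraMap E R 2⁻¹ ⊗ₜ 1 + algebraMap E R (2 * i Δ.δ)⁻¹ ⊗ₜ algebraMap E (Module.End E 𝔙) Δ.δ

variable {R}

lemma SqrtGenerator.map_ne_zero : i Δ.δ ≠ 0 := by
  rw [map_ne_zero_iff i i.injective]
  exact Δ.ne_zero

lemma SqrtGenerator.map_sq : i Δ.δ * i Δ.δ = algebraMap ℚ E Δ.norm := by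
  rw [← map_mul, Δ.sq, AlgHom.commutes]

lemma tmul_algebraMap_rat (r : R) (x : ℚ) :
    r ⊗ₜ[ℚ] algebraMap E (Module.End E 𝔙) (algebraMap ℚ E x) =
      (algebraMap E R (algebraMap ℚ E x) * r) ⊗ₜ 1 := by
  have : algebraMap E (Module.End E 𝔙) (algebraMap ℚ E x) = x • (1 : Module.End E 𝔙) := by
    ext v
    rw [Module.algebraMap_end_apply, algebraMap_smul]
    rfl
  rw [this, TensorProduct.tmul_smul, TensorProduct.smul_tmul', Algebra.smul_def,
    IsScalarTower.algebraMap_apply ℚ E R]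

/-- `E` acts on the image of the idempotent through `i`. -/
lemma SqrtGenerator.scalar_mul_idem (a : E) :
    ((1 : R) ⊗ₜ[ℚ] algebraMap E (Module.End E 𝔙) a) * Δ.idem R =
      algebraMap E R (i a) • Δ.idem R := by
  have hδ : ((1 : R) ⊗ₜ[ℚ] algebraMap E (Module.End E 𝔙) Δ.δ) * Δ.idem R =
      algebraMap E R (i Δ.δ) • Δ.idem R := by
    have h0 := Δ.map_ne_zero
    rw [idem, mul_add, Algebra.TensorProduct.tmul_mul_tmul, Algebra.TensorProduct.tmul_mul_tmul,
      ← map_mul (algebraMap E (Module.End E 𝔙)), Δ.sq, tmul_algebraMap_rat, smul_add,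
      TensorProduct.smul_tmul', TensorProduct.smul_tmul', add_comm, one_mul, one_mul, mul_one,
      smul_eq_mul, smul_eq_mul, ← map_mul, ← map_mul, ← map_mul]
    have e1 : algebraMap ℚ E Δ.norm * (2 * i Δ.δ)⁻¹ = i Δ.δ * 2⁻¹ := by
      rw [← Δ.map_sq]
      field_simp
    have e2 : i Δ.δ * (2 * i Δ.δ)⁻¹ = 2⁻¹ := by
      field_simp
    rw [e1, e2]
  obtain ⟨x, y, rfl⟩ := Δ.exists_eq a
  have e : (1 : R) ⊗ₜ[ℚ] algebraMap E (Module.End E 𝔙)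
      (algebraMap ℚ E x + algebraMap ℚ E y * Δ.δ) =
      algebraMap E R (algebraMap ℚ E x) • 1 + algebraMap E R (algebraMap ℚ E y) •
        ((1 : R) ⊗ₜ[ℚ] algebraMap E (Module.End E 𝔙) Δ.δ) := by
    have h1 : (1 : R) ⊗ₜ[ℚ] algebraMap E (Module.End E 𝔙) (algebraMap ℚ E y * Δ.δ) =
        ((1 : R) ⊗ₜ[ℚ] algebraMap E (Module.End E 𝔙) (algebraMap ℚ E y)) *
          ((1 : R) ⊗ₜ[ℚ] algebraMap E (Module.End E 𝔙) Δ.δ) := by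
      rw [Algebra.TensorProduct.tmul_mul_tmul, map_mul, one_mul]
    rw [map_add, TensorProduct.tmul_add, h1, tmul_algebraMap_rat, tmul_algebraMap_rat, mul_one,
      mul_one, Algebra.TensorProduct.tmul_mul_tmul, mul_one, one_mul,
      Algebra.TensorProduct.one_def, TensorProduct.smul_tmul', TensorProduct.smul_tmul',
      smul_eq_mul, smul_eq_mul, mul_one, mul_one]
  rw [e, add_mul, smul_mul_assoc, one_mul, smul_mul_assoc, hδ, smul_smul, ← add_smul, map_add,
    map_mul, AlgHom.commutes, AlgHom.commutes, map_add, map_mul]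

lemma SqrtGenerator.commute_idem (x : R ⊗[ℚ] Module.End E 𝔙) : Commute (Δ.idem R) x := by
  induction x with
  | zero => exact Commute.zero_right _
  | add x y hx hy => exact hx.add_right hy
  | tmul r f =>
    refine Commute.add_left ?_ ?_
    · change _ * _ = _ * _
      rw [Algebra.TensorProduct.tmul_mul_tmul, Algebra.TensorProduct.tmul_mul_tmul, mul_comm r,
        one_mul, mul_one]
    · change _ * _ = _ * _
      rw [Algebra.TensorProduct.tmul_mul_tmul, Algebra.TensorProduct.tmul_mul_tmul, mul_comm r,
        Algebra.commutes Δ.δ f]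

lemma SqrtGenerator.idem_add_swap : Δ.idem R + Δ.swap.idem R = 1 := by
  have e : algebraMap E R (2 * j Δ.swap.δ)⁻¹ = -algebraMap E R (2 * i Δ.δ)⁻¹ := by
    change algebraMap E R (2 * j Δ.δ)⁻¹ = _
    rw [Δ.map_eq_neg, mul_neg, inv_neg, map_neg (algebraMap E R)]
  rw [idem, idem, e]
  change _ + (_ + _ ⊗ₜ algebraMap E (Module.End E 𝔙) Δ.δ) = _
  rw [TensorProduct.neg_tmul, add_add_add_comm, add_neg_cancel, add_zero,
    ← TensorProduct.add_tmul, ← map_add, ← two_mul, mul_inv_cancel₀ two_ne_zero, map_one,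
    Algebra.TensorProduct.one_def]

lemma SqrtGenerator.mul_idem (x : R) (y : E) :
    (x ⊗ₜ[ℚ] algebraMap E (Module.End E 𝔙) y) * Δ.idem R =
      (x * algebraMap E R (i y)) • Δ.idem R := by
  have e : x ⊗ₜ[ℚ] algebraMap E (Module.End E 𝔙) y =
      x • ((1 : R) ⊗ₜ[ℚ] algebraMap E (Module.End E 𝔙) y) := by
    rw [TensorProduct.smul_tmul', smul_eq_mul, mul_one]
  rw [e, smul_mul_assoc, Δ.scalar_mul_idem, smul_smul]

lemma SqrtGenerator.idem_mul_idem : Δ.idem R * Δ.idem R = Δ.idem R := by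
  conv_lhs =>
    lhs
    rw [idem]
  rw [add_mul, ← map_one (algebraMap E (Module.End E 𝔙)), Δ.mul_idem, Δ.mul_idem, ← add_smul,
    map_one, map_one, mul_one, ← map_mul, ← map_add]
  have h0 := Δ.map_ne_zero
  have : (2⁻¹ + (2 * i Δ.δ)⁻¹ * i Δ.δ : E) = 1 := by
    field_simp
    norm_num
  rw [this, map_one, one_smul]

lemma SqrtGenerator.swap_idem_mul_idem : Δ.swap.idem R * Δ.idem R = 0 := by
  have h := congrArg (· * Δ.idem R) (Δ.idem_add_swap (R := R))
  simp only [add_mul, Δ.idem_mul_idem, one_mul] at h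
  simpa using h

lemma SqrtGenerator.idem_mul_swap_idem : Δ.idem R * Δ.swap.idem R = 0 := by
  rw [(Δ.commute_idem _).eq, Δ.swap_idem_mul_idem]

lemma SqrtGenerator.map_idem {S : Type*} [CommRing S] [Algebra ℚ S] [Algebra E S]
    [IsScalarTower ℚ E S] (f : R →ₐ[ℚ] S) (hf : ∀ z, f (algebraMap E R z) = algebraMap E S z) :
    Algebra.TensorProduct.map f (AlgHom.id ℚ (Module.End E 𝔙)) (Δ.idem R) = Δ.idem S := by
  simp [idem, hf]

end Idempotents

end UnitaryDatum

namespace UnitaryDatum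

/-- An imaginary quadratic field has such a generator; its square is negative, so that the
positive involution is not the identity. -/
lemma nonempty_sqrtGenerator {E 𝔙 : Type u} [Field E] [NumberField E] [AddCommGroup 𝔙] [Module E 𝔙]
    [Module ℚ 𝔙] (hE : Module.finrank ℚ E = 2)
    (hE' : NumberField.IsTotallyComplex E) (D : UnitaryDatum E 𝔙) (i j : E →ₐ[ℚ] E) (hij : i ≠ j) :
    Nonempty (SqrtGenerator D i j) := by
  obtain ⟨α, hα⟩ : ∃ α : E, α ∉ Set.range (algebraMap ℚ E) := by
    by_contra h
    push Not at h
    refine hij (AlgHom.ext fun z => ?_)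
    obtain ⟨x, rfl⟩ := h z
    rw [AlgHom.commutes, AlgHom.commutes]
  have hli : LinearIndependent ℚ ![(1 : E), α] := by
    rw [LinearIndependent.pair_iff' one_ne_zero]
    intro x hx
    exact hα ⟨x, by rw [Algebra.algebraMap_eq_smul_one, hx]⟩
  have hspan : ∀ z : E, ∃ x y : ℚ, x • (1 : E) + y • α = z := by
    have h := hli.span_eq_top_of_card_eq_finrank (by simp [hE])
    intro z
    have hz : z ∈ Submodule.span ℚ (Set.range ![(1 : E), α]) := h ▸ Submodule.mem_top
    rw [Matrix.range_cons, Matrix.range_cons, Matrix.range_empty, Set.union_empty,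
      Set.singleton_union] at hz
    exact Submodule.mem_span_pair.1 hz
  obtain ⟨q, p, hpq⟩ := hspan (α * α)
  -- complete the square
  let δ : E := α - algebraMap ℚ E (p / 2)
  let N : ℚ := q + p ^ 2 / 4
  have hδ : δ * δ = algebraMap ℚ E N := by
    have h1 : α * α = algebraMap ℚ E q + algebraMap ℚ E p * α := by
      rw [← hpq, Algebra.smul_def, Algebra.smul_def, mul_one]
    have h2 : δ * δ = α * α - 2 * algebraMap ℚ E (p / 2) * α + algebraMap ℚ E (p / 2) ^ 2 := by
      simp only [δ]
      ring
    rw [h2, h1]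
    simp only [N, map_add, map_div₀, map_pow, map_ofNat]
    ring
  have hgen : ∀ z : E, ∃ x y : ℚ, z = algebraMap ℚ E x + algebraMap ℚ E y * δ := by
    intro z
    obtain ⟨x, y, rfl⟩ := hspan z
    refine ⟨x + y * (p / 2), y, ?_⟩
    rw [Algebra.smul_def, Algebra.smul_def]
    simp only [δ, map_add, map_mul]
    ring
  have hδ0 : δ ≠ 0 := fun h => hα ⟨p / 2, (sub_eq_zero.1 h).symm⟩
  have hsq : ∀ x y : E, x * x = algebraMap ℚ E N → y * y = algebraMap ℚ E N → x = y ∨ x = -y :=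
    fun x y hx hy => mul_self_eq_mul_self_iff.1 (hx.trans hy.symm)
  have hi : i δ * i δ = algebraMap ℚ E N := by rw [← map_mul, hδ, AlgHom.commutes]
  have hj : j δ * j δ = algebraMap ℚ E N := by rw [← map_mul, hδ, AlgHom.commutes]
  have hc : D.conj δ * D.conj δ = algebraMap ℚ E N := by rw [← map_mul, hδ, AlgEquiv.commutes]
  refine ⟨⟨δ, N, hδ, hδ0, hgen, ?_, ?_⟩⟩
  · refine (hsq _ _ hj hi).resolve_left fun h => hij (AlgHom.ext fun z => ?_)
    obtain ⟨x, y, rfl⟩ := hgen z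
    simp only [map_add, map_mul, AlgHom.commutes, h]
  · refine (hsq _ _ hc hδ).resolve_left fun h => ?_
    have htr := D.conj_pos δ hδ0
    rw [h, hδ, Algebra.trace_algebraMap, hE, nsmul_eq_mul] at htr
    have hN : 0 < N := by
      have : (0 : ℚ) < 2 * N := by simpa using htr
      linarith
    -- a positive square would give a real embedding
    let φ : E →+* ℂ := Classical.arbitrary _
    have hφ : NumberField.ComplexEmbedding.IsReal φ := by
      refine RingHom.ext fun z => ?_
      rw [NumberField.ComplexEmbedding.conjugate_coe_eq]
      have h1 : φ δ * φ δ = ((Real.sqrt N : ℝ) : ℂ) * ((Real.sqrt N : ℝ) : ℂ) := by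
        rw [← map_mul, hδ, ← Complex.ofReal_mul, Real.mul_self_sqrt (by exact_mod_cast hN.le)]
        simp
      have h2 : (starRingEnd ℂ) (φ δ) = φ δ := by
        rcases mul_self_eq_mul_self_iff.1 h1 with h | h <;> rw [h] <;> simp
      obtain ⟨x, y, rfl⟩ := hgen z
      simp [h2]
    have h3 := hE'.isComplex (NumberField.InfinitePlace.mk φ)
    rw [← NumberField.InfinitePlace.not_isReal_iff_isComplex] at h3
    exact h3 ((NumberField.InfinitePlace.isReal_mk_iff).2 hφ)

end UnitaryDatum

namespace UnitaryDatum

variable {E 𝔙 : Type u} [Field E] [CharZero E] [AddCommGroup 𝔙] [Module E 𝔙] [Module ℚ 𝔙]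
  [IsScalarTower ℚ E 𝔙]

/-- Evaluation of the elements of `V₀ = E ⊗ 𝔙ᵛ` at a vector of `𝔙`. -/
def pair (v : 𝔙) : V0 𝔙 E →ₗ[E] E := AlgRep.ev E (Module.Dual.eval ℚ 𝔙 v)

lemma pair_tmul (v : 𝔙) (r : E) (φ : Module.Dual ℚ 𝔙) :
    pair v (r ⊗ₜ[ℚ] φ : V0 𝔙 E) = φ v • r := by
  rw [pair, AlgRep.ev_tmul, Module.Dual.eval_apply]

lemma pair_add (v v' : 𝔙) (ξ : V0 𝔙 E) : pair (v + v') ξ = pair v ξ + pair v' ξ := by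
  induction ξ using TensorProduct.induction_on with
  | zero => simp
  | add x y hx hy => simp only [map_add, hx, hy]; abel
  | tmul r φ => simp only [pair_tmul, map_add, add_smul]

lemma pair_zero (ξ : V0 𝔙 E) : pair 0 ξ = 0 := by
  induction ξ using TensorProduct.induction_on with
  | zero => simp
  | add x y hx hy => simp only [map_add, hx, hy, add_zero]
  | tmul r φ => simp only [pair_tmul, map_zero, zero_smul]

lemma scalarAct_baseChange (z : E) (ξ : V0 𝔙 E) :
    (scalarAct 𝔙 z).baseChange E ξ =
      transpose E 𝔙 E (1 ⊗ₜ algebraMap E (Module.End E 𝔙) z) ξ := by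
  induction ξ using TensorProduct.induction_on with
  | zero => simp
  | add x y hx hy => simp only [map_add, hx, hy]
  | tmul r φ =>
    rw [LinearMap.baseChange_tmul, transpose_tmul, one_mul]
    rfl

lemma pair_transpose (f : Module.End E 𝔙) (v : 𝔙) (ξ : V0 𝔙 E) :
    pair v (transpose E 𝔙 E (1 ⊗ₜ f) ξ) = pair (f v) ξ := by
  induction ξ using TensorProduct.induction_on with
  | zero => simp
  | add x y hx hy => simp only [map_add, hx, hy]
  | tmul r φ =>
    rw [transpose_tmul, pair_tmul, pair_tmul, one_mul]
    rfl

lemma mem_eigenPart {i : E →ₐ[ℚ] E} {ξ : V0 𝔙 E} : ξ ∈ eigenPart 𝔙 i ↔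
    ∀ z, transpose E 𝔙 E (1 ⊗ₜ algebraMap E (Module.End E 𝔙) z) ξ = i z • ξ := by
  simp only [eigenPart, Submodule.mem_iInf, LinearMap.mem_ker, LinearMap.sub_apply,
    LinearMap.smul_apply, LinearMap.id_apply, sub_eq_zero, scalarAct_baseChange]

lemma pair_smul {i : E →ₐ[ℚ] E} {ξ : V0 𝔙 E} (hξ : ξ ∈ eigenPart 𝔙 i) (z : E) (v : 𝔙) :
    pair (z • v) ξ = i z * pair v ξ := by
  have h := congrArg (pair v) (mem_eigenPart.1 hξ z)
  rwa [pair_transpose, map_smul, Module.algebraMap_end_apply] at h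

lemma eq_zero_of_pair [Module.Finite ℚ 𝔙] {ξ : V0 𝔙 E} (h : ∀ v, pair v ξ = 0) : ξ = 0 := by
  refine AlgRep.eq_zero_of_ev fun φ => ?_
  obtain ⟨v, rfl⟩ := (Module.evalEquiv ℚ 𝔙).surjective φ
  exact h v

/-- The dual basis of a family of linearly independent semilinear forms. -/
lemma exists_basis_of_semilinear {g : ℕ} (hg : Module.finrank E 𝔙 = g) [Module.Finite E 𝔙]
    (σ : E ≃+* E) (F : Fin g → 𝔙 →+ E) (hF : ∀ k z v, F k (z • v) = σ z * F k v)
    (hli : ∀ c : Fin g → E, (∀ v, ∑ k, c k * F k v = 0) → c = 0) :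
    ∃ w : Module.Basis (Fin g) E 𝔙, ∀ k l, F k (w l) = if k = l then 1 else 0 := by
  let L : Fin g → Module.Dual E 𝔙 := fun k =>
    { toFun := fun v => σ.symm (F k v)
      map_add' := fun v v' => by rw [map_add, map_add]
      map_smul' := fun z v => by rw [hF, map_mul, σ.symm_apply_apply]; rfl }
  have hL : LinearIndependent E L := by
    rw [Fintype.linearIndependent_iff]
    intro c hc
    have h1 : (fun k => σ (c k)) = 0 := hli _ fun v => by
      have h2 := congrArg σ (LinearMap.congr_fun hc v)
      simpa [L, LinearMap.sum_apply, map_sum] using h2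
    intro k
    have := congrFun h1 k
    simpa using this
  let B := Module.Basis.mk hL (by
    rw [hL.span_eq_top_of_card_eq_finrank' (by rw [Fintype.card_fin, Subspace.dual_finrank_eq, hg])])
  refine ⟨B.dualBasis.map (Module.evalEquiv E 𝔙).symm, fun k l => ?_⟩
  have h1 : B.dualBasis l (B k) = if k = l then 1 else 0 := by
    rw [Module.Basis.dualBasis_apply_self]
  have h2 : B.dualBasis l = Module.evalEquiv E 𝔙 ((Module.evalEquiv E 𝔙).symm (B.dualBasis l)) :=
    ((Module.evalEquiv E 𝔙).apply_symm_apply _).symm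
  rw [h2] at h1
  have h3 : σ.symm (F k ((Module.evalEquiv E 𝔙).symm (B.dualBasis l))) =
      if k = l then 1 else 0 := by
    rw [← h1, Module.evalEquiv_apply, Module.Basis.mk_apply]
    rfl
  rw [Module.Basis.map_apply]
  have := congrArg σ h3
  rw [σ.apply_symm_apply] at this
  rw [this]
  split_ifs <;> simp

variable {D : UnitaryDatum E 𝔙} {i j : E →ₐ[ℚ] E} (Δ : SqrtGenerator D i j)

lemma SqrtGenerator.map_conj (Δ : SqrtGenerator D i j) (z : E) : j (D.conj z) = i z := by
  obtain ⟨x, y, rfl⟩ := Δ.exists_eq z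
  simp only [map_add, map_mul, AlgEquiv.commutes, AlgHom.commutes, Δ.conj_neg, map_neg,
    Δ.map_eq_neg, neg_neg]

lemma SqrtGenerator.transpose_idem_mem (ξ : V0 𝔙 E) :
    transpose E 𝔙 E (Δ.idem E) ξ ∈ eigenPart 𝔙 i := by
  rw [mem_eigenPart]
  intro z
  rw [← Module.End.mul_apply, ← transpose_mul, (Δ.commute_idem _).eq, Δ.scalar_mul_idem, map_smul]
  rfl

lemma SqrtGenerator.transpose_idem_of_mem {ξ : V0 𝔙 E} (hξ : ξ ∈ eigenPart 𝔙 i) :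
    transpose E 𝔙 E (Δ.idem E) ξ = ξ := by
  have e : ∀ (x y : E), x ⊗ₜ[ℚ] algebraMap E (Module.End E 𝔙) y =
      x • ((1 : E) ⊗ₜ[ℚ] algebraMap E (Module.End E 𝔙) y) := by
    intro x y
    rw [TensorProduct.smul_tmul', smul_eq_mul, mul_one]
  have h0 := Δ.map_ne_zero
  rw [idem, ← map_one (algebraMap E (Module.End E 𝔙)), e, e _ Δ.δ, map_add, map_smul, map_smul,
    LinearMap.add_apply, LinearMap.smul_apply, LinearMap.smul_apply, mem_eigenPart.1 hξ,
    mem_eigenPart.1 hξ, smul_smul, smul_smul, ← add_smul]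
  have : algebraMap E E 2⁻¹ * i 1 + algebraMap E E (2 * i Δ.δ)⁻¹ * i Δ.δ = 1 := by
    rw [map_one, Algebra.algebraMap_self, RingHom.id_apply, RingHom.id_apply]
    field_simp
    norm_num
  rw [this, one_smul]

lemma SqrtGenerator.transpose_swap_idem_of_mem {ξ : V0 𝔙 E} (hξ : ξ ∈ eigenPart 𝔙 i) :
    transpose E 𝔙 E (Δ.swap.idem E) ξ = 0 := by
  have h := Δ.transpose_idem_of_mem hξ
  rw [← h, ← Module.End.mul_apply, ← transpose_mul, Δ.idem_mul_swap_idem, map_zero,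
    LinearMap.zero_apply]

lemma SqrtGenerator.pair_transpose_idem (φ : Module.Dual ℚ 𝔙) (v : 𝔙) :
    pair v (transpose E 𝔙 E (Δ.idem E) (1 ⊗ₜ φ)) =
      algebraMap ℚ E (φ v) * 2⁻¹ + algebraMap ℚ E (φ (Δ.δ • v)) * (2 * i Δ.δ)⁻¹ := by
  rw [idem, map_add, LinearMap.add_apply, transpose_tmul, transpose_tmul, map_add, pair_tmul,
    pair_tmul, mul_one, mul_one, Algebra.smul_def, Algebra.smul_def]
  rfl

lemma SqrtGenerator.eq_zero_of_transpose_idem {φ : Module.Dual ℚ 𝔙}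
    (h : transpose E 𝔙 E (Δ.idem E) (1 ⊗ₜ φ) = 0) : φ = 0 := by
  refine LinearMap.ext fun v => ?_
  by_contra hv
  have hv' : φ v ≠ 0 := hv
  have h1 := Δ.pair_transpose_idem φ v
  have h0 := Δ.map_ne_zero
  rw [h, map_zero] at h1
  -- otherwise `δ` would be rational
  have h2 : i Δ.δ = i (algebraMap ℚ E (-(φ (Δ.δ • v)) / φ v)) := by
    have hv'' : algebraMap ℚ E (φ v) ≠ 0 := by simpa using hv'
    rw [AlgHom.commutes, map_div₀, map_neg, eq_div_iff hv'']
    field_simp at h1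
    linear_combination -h1
  have h3 := i.injective h2
  have h4 := Δ.map_eq_neg
  rw [h3, AlgHom.commutes, AlgHom.commutes, ← AlgHom.commutes i, ← h3] at h4
  have h5 : (2 : E) * i Δ.δ = 0 := by linear_combination h4
  exact h0 ((mul_eq_zero.1 h5).resolve_left two_ne_zero)

/-- Bases of `𝔙` dual to given bases of `V₁` and of `V₂`, in relation to each other through the
alternating form: the vectors `e_i (1 ⊗ w k)` and `e_j (1 ⊗ w' k)` of `E ⊗ 𝔙`, with `e_i` and `e_j`
the two idempotents, form a symplectic basis which is dual to the basis of `V₁ ⊕ V₂`. -/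
structure Frame (Δ : SqrtGenerator D i j) {g : ℕ} (b : Module.Basis (Fin g) E (eigenPart 𝔙 i)) where
  w : Module.Basis (Fin g) E 𝔙
  w' : Module.Basis (Fin g) E 𝔙
  b' : Module.Basis (Fin g) E (eigenPart 𝔙 j)
  pair_w : ∀ k l, pair (w l) (b k : V0 𝔙 E) = if k = l then 1 else 0
  pair_w' : ∀ k l, pair (w' l) (b' k : V0 𝔙 E) = if k = l then 1 else 0
  b'_eq : ∀ k, (b' k : V0 𝔙 E) = transpose E 𝔙 E (Δ.swap.idem E) (1 ⊗ₜ D.form (w k))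

lemma SqrtGenerator.transpose_idem_form_smul (Δ : SqrtGenerator D i j) (z : E) (v : 𝔙) :
    transpose E 𝔙 E (Δ.swap.idem E) (1 ⊗ₜ D.form (z • v)) =
      i z • transpose E 𝔙 E (Δ.swap.idem E) (1 ⊗ₜ D.form v) := by
  have e : (1 : E) ⊗ₜ[ℚ] D.form (z • v) = transpose E 𝔙 E
      (1 ⊗ₜ algebraMap E (Module.End E 𝔙) (D.conj z)) (1 ⊗ₜ D.form v) := by
    rw [transpose_tmul, one_mul]
    congr 1
    refine LinearMap.ext fun v' => ?_
    rw [D.form_smul]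
    rfl
  rw [e, ← Module.End.mul_apply, ← transpose_mul, Δ.swap.scalar_mul_idem, map_smul, Δ.map_conj]
  rfl

variable (E) in
/-- An embedding of `E` into itself is an automorphism. -/
def autOfEmbedding [Module.Finite ℚ E] (i : E →ₐ[ℚ] E) : E ≃+* E :=
  RingEquiv.ofBijective i ⟨i.injective,
    (LinearMap.injective_iff_surjective (f := i.toLinearMap)).1 i.injective⟩

lemma autOfEmbedding_apply [Module.Finite ℚ E] (z : E) : autOfEmbedding E i z = i z := rfl

lemma linearIndependent_coe {K V ι : Type*} [Field K] [AddCommGroup V] [Module K V]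
    {W : Submodule K V} (b : Module.Basis ι K W) : LinearIndependent K fun k => (b k : V) :=
  b.linearIndependent.map' W.subtype W.ker_subtype

lemma linearIndependent_of_coe {K V ι : Type*} [Field K] [AddCommGroup V] [Module K V]
    {W : Submodule K V} {v : ι → W} (h : LinearIndependent K fun k => (v k : V)) :
    LinearIndependent K v :=
  LinearIndependent.of_comp W.subtype h

/-- A linearly independent family of elements of `V₁` consists of `i`-semilinear forms on `𝔙` and
has a dual basis. -/
lemma exists_basis_of_mem_eigenPart [Module.Finite ℚ E] [Module.Finite ℚ 𝔙] {g : ℕ}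
    (hg : Module.finrank E 𝔙 = g) {β : Fin g → V0 𝔙 E} (hβ : ∀ k, β k ∈ eigenPart 𝔙 i)
    (hli : LinearIndependent E β) :
    ∃ w : Module.Basis (Fin g) E 𝔙, ∀ k l, pair (w l) (β k) = if k = l then 1 else 0 := by
  have : Module.Finite E 𝔙 := Module.Finite.of_restrictScalars_finite ℚ E 𝔙
  refine exists_basis_of_semilinear hg (autOfEmbedding E i) (fun k =>
    { toFun := fun v => pair v (β k)
      map_zero' := pair_zero _
      map_add' := fun v v' => pair_add v v' _ }) (fun k z v => pair_smul (hβ k) z v)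
    fun c hc => ?_
  have h1 : ∑ k, c k • β k = 0 := eq_zero_of_pair fun v => by
    have h2 : ∑ k, c k * pair v (β k) = 0 := hc v
    rw [map_sum, ← h2]
    exact Finset.sum_congr rfl fun k _ => map_smul _ _ _
  exact funext fun k => Fintype.linearIndependent_iff.1 hli c h1 k

lemma eq_sum_of_pair [Module.Finite ℚ 𝔙] {g : ℕ} {β : Fin g → V0 𝔙 E}
    (hβ : ∀ k, β k ∈ eigenPart 𝔙 i) {w : Module.Basis (Fin g) E 𝔙}
    (hw : ∀ k l, pair (w l) (β k) = if k = l then 1 else 0) {ξ : V0 𝔙 E} (hξ : ξ ∈ eigenPart 𝔙 i) :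
    ξ = ∑ k, pair (w k) ξ • β k := by
  refine sub_eq_zero.1 (eq_zero_of_pair fun v => ?_)
  have hmem : ξ - ∑ k, pair (w k) ξ • β k ∈ eigenPart 𝔙 i :=
    Submodule.sub_mem _ hξ (Submodule.sum_mem _ fun k _ => Submodule.smul_mem _ _ (hβ k))
  have hv : v ∈ Submodule.span E (Set.range w) := w.span_eq ▸ Submodule.mem_top
  induction hv using Submodule.span_induction with
  | mem x hx =>
    obtain ⟨l, rfl⟩ := hx
    rw [map_sub, map_sum, sub_eq_zero]
    simp only [map_smul, hw, smul_eq_mul, mul_ite, mul_one, mul_zero, Finset.sum_ite_eq',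
      Finset.mem_univ, if_true]
  | zero => exact pair_zero _
  | add x y _ _ hx hy => rw [pair_add, hx, hy, add_zero]
  | smul z x _ hx => rw [pair_smul hmem, hx, mul_zero]

lemma SqrtGenerator.linearIndependent_transpose_idem_form [Module.Finite ℚ E]
    (Δ : SqrtGenerator D i j) {g : ℕ} (w : Module.Basis (Fin g) E 𝔙) :
    LinearIndependent E fun k => transpose E 𝔙 E (Δ.swap.idem E) (1 ⊗ₜ D.form (w k)) := by
  rw [Fintype.linearIndependent_iff]
  intro c hc k
  have h1 : transpose E 𝔙 E (Δ.swap.idem E)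
      (1 ⊗ₜ D.form (∑ k, (autOfEmbedding E i).symm (c k) • w k)) = 0 := by
    rw [map_sum, TensorProduct.tmul_sum, map_sum, ← hc]
    refine Finset.sum_congr rfl fun k _ => ?_
    rw [Δ.transpose_idem_form_smul, ← autOfEmbedding_apply, RingEquiv.apply_symm_apply]
  have h2 := Δ.swap.eq_zero_of_transpose_idem h1
  have h3 : ∑ k, (autOfEmbedding E i).symm (c k) • w k = 0 :=
    D.form_nondegenerate.1 _ fun v => LinearMap.congr_fun h2 v
  have h4 := Fintype.linearIndependent_iff.1 w.linearIndependent _ h3 k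
  simpa using h4

lemma nonempty_frame [Module.Finite ℚ E] [Module.Finite ℚ 𝔙] {g : ℕ}
    (hg : Module.finrank E 𝔙 = g) (b : Module.Basis (Fin g) E (eigenPart 𝔙 i)) :
    Nonempty (Frame Δ b) := by
  have hb := linearIndependent_coe b
  obtain ⟨w, hw⟩ := exists_basis_of_mem_eigenPart hg (fun k => (b k).2) hb
  have hβ : ∀ k, transpose E 𝔙 E (Δ.swap.idem E) (1 ⊗ₜ D.form (w k)) ∈ eigenPart 𝔙 j :=
    fun k => Δ.swap.transpose_idem_mem _
  have hli := Δ.linearIndependent_transpose_idem_form w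
  obtain ⟨w', hw'⟩ := exists_basis_of_mem_eigenPart hg hβ hli
  let β : Fin g → eigenPart 𝔙 j := fun k => ⟨_, hβ k⟩
  let b' := Module.Basis.mk (v := β) (linearIndependent_of_coe hli) (by
    rintro ⟨ξ, hξ⟩ -
    have h : (⟨ξ, hξ⟩ : eigenPart 𝔙 j) = ∑ k, pair (w' k) ξ • β k := by
      refine Subtype.ext ((eq_sum_of_pair hβ hw' hξ).trans ?_)
      rw [AddSubmonoidClass.coe_finset_sum]
      rfl
    rw [h]
    exact Submodule.sum_mem _ fun k _ =>
      Submodule.smul_mem _ _ (Submodule.subset_span ⟨k, rfl⟩))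
  have hb' : ∀ k, b' k = β k := fun k => Module.Basis.mk_apply _ _ k
  exact ⟨⟨w, w', b', hw, fun k l => by rw [hb']; exact hw' k l, fun k => by rw [hb']⟩⟩

end UnitaryDatum

namespace UnitaryDatum

variable {E 𝔙 : Type u} [Field E] [CharZero E] [AddCommGroup 𝔙] [Module E 𝔙] [Module ℚ 𝔙]
  [IsScalarTower ℚ E 𝔙] {g : ℕ}

section MatrixUnits

/-- The matrix units of `End_E(𝔙)` in a basis of `𝔙`. -/
def matUnit (w : Module.Basis (Fin g) E 𝔙) (k l : Fin g) : Module.End E 𝔙 :=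
  Matrix.toLinAlgEquiv w (Matrix.single k l 1)

lemma matUnit_self (w : Module.Basis (Fin g) E 𝔙) (k l m : Fin g) :
    matUnit w k l (w m) = if l = m then w k else 0 := by
  rw [matUnit, Matrix.toLinAlgEquiv_self]
  by_cases h : l = m
  · subst h
    rw [Finset.sum_eq_single k]
    · simp
    · intro k' _ hk
      simp [Matrix.single_apply, hk.symm]
    · simp
  · rw [if_neg h]
    exact Finset.sum_eq_zero fun k' _ => by simp [Matrix.single_apply, h]

variable {R : Type u} [CommRing R] [Algebra ℚ R]

/-- The matrix algebra `M_g(R)` inside `R ⊗ End_E(𝔙)`. -/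
def matEmb (w : Module.Basis (Fin g) E 𝔙) :
    Matrix (Fin g) (Fin g) R →ₐ[ℚ] R ⊗[ℚ] Module.End E 𝔙 :=
  (Algebra.TensorProduct.map (AlgHom.id ℚ R)
    (((Matrix.toLinAlgEquiv w).toAlgHom.restrictScalars ℚ).comp
      (Algebra.ofId ℚ E).mapMatrix)).comp (matrixEquivTensor (Fin g) ℚ R).toAlgHom

lemma matEmb_apply (w : Module.Basis (Fin g) E 𝔙) (A : Matrix (Fin g) (Fin g) R) :
    matEmb w A = ∑ p : Fin g × Fin g, A p.1 p.2 ⊗ₜ matUnit w p.1 p.2 := by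
  have h1 : ∀ k l : Fin g, ((Algebra.ofId ℚ E).mapMatrix (Matrix.single k l (1 : ℚ)) :
      Matrix (Fin g) (Fin g) E) = Matrix.single k l 1 := by
    intro k l
    ext m n
    simp only [AlgHom.mapMatrix_apply, Matrix.map_apply, Matrix.single_apply]
    split_ifs
    · exact map_one _
    · exact map_zero _
  have h2 : matEmb w A = Algebra.TensorProduct.map (AlgHom.id ℚ R)
      (((Matrix.toLinAlgEquiv w).toAlgHom.restrictScalars ℚ).comp
        (Algebra.ofId ℚ E).mapMatrix) (matrixEquivTensor (Fin g) ℚ R A) := rfl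
  rw [h2, matrixEquivTensor_apply, map_sum]
  refine Finset.sum_congr rfl fun p _ => ?_
  rw [Algebra.TensorProduct.map_tmul]
  change _ ⊗ₜ[ℚ] (Matrix.toLinAlgEquiv w) ((Algebra.ofId ℚ E).mapMatrix _) = _
  rw [h1]
  rfl

lemma matEmb_smul (w : Module.Basis (Fin g) E 𝔙) (r : R) (A : Matrix (Fin g) (Fin g) R) :
    matEmb w (r • A) = r • matEmb w A := by
  simp only [matEmb_apply, Finset.smul_sum, TensorProduct.smul_tmul', Matrix.smul_apply]

lemma map_matEmb {S : Type u} [CommRing S] [Algebra ℚ S] (f : R →ₐ[ℚ] S)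
    (w : Module.Basis (Fin g) E 𝔙) (A : Matrix (Fin g) (Fin g) R) :
    Algebra.TensorProduct.map f (AlgHom.id ℚ (Module.End E 𝔙)) (matEmb w A) =
      matEmb w (A.map f) := by
  simp [matEmb_apply]

variable [Algebra E R] [IsScalarTower ℚ E R]
variable {D : UnitaryDatum E 𝔙} {i j : E →ₐ[ℚ] E} (Δ : SqrtGenerator D i j)

/-- On the part of `R ⊗ End_E(𝔙)` where `E` acts through `i`, every element is in the image of
`M_g(R)`. -/
lemma SqrtGenerator.exists_matEmb_mul_idem (w : Module.Basis (Fin g) E 𝔙)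
    (x : R ⊗[ℚ] Module.End E 𝔙) :
    ∃ A : Matrix (Fin g) (Fin g) R, x * Δ.idem R = matEmb w A * Δ.idem R := by
  induction x with
  | zero => exact ⟨0, by simp⟩
  | add x y hx hy =>
    obtain ⟨A, hA⟩ := hx
    obtain ⟨B, hB⟩ := hy
    exact ⟨A + B, by rw [add_mul, hA, hB, map_add, add_mul]⟩
  | tmul r f =>
    have hf : f = ∑ p : Fin g × Fin g,
        algebraMap E (Module.End E 𝔙) (LinearMap.toMatrix w w f p.1 p.2) *
          matUnit w p.1 p.2 := by
      refine w.ext fun m => ?_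
      rw [LinearMap.sum_apply, Fintype.sum_prod_type]
      have h1 : ∀ k l : Fin g, (algebraMap E (Module.End E 𝔙) (LinearMap.toMatrix w w f k l) *
          matUnit w k l) (w m) = if l = m then LinearMap.toMatrix w w f k l • w k else 0 := by
        intro k l
        rw [Module.End.mul_apply, matUnit_self, Module.algebraMap_end_apply]
        split_ifs <;> simp
      rw [Finset.sum_congr rfl fun k _ => Finset.sum_congr rfl fun l _ => h1 k l]
      simp only [Finset.sum_ite_eq', Finset.mem_univ, if_true, LinearMap.toMatrix_apply]
      exact (w.sum_repr _).symm
    refine ⟨r • (LinearMap.toMatrix w w f).map fun z => algebraMap E R (i z), ?_⟩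
    rw [matEmb_smul, matEmb_apply]
    conv_lhs => rw [hf]
    rw [TensorProduct.tmul_sum, Finset.sum_mul, Finset.smul_sum, Finset.sum_mul]
    refine Finset.sum_congr rfl fun p _ => ?_
    have e : ∀ (z : E) (h : Module.End E 𝔙), r ⊗ₜ[ℚ] (algebraMap E (Module.End E 𝔙) z * h) =
        (r ⊗ₜ h) * ((1 : R) ⊗ₜ algebraMap E (Module.End E 𝔙) z) := by
      intro z h
      rw [Algebra.TensorProduct.tmul_mul_tmul, mul_one, Algebra.commutes]
    rw [e, mul_assoc, Δ.scalar_mul_idem, mul_smul_comm, ← smul_mul_assoc,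
      TensorProduct.smul_tmul', TensorProduct.smul_tmul', Matrix.map_apply, smul_eq_mul,
      smul_eq_mul, mul_comm]

/-- The extension of scalars `V₀ → R ⊗ 𝔙ᵛ`. -/
def extendV0 (R : Type u) [CommRing R] [Algebra ℚ R] [Algebra E R] [IsScalarTower ℚ E R] :
    V0 𝔙 E →ₗ[ℚ] R ⊗[ℚ] Module.Dual ℚ 𝔙 :=
  ((Algebra.ofId E R).restrictScalars ℚ).toLinearMap.rTensor (Module.Dual ℚ 𝔙)

lemma transpose_extendV0 (f : Module.End E 𝔙) (ξ : V0 𝔙 E) :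
    transpose E 𝔙 R (1 ⊗ₜ f) (extendV0 R ξ) = extendV0 R (transpose E 𝔙 E (1 ⊗ₜ f) ξ) := by
  have h := transpose_natural ((Algebra.ofId E R).restrictScalars ℚ) ((1 : E) ⊗ₜ f) ξ
  rw [Algebra.TensorProduct.map_tmul, map_one] at h
  exact h.symm

lemma SqrtGenerator.transpose_idem_extendV0 (ξ : V0 𝔙 E) :
    transpose E 𝔙 R (Δ.idem R) (extendV0 R ξ) =
      extendV0 R (transpose E 𝔙 E (Δ.idem E) ξ) := by
  have h := transpose_natural ((Algebra.ofId E R).restrictScalars ℚ) (Δ.idem E) ξ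
  rw [Δ.map_idem _ fun z => rfl] at h
  exact h.symm

variable [Module.Finite ℚ 𝔙]

lemma transpose_matUnit {w : Module.Basis (Fin g) E 𝔙} {β : Fin g → V0 𝔙 E}
    (hβ : ∀ k, β k ∈ eigenPart 𝔙 i) (hw : ∀ k l, pair (w l) (β k) = if k = l then 1 else 0)
    (k n l : Fin g) :
    transpose E 𝔙 E (1 ⊗ₜ matUnit w k n) (β l) = if l = k then β n else 0 := by
  have hmem : transpose E 𝔙 E (1 ⊗ₜ matUnit w k n) (β l) ∈ eigenPart 𝔙 i := by
    rw [mem_eigenPart]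
    intro z
    have e : ((1 : E) ⊗ₜ[ℚ] matUnit w k n) * ((1 : E) ⊗ₜ[ℚ] algebraMap E (Module.End E 𝔙) z) =
        (1 ⊗ₜ algebraMap E (Module.End E 𝔙) z) * ((1 : E) ⊗ₜ matUnit w k n) := by
      rw [Algebra.TensorProduct.tmul_mul_tmul, Algebra.TensorProduct.tmul_mul_tmul,
        Algebra.commutes]
    rw [← Module.End.mul_apply, ← transpose_mul, e, transpose_mul, Module.End.mul_apply,
      mem_eigenPart.1 (hβ l), map_smul]
  rw [eq_sum_of_pair hβ hw hmem]
  have h1 : ∀ m, pair (w m) (transpose E 𝔙 E (1 ⊗ₜ matUnit w k n) (β l)) =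
      if n = m then (if l = k then 1 else 0) else 0 := by
    intro m
    rw [pair_transpose, matUnit_self]
    split_ifs with h1 h2 h2
    · rw [hw, if_pos h2]
    · rw [hw, if_neg h2]
    · exact pair_zero _
  simp only [h1, ite_smul, zero_smul, one_smul, Finset.sum_ite_eq, Finset.mem_univ, if_true]

lemma transpose_matEmb_mul_idem {w : Module.Basis (Fin g) E 𝔙} {β : Fin g → V0 𝔙 E}
    (hβ : ∀ k, β k ∈ eigenPart 𝔙 i) (hw : ∀ k l, pair (w l) (β k) = if k = l then 1 else 0)
    (A : Matrix (Fin g) (Fin g) R) (l : Fin g) :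
    transpose E 𝔙 R (matEmb w A * Δ.idem R) (extendV0 R (β l)) =
      ∑ n, A l n • extendV0 R (β n) := by
  rw [← (Δ.commute_idem _).eq, transpose_mul, Module.End.mul_apply, Δ.transpose_idem_extendV0,
    Δ.transpose_idem_of_mem (hβ l), matEmb_apply, map_sum, LinearMap.sum_apply,
    Fintype.sum_prod_type]
  have e : ∀ k n : Fin g, transpose E 𝔙 R (A k n ⊗ₜ matUnit w k n) (extendV0 R (β l)) =
      if l = k then A k n • extendV0 R (β n) else 0 := by
    intro k n
    have e1 : A k n ⊗ₜ[ℚ] matUnit w k n = A k n • ((1 : R) ⊗ₜ matUnit w k n) := by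
      rw [TensorProduct.smul_tmul', smul_eq_mul, mul_one]
    rw [e1, map_smul, LinearMap.smul_apply, transpose_extendV0, transpose_matUnit hβ hw]
    split_ifs with h
    · rfl
    · rw [map_zero, smul_zero]
  simp only [e]
  rw [Finset.sum_eq_single l]
  · simp
  · intro k _ hk
    simp [hk.symm]
  · simp

lemma transpose_mul_swap_idem {ξ : V0 𝔙 E} (hξ : ξ ∈ eigenPart 𝔙 i)
    (x : R ⊗[ℚ] Module.End E 𝔙) :
    transpose E 𝔙 R (x * Δ.swap.idem R) (extendV0 R ξ) = 0 := by
  rw [← (Δ.swap.commute_idem _).eq, transpose_mul, Module.End.mul_apply,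
    Δ.swap.transpose_idem_extendV0, Δ.transpose_swap_idem_of_mem hξ, map_zero, map_zero]

end MatrixUnits

section Vectors

variable {D : UnitaryDatum E 𝔙} {i j : E →ₐ[ℚ] E} (Δ : SqrtGenerator D i j)
variable {R : Type u} [CommRing R] [Algebra ℚ R]

lemma form_baseChange_neg (x y : R ⊗[ℚ] 𝔙) :
    D.form.baseChange R y x = -D.form.baseChange R x y := by
  induction x with
  | zero => simp
  | add a b ha hb => simp only [map_add, LinearMap.add_apply, ha, hb, neg_add]
  | tmul r v =>
    induction y with
    | zero => simp
    | add a b ha hb => simp only [map_add, LinearMap.add_apply, ha, hb, neg_add]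
    | tmul t v' =>
      rw [LinearMap.BilinForm.baseChange_tmul, LinearMap.BilinForm.baseChange_tmul,
        ← D.form_alt.neg_eq v v', neg_smul, mul_comm]

variable [Algebra E R] [IsScalarTower ℚ E R]

lemma SqrtGenerator.form_idem (x y : R ⊗[ℚ] 𝔙) :
    D.form.baseChange R (std E 𝔙 R (Δ.idem R) x) y =
      D.form.baseChange R x (std E 𝔙 R (Δ.swap.idem R) y) := by
  induction x with
  | zero => simp
  | add a b ha hb => simp only [map_add, LinearMap.add_apply, ha, hb]
  | tmul r v =>
    induction y with
    | zero => simp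
    | add a b ha hb => simp only [map_add, ha, hb]
    | tmul t v' =>
      have e : algebraMap E R (2 * j Δ.swap.δ)⁻¹ = -algebraMap E R (2 * i Δ.δ)⁻¹ := by
        change algebraMap E R (2 * j Δ.δ)⁻¹ = _
        rw [Δ.map_eq_neg, mul_neg, inv_neg, _root_.map_neg (algebraMap E R)]
      have e1 : D.form (Δ.δ • v) v' = -D.form v (Δ.δ • v') := by
        rw [D.form_smul, Δ.conj_neg, neg_smul, map_neg]
      rw [idem, idem, e]
      change _ = D.form.baseChange R _ (std E 𝔙 R (_ + _ ⊗ₜ algebraMap E (Module.End E 𝔙) Δ.δ) _)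
      simp only [map_add, LinearMap.add_apply, std_tmul, LinearMap.BilinForm.baseChange_tmul,
        Module.End.one_apply, Module.algebraMap_end_apply, e1]
      simp only [neg_smul, neg_mul, mul_neg, smul_neg, mul_assoc, mul_left_comm r]

variable (R) in
/-- The component in `R ⊗ 𝔙` on which `E` acts through `i`, of the image of a vector of `𝔙`. -/
def SqrtGenerator.vec (v : 𝔙) : R ⊗[ℚ] 𝔙 := std E 𝔙 R (Δ.idem R) (1 ⊗ₜ v)

lemma SqrtGenerator.std_mul_idem_vec (x : R ⊗[ℚ] Module.End E 𝔙) (v : 𝔙) :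
    std E 𝔙 R (x * Δ.idem R) (Δ.vec R v) = std E 𝔙 R (Δ.idem R) (std E 𝔙 R x (1 ⊗ₜ v)) := by
  rw [vec, ← Module.End.mul_apply, ← map_mul, mul_assoc, Δ.idem_mul_idem, ← (Δ.commute_idem x).eq,
    map_mul, Module.End.mul_apply]

lemma SqrtGenerator.std_mul_swap_idem_vec (x : R ⊗[ℚ] Module.End E 𝔙) (v : 𝔙) :
    std E 𝔙 R (x * Δ.swap.idem R) (Δ.vec R v) = 0 := by
  rw [vec, ← Module.End.mul_apply, ← map_mul, mul_assoc, Δ.swap_idem_mul_idem, mul_zero, map_zero,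
    LinearMap.zero_apply]

lemma SqrtGenerator.std_matEmb_vec (w : Module.Basis (Fin g) E 𝔙) (A : Matrix (Fin g) (Fin g) R)
    (l : Fin g) :
    std E 𝔙 R (matEmb w A * Δ.idem R) (Δ.vec R (w l)) = ∑ k, A k l • Δ.vec R (w k) := by
  rw [Δ.std_mul_idem_vec, matEmb_apply, map_sum, LinearMap.sum_apply, Fintype.sum_prod_type]
  have e : ∀ k n : Fin g, std E 𝔙 R (A k n ⊗ₜ matUnit w k n) (1 ⊗ₜ w l) =
      if n = l then A k n • (1 ⊗ₜ w k) else 0 := by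
    intro k n
    rw [std_tmul, matUnit_self, mul_one]
    split_ifs
    · rw [TensorProduct.smul_tmul', smul_eq_mul, mul_one]
    · rw [TensorProduct.tmul_zero]
  simp only [e, Finset.sum_ite_eq', Finset.mem_univ, if_true, map_sum, map_smul]
  rfl

lemma SqrtGenerator.std_idem_mem_span (w : Module.Basis (Fin g) E 𝔙) (x : R ⊗[ℚ] 𝔙) :
    std E 𝔙 R (Δ.idem R) x ∈ Submodule.span R (Set.range fun l => Δ.vec R (w l)) := by
  induction x with
  | zero => simp
  | add a b ha hb =>
    rw [map_add]
    exact Submodule.add_mem _ ha hb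
  | tmul r v =>
    have e1 : r ⊗ₜ[ℚ] v = r • ((1 : R) ⊗ₜ v) := by
      rw [TensorProduct.smul_tmul', smul_eq_mul, mul_one]
    rw [e1, map_smul, ← w.sum_repr v, TensorProduct.tmul_sum, map_sum]
    refine Submodule.smul_mem _ _ (Submodule.sum_mem _ fun l _ => ?_)
    have e2 : (1 : R) ⊗ₜ[ℚ] (w.repr v l • w l) =
        std E 𝔙 R (1 ⊗ₜ algebraMap E (Module.End E 𝔙) (w.repr v l)) (1 ⊗ₜ w l) := by
      rw [std_tmul, mul_one, Module.algebraMap_end_apply]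
    rw [e2, ← Module.End.mul_apply, ← map_mul, (Δ.commute_idem _).eq, Δ.scalar_mul_idem, map_smul,
      LinearMap.smul_apply]
    exact Submodule.smul_mem _ _ (Submodule.subset_span ⟨l, rfl⟩)

lemma SqrtGenerator.span_vec (w w' : Module.Basis (Fin g) E 𝔙) :
    Submodule.span R (Set.range (fun l => Δ.vec R (w l)) ∪
      Set.range fun l => Δ.swap.vec R (w' l)) = ⊤ := by
  rw [eq_top_iff]
  intro x _
  have h : x = std E 𝔙 R (Δ.idem R) x + std E 𝔙 R (Δ.swap.idem R) x := by
    rw [← LinearMap.add_apply, ← map_add, Δ.idem_add_swap, map_one, Module.End.one_apply]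
  rw [h, Submodule.span_union]
  exact Submodule.add_mem_sup (Δ.std_idem_mem_span w x) (Δ.swap.std_idem_mem_span w' x)

lemma SqrtGenerator.form_vec_vec (v v' : 𝔙) :
    D.form.baseChange R (Δ.vec R v) (Δ.vec R v') = 0 := by
  rw [vec, Δ.form_idem, vec, ← Module.End.mul_apply, ← map_mul, Δ.swap_idem_mul_idem, map_zero,
    LinearMap.zero_apply, map_zero]

variable {Δ} {b : Module.Basis (Fin g) E (eigenPart 𝔙 i)} (F : Frame Δ b)

lemma Frame.form_vec_swap_vec (k l : Fin g) :
    D.form.baseChange R (Δ.vec R (F.w k)) (Δ.swap.vec R (F.w' l)) = if k = l then 1 else 0 := by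
  have h := F.pair_w' k l
  rw [F.b'_eq, Δ.swap.pair_transpose_idem] at h
  rw [SqrtGenerator.vec, Δ.form_idem, SqrtGenerator.vec, ← Module.End.mul_apply, ← map_mul,
    Δ.swap.idem_mul_idem, SqrtGenerator.idem, map_add, LinearMap.add_apply, std_tmul, std_tmul,
    map_add, LinearMap.BilinForm.baseChange_tmul, LinearMap.BilinForm.baseChange_tmul]
  have h' := congrArg (algebraMap E R) h
  rw [map_add, map_mul, map_mul, ← IsScalarTower.algebraMap_apply,
    ← IsScalarTower.algebraMap_apply] at h'
  rw [Module.End.one_apply, Module.algebraMap_end_apply, one_mul, one_mul, mul_one, mul_one,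
    Algebra.smul_def, Algebra.smul_def, h']
  split_ifs <;> simp

end Vectors

end UnitaryDatum

namespace UnitaryDatum

open Matrix

variable {E 𝔙 : Type u} [Field E] [CharZero E] [AddCommGroup 𝔙] [Module E 𝔙] [Module ℚ 𝔙]
  [IsScalarTower ℚ E 𝔙] {g : ℕ}

variable {D : UnitaryDatum E 𝔙} {i j : E →ₐ[ℚ] E} {Δ : SqrtGenerator D i j}
  {b : Module.Basis (Fin g) E (eigenPart 𝔙 i)} (F : Frame Δ b)
variable {R : Type u} [CommRing R] [Algebra ℚ R] [Algebra E R] [IsScalarTower ℚ E R]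

/-- The element of `R ⊗ End_E(𝔙)` acting through the given matrices on the two parts of
`R ⊗ 𝔙`. -/
def Frame.block : Matrix (Fin g) (Fin g) R × Matrix (Fin g) (Fin g) R →*
    R ⊗[ℚ] Module.End E 𝔙 where
  toFun A := matEmb F.w A.1 * Δ.idem R + matEmb F.w' A.2 * Δ.swap.idem R
  map_one' := by rw [Prod.fst_one, Prod.snd_one, map_one, map_one, one_mul, one_mul,
    Δ.idem_add_swap]
  map_mul' A B := by
    have e : ∀ x y x' y' e f : R ⊗[ℚ] Module.End E 𝔙, (∀ z, Commute e z) → (∀ z, Commute f z) →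
        e * e = e → f * f = f → e * f = 0 →
        (x * x') * e + (y * y') * f = (x * e + y * f) * (x' * e + y' * f) := by
      intro x y x' y' e f he hf hee hff hef
      have h1 : x * e * (x' * e) = x * x' * e := by
        rw [mul_assoc, ← mul_assoc e, (he x').eq, mul_assoc, hee, mul_assoc]
      have h2 : y * f * (y' * f) = y * y' * f := by
        rw [mul_assoc, ← mul_assoc f, (hf y').eq, mul_assoc, hff, mul_assoc]
      have h3 : x * e * (y' * f) = 0 := by
        rw [mul_assoc, ← mul_assoc e, (he y').eq, mul_assoc, hef, mul_zero, mul_zero]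
      have h4 : y * f * (x' * e) = 0 := by
        rw [mul_assoc, ← mul_assoc f, (hf x').eq, mul_assoc, (hf e).eq, hef, mul_zero, mul_zero]
      rw [add_mul, mul_add, mul_add, h1, h2, h3, h4, add_zero, zero_add]
    rw [Prod.fst_mul, Prod.snd_mul, map_mul, map_mul]
    exact e _ _ _ _ _ _ Δ.commute_idem Δ.swap.commute_idem Δ.idem_mul_idem
      Δ.swap.idem_mul_idem Δ.idem_mul_swap_idem

lemma Frame.block_apply (A : Matrix (Fin g) (Fin g) R × Matrix (Fin g) (Fin g) R) :
    F.block A = matEmb F.w A.1 * Δ.idem R + matEmb F.w' A.2 * Δ.swap.idem R := rfl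

lemma Frame.exists_block (x : R ⊗[ℚ] Module.End E 𝔙) : ∃ A, x = F.block A := by
  obtain ⟨A, hA⟩ := Δ.exists_matEmb_mul_idem F.w x
  obtain ⟨B, hB⟩ := Δ.swap.exists_matEmb_mul_idem F.w' x
  exact ⟨(A, B), by rw [F.block_apply, ← hA, ← hB, ← mul_add, Δ.idem_add_swap, mul_one]⟩

lemma Frame.std_block_vec (A : Matrix (Fin g) (Fin g) R × Matrix (Fin g) (Fin g) R) (l : Fin g) :
    std E 𝔙 R (F.block A) (Δ.vec R (F.w l)) = ∑ k, A.1 k l • Δ.vec R (F.w k) := by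
  rw [F.block_apply, map_add, LinearMap.add_apply, Δ.std_matEmb_vec, Δ.std_mul_swap_idem_vec,
    add_zero]

lemma Frame.std_block_swap_vec (A : Matrix (Fin g) (Fin g) R × Matrix (Fin g) (Fin g) R)
    (l : Fin g) :
    std E 𝔙 R (F.block A) (Δ.swap.vec R (F.w' l)) = ∑ k, A.2 k l • Δ.swap.vec R (F.w' k) := by
  rw [F.block_apply, map_add, LinearMap.add_apply, Δ.swap.std_matEmb_vec]
  have h := Δ.swap.std_mul_swap_idem_vec (matEmb F.w A.1 : R ⊗[ℚ] Module.End E 𝔙) (F.w' l)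
  have h' : std E 𝔙 R (matEmb F.w A.1 * Δ.idem R) (Δ.swap.vec R (F.w' l)) = 0 := h
  rw [h', zero_add]

lemma Frame.form_std_block (A : Matrix (Fin g) (Fin g) R × Matrix (Fin g) (Fin g) R)
    (k l : Fin g) :
    D.form.baseChange R (std E 𝔙 R (F.block A) (Δ.vec R (F.w k)))
      (std E 𝔙 R (F.block A) (Δ.swap.vec R (F.w' l))) = (A.1ᵀ * A.2) k l := by
  rw [F.std_block_vec, F.std_block_swap_vec, Matrix.mul_apply]
  simp only [map_sum, LinearMap.sum_apply, map_smul, LinearMap.smul_apply, F.form_vec_swap_vec,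
    smul_eq_mul, mul_ite, mul_one, mul_zero, Finset.sum_ite_eq', Finset.mem_univ, if_true,
    Matrix.transpose_apply]
  exact Finset.sum_congr rfl fun m _ => mul_comm _ _

/-- The two parts of `R ⊗ 𝔙` are isotropic and in duality, so that a pair of matrices gives a
similitude if and only if the second one is a multiple of the contragredient of the first one. -/
lemma Frame.isSimilitude_iff {c : (R ⊗[ℚ] Module.End E 𝔙)ˣ}
    {A : Matrix (Fin g) (Fin g) R × Matrix (Fin g) (Fin g) R} (hc : (c : _) = F.block A) (μ : Rˣ) :
    D.IsSimilitude c μ ↔ A.1ᵀ * A.2 = (μ : R) • 1 := by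
  constructor
  · intro h
    ext k l
    rw [← F.form_std_block, ← hc, h, F.form_vec_swap_vec, Matrix.smul_apply, Matrix.one_apply,
      smul_eq_mul]
  · intro h
    have h1 : ∀ k l, D.form.baseChange R (std E 𝔙 R c (Δ.vec R (F.w k)))
        (std E 𝔙 R c (Δ.swap.vec R (F.w' l))) =
        μ * D.form.baseChange R (Δ.vec R (F.w k)) (Δ.swap.vec R (F.w' l)) := by
      intro k l
      rw [hc, F.form_std_block, h, F.form_vec_swap_vec, Matrix.smul_apply, Matrix.one_apply,
        smul_eq_mul]
    have h2 : (D.form.baseChange R).compl₁₂ (std E 𝔙 R c) (std E 𝔙 R c) =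
        (μ : R) • D.form.baseChange R := by
      refine LinearMap.ext_on (Δ.span_vec F.w F.w') ?_
      rintro _ (⟨k, rfl⟩ | ⟨k, rfl⟩) <;>
        refine LinearMap.ext_on (Δ.span_vec F.w F.w') ?_ <;>
        rintro _ (⟨l, rfl⟩ | ⟨l, rfl⟩) <;>
        simp only [LinearMap.compl₁₂_apply, LinearMap.smul_apply, smul_eq_mul]
      · rw [hc, F.std_block_vec, F.std_block_vec]
        simp only [map_sum, LinearMap.sum_apply, map_smul, LinearMap.smul_apply, Δ.form_vec_vec,
          smul_zero, mul_zero, Finset.sum_const_zero]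
      · exact h1 k l
      · rw [form_baseChange_neg, h1, form_baseChange_neg (Δ.swap.vec R (F.w' k)), mul_neg, neg_neg,
          form_baseChange_neg, mul_neg]
      · rw [hc, F.std_block_swap_vec, F.std_block_swap_vec]
        simp only [map_sum, LinearMap.sum_apply, map_smul, LinearMap.smul_apply,
          Δ.swap.form_vec_vec, smul_zero, mul_zero, Finset.sum_const_zero]
    intro x y
    have := LinearMap.congr_fun (LinearMap.congr_fun h2 x) y
    simpa using this

/-- The matrices through which the point with parameters `(A, ν)` acts on `R ⊗ 𝔙`: it acts
through `A` on `V₁`, which is the dual of the first part of `𝔙`, and has multiplier `ν⁻¹`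
on `𝔙`. -/
def dualMatrices : GL (Fin g) R × Rˣ →* Matrix (Fin g) (Fin g) R × Matrix (Fin g) (Fin g) R where
  toFun x := ((x.1⁻¹).1ᵀ, ((x.2⁻¹ : Rˣ) : R) • x.1.1)
  map_one' := by simp
  map_mul' x y := by
    change (((x.1 * y.1)⁻¹).1ᵀ, (((x.2 * y.2)⁻¹ : Rˣ) : R) • (x.1 * y.1).1) = _
    rw [Prod.mk_mul_mk, _root_.mul_inv_rev, _root_.mul_inv_rev, Units.val_mul,
      Units.val_mul, Units.val_mul, Matrix.transpose_mul, Matrix.smul_mul, Matrix.mul_smul,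
      smul_smul, mul_comm ((y.2⁻¹ : Rˣ) : R)]

variable (R) in
/-- The unit of `R ⊗ End_E(𝔙)` with parameters `(A, ν)`. -/
def Frame.unit : GL (Fin g) R × Rˣ →* (R ⊗[ℚ] Module.End E 𝔙)ˣ :=
  (F.block.comp dualMatrices).toHomUnits

lemma Frame.coe_unit (x : GL (Fin g) R × Rˣ) : (F.unit R x : _) = F.block (dualMatrices x) := rfl

lemma Frame.isSimilitude_unit (x : GL (Fin g) R × Rˣ) : D.IsSimilitude (F.unit R x) x.2⁻¹ := by
  rw [F.isSimilitude_iff (F.coe_unit x)]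
  change (x.1⁻¹).1ᵀᵀ * _ • x.1.1 = _
  rw [Matrix.transpose_transpose, Matrix.mul_smul, Units.inv_mul x.1]

lemma Frame.exists_unit {c : (R ⊗[ℚ] Module.End E 𝔙)ˣ} {μ : Rˣ} (hc : D.IsSimilitude c μ) :
    ∃ A : GL (Fin g) R, c = F.unit R (A, μ⁻¹) := by
  obtain ⟨⟨B, B'⟩, hB⟩ := F.exists_block (c : R ⊗[ℚ] Module.End E 𝔙)
  have h := (F.isSimilitude_iff hB μ).1 hc
  have h1 : Bᵀ * (((μ⁻¹ : Rˣ) : R) • B') = 1 := by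
    rw [Matrix.mul_smul, h, smul_smul, Units.inv_mul, one_smul]
  let A : GL (Fin g) R := ⟨((μ⁻¹ : Rˣ) : R) • B', Bᵀ, mul_eq_one_comm.1 h1, h1⟩
  refine ⟨A, Units.ext ?_⟩
  rw [hB, F.coe_unit]
  congr 1
  change (B, B') = (Bᵀᵀ, (((μ⁻¹)⁻¹ : Rˣ) : R) • (((μ⁻¹ : Rˣ) : R) • B'))
  rw [Matrix.transpose_transpose, inv_inv, smul_smul, Units.mul_inv, one_smul]

lemma Frame.isSimilitude_unique (F : Frame Δ b) (hg : 0 < g) {c : (R ⊗[ℚ] Module.End E 𝔙)ˣ} {μ μ' : Rˣ}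
    (h : D.IsSimilitude c μ) (h' : D.IsSimilitude c μ') : μ = μ' := by
  obtain ⟨A, hA⟩ := F.exists_block (c : R ⊗[ℚ] Module.End E 𝔙)
  have h1 := ((F.isSimilitude_iff hA μ).1 h).symm.trans ((F.isSimilitude_iff hA μ').1 h')
  have h2 := congrFun (congrFun h1 ⟨0, hg⟩) ⟨0, hg⟩
  rw [Matrix.smul_apply, Matrix.smul_apply, Matrix.one_apply_eq, smul_eq_mul, smul_eq_mul, mul_one,
    mul_one] at h2
  exact Units.ext h2

lemma Frame.map_unit {S : Type u} [CommRing S] [Algebra ℚ S] [Algebra E S] [IsScalarTower ℚ E S]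
    (f : R →ₐ[ℚ] S) (hf : ∀ z, f (algebraMap E R z) = algebraMap E S z) (A : GL (Fin g) R)
    (ν : Rˣ) :
    Units.map (Algebra.TensorProduct.map f (AlgHom.id ℚ (Module.End E 𝔙)) : _ →* _)
      (F.unit R (A, ν)) =
      F.unit S (Matrix.GeneralLinearGroup.map (f : R →+* S) A, Units.map (f : R →* S) ν) := by
  refine Units.ext ?_
  change Algebra.TensorProduct.map f (AlgHom.id ℚ (Module.End E 𝔙)) (F.block _) = F.block _
  rw [F.block_apply, F.block_apply, map_add, map_mul, map_mul, Δ.map_idem f hf,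
    Δ.swap.map_idem f hf, map_matEmb, map_matEmb]
  congr 3
  ext k l
  simp [dualMatrices]

variable [Module.Finite ℚ 𝔙]

lemma Frame.inv_unit (x : GL (Fin g) R × Rˣ) :
    (((F.unit R x)⁻¹ : (R ⊗[ℚ] Module.End E 𝔙)ˣ) : R ⊗[ℚ] Module.End E 𝔙) =
      F.block (x.1.1ᵀ, (x.2 : R) • (x.1⁻¹).1) := by
  rw [← map_inv, F.coe_unit]
  change F.block ((x.1⁻¹⁻¹).1ᵀ, ((x.2⁻¹⁻¹ : Rˣ) : R) • (x.1⁻¹).1) = _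
  rw [inv_inv, inv_inv]

lemma Frame.transpose_inv_unit (A : GL (Fin g) R) (ν : Rˣ) (l : Fin g) :
    transpose E 𝔙 R (((F.unit R (A, ν))⁻¹ : (R ⊗[ℚ] Module.End E 𝔙)ˣ) : R ⊗[ℚ] Module.End E 𝔙)
      (extendV0 R (b l : V0 𝔙 E)) = ∑ n, A n l • extendV0 R (b n : V0 𝔙 E) := by
  rw [F.inv_unit, F.block_apply, map_add, LinearMap.add_apply,
    transpose_matEmb_mul_idem Δ (fun k => (b k).2) F.pair_w, transpose_mul_swap_idem Δ (b l).2,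
    add_zero]
  rfl

lemma Frame.transpose_inv_unit' (A : GL (Fin g) R) (ν : Rˣ) (l : Fin g) :
    transpose E 𝔙 R (((F.unit R (A, ν))⁻¹ : (R ⊗[ℚ] Module.End E 𝔙)ˣ) : R ⊗[ℚ] Module.End E 𝔙)
      (extendV0 R (F.b' l : V0 𝔙 E)) = ∑ n, ((ν : R) * (A⁻¹).1 l n) • extendV0 R (F.b' n : V0 𝔙 E) := by
  have h := transpose_mul_swap_idem Δ.swap (F.b' l).2
    (matEmb F.w A.1ᵀ : R ⊗[ℚ] Module.End E 𝔙)
  have h' : transpose E 𝔙 R (matEmb F.w A.1ᵀ * Δ.idem R) (extendV0 R (F.b' l : V0 𝔙 E)) = 0 := h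
  rw [F.inv_unit, F.block_apply, map_add, LinearMap.add_apply, h',
    transpose_matEmb_mul_idem Δ.swap (fun k => (F.b' k).2) F.pair_w', zero_add]
  rfl

end UnitaryDatum

namespace UnitaryDatum

open Matrix

variable {E 𝔙 : Type u} [Field E] [CharZero E] [AddCommGroup 𝔙] [Module E 𝔙] [Module ℚ 𝔙]
  [IsScalarTower ℚ E 𝔙] {g : ℕ}

variable {D : UnitaryDatum E 𝔙} {i j : E →ₐ[ℚ] E} {Δ : SqrtGenerator D i j}
  {b : Module.Basis (Fin g) E (eigenPart 𝔙 i)} (F : Frame Δ b)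

lemma isScalarTower_compHom (R : Type u) [CommRing R] [Algebra E R] :
    letI : Algebra ℚ R := Algebra.compHom R (algebraMap ℚ E)
    IsScalarTower ℚ E R :=
  letI : Algebra ℚ R := Algebra.compHom R (algebraMap ℚ E)
  IsScalarTower.of_algebraMap_eq fun _ => rfl

/-- The parametrization of the points of `G_E` by `GL_g × 𝔾_m`. -/
def Frame.param : GLParam D.groupE g where
  pt R _ _ :=
    letI : Algebra ℚ R := Algebra.compHom R (algebraMap ℚ E)
    haveI := isScalarTower_compHom (E := E) R
    (F.unit R).codRestrict (D.similitudes R) fun x => ⟨_, F.isSimilitude_unit x⟩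
  map_pt {R S} _ _ _ _ f A ν := by
    letI : Algebra ℚ R := Algebra.compHom R (algebraMap ℚ E)
    haveI := isScalarTower_compHom (E := E) R
    letI : Algebra ℚ S := Algebra.compHom S (algebraMap ℚ E)
    haveI := isScalarTower_compHom (E := E) S
    exact Subtype.ext (F.map_unit (AlgHom.mk f.toRingHom fun r => f.commutes (algebraMap ℚ E r))
      (fun z => f.commutes z) A ν)
  surjective R _ _ := by
    letI : Algebra ℚ R := Algebra.compHom R (algebraMap ℚ E)
    haveI := isScalarTower_compHom (E := E) R
    rintro ⟨c, μ, hμ⟩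
    obtain ⟨A, hA⟩ := F.exists_unit hμ
    exact ⟨(A, μ⁻¹), Subtype.ext hA.symm⟩

variable {R : Type u} [CommRing R] [Algebra E R]

lemma Frame.hasMultiplier_param (hg : 0 < g) (A : GL (Fin g) R) (ν μ : Rˣ) :
    D.HasMultiplier (F.param.pt R (A, ν)) μ ↔ μ = ν⁻¹ := by
  letI : Algebra ℚ R := Algebra.compHom R (algebraMap ℚ E)
  haveI := isScalarTower_compHom (E := E) R
  have h : D.IsSimilitude (F.unit R (A, ν)) ν⁻¹ := F.isSimilitude_unit (A, ν)
  constructor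
  · intro h'
    exact F.isSimilitude_unique hg h' h
  · rintro rfl
    exact h

variable [Module.Finite ℚ 𝔙]

/-- The action on `V₁` in the given basis. -/
lemma Frame.act_basis (A : GL (Fin g) R) (ν : Rˣ) (l : Fin g) :
    (D.dualRep.baseChange E).act R (F.param.pt R (A, ν)) (1 ⊗ₜ (b l : V0 𝔙 E)) =
      ∑ n, A n l • ((1 : R) ⊗ₜ[E] (b n : V0 𝔙 E)) := by
  letI : Algebra ℚ R := Algebra.compHom R (algebraMap ℚ E)
  haveI := isScalarTower_compHom (E := E) R
  apply (TensorProduct.AlgebraTensorModule.cancelBaseChange ℚ E R R (Module.Dual ℚ 𝔙)).injective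
  rw [map_sum]
  refine (AlgRep.baseChange_act_one_tmul E D.dualRep _ _).trans ((F.transpose_inv_unit A ν l).trans ?_)
  exact Finset.sum_congr rfl fun n _ => (AlgRep.cancelBaseChange_smul_tmul E _ _).symm

/-- The action on `V₂` in the dual basis. -/
lemma Frame.act_basis' (A : GL (Fin g) R) (ν : Rˣ) (l : Fin g) :
    (D.dualRep.baseChange E).act R (F.param.pt R (A, ν)) (1 ⊗ₜ (F.b' l : V0 𝔙 E)) =
      ∑ n, ((ν : R) * (A⁻¹).1 l n) • ((1 : R) ⊗ₜ[E] (F.b' n : V0 𝔙 E)) := by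
  letI : Algebra ℚ R := Algebra.compHom R (algebraMap ℚ E)
  haveI := isScalarTower_compHom (E := E) R
  apply (TensorProduct.AlgebraTensorModule.cancelBaseChange ℚ E R R (Module.Dual ℚ 𝔙)).injective
  rw [map_sum]
  refine (AlgRep.baseChange_act_one_tmul E D.dualRep _ _).trans ((F.transpose_inv_unit' A ν l).trans ?_)
  exact Finset.sum_congr rfl fun n _ => (AlgRep.cancelBaseChange_smul_tmul E _ _).symm

/-- The points of the standard Borel subgroup are those with an upper triangular matrix. -/
lemma Frame.isUpperTriangular_iff (hg : 0 < g) (x : D.groupE.pts R) (t : Fin g → Rˣ) (ν : Rˣ) :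
    D.IsUpperTriangular b x t ν ↔ ∃ A : GL (Fin g) R, x = F.param.pt R (A, ν) ∧
      (∀ l' l, l < l' → A l' l = 0) ∧ ∀ l, A l l = t l := by
  constructor
  · rintro ⟨h1, h2⟩
    obtain ⟨⟨A, ν'⟩, rfl⟩ := F.param.surjective R x
    have hν := (F.hasMultiplier_param hg A ν' ν⁻¹).1 h1
    obtain rfl : ν = ν' := inv_injective hν
    have h3 : ∀ l n, l ≤ n → A n l - (if n = l then (t l : R) else 0) = 0 := by
      intro l n hln
      have h4 := h2 l
      rw [F.act_basis] at h4
      have h5 : ∀ y ∈ Submodule.span R ((fun l' : Fin g => (1 : R) ⊗ₜ[E] (b l' : V0 𝔙 E)) ''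
          {l' | l' < l}), AlgRep.ev R (pair (F.w n)) y = 0 := by
        intro y hy
        induction hy using Submodule.span_induction with
        | mem y hy =>
          obtain ⟨l', hl', rfl⟩ := hy
          rw [AlgRep.ev_tmul, F.pair_w, if_neg (lt_of_lt_of_le hl' hln).ne, zero_smul]
        | zero => exact map_zero _
        | add y z _ _ hy hz => rw [map_add, hy, hz, add_zero]
        | smul r y _ hy => rw [map_smul, hy, smul_zero]
      have h6 := h5 _ h4
      rw [map_sub, map_sum, map_smul] at h6
      simp only [map_smul, AlgRep.ev_tmul, F.pair_w, ite_smul, one_smul, zero_smul, smul_eq_mul,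
        mul_ite, mul_one, mul_zero, Finset.sum_ite_eq', Finset.mem_univ, if_true] at h6
      simpa only [eq_comm (a := n)] using h6
    refine ⟨A, rfl, fun l' l hl => ?_, fun l => ?_⟩
    · simpa [hl.ne'] using h3 l l' hl.le
    · simpa [sub_eq_zero] using h3 l l le_rfl
  · rintro ⟨A, rfl, hA, ht⟩
    refine ⟨(F.hasMultiplier_param hg A ν ν⁻¹).2 rfl, fun l => ?_⟩
    rw [F.act_basis, ← ht, ← Finset.sum_erase_eq_sub (Finset.mem_univ l)]
    refine Submodule.sum_mem _ fun n hn => ?_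
    rcases lt_trichotomy n l with h | h | h
    · exact Submodule.smul_mem _ _ (Submodule.subset_span ⟨n, h, rfl⟩)
    · exact absurd h (Finset.ne_of_mem_erase hn)
    · rw [hA n l h, zero_smul]
      exact Submodule.zero_mem _

end UnitaryDatum

/-! ### Tensor powers inside the exterior algebra -/

namespace AlgRep

section Wedge

variable {k : Type w} [CommRing k] {W : Type v} [AddCommGroup W] [Module k W]
variable (R : Type u) [CommRing R] [Algebra k R]

/-- The wedge product of `n` elements of `R ⊗ W`, in `R ⊗ ∧W = ∧(R ⊗ W)`. -/
def wedge (n : ℕ) : (R ⊗[k] W) [⋀^Fin n]→ₗ[R] R ⊗[k] ExteriorAlgebra k W :=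
  (ExteriorAlgebra.lift R ⟨extι k W R, extι_sq⟩).toLinearMap.compAlternatingMap
    (ExteriorAlgebra.ιMulti R n)

variable {R}

lemma wedge_apply {n : ℕ} (m : Fin n → R ⊗[k] W) :
    wedge R n m = (List.ofFn fun l => extι k W R (m l)).prod := by
  rw [wedge, LinearMap.compAlternatingMap_apply, AlgHom.toLinearMap_apply,
    ExteriorAlgebra.ιMulti_apply, map_list_prod, List.map_ofFn]
  congr 2
  funext l
  exact ExteriorAlgebra.lift_ι_apply _ _ _ _

lemma wedge_one_tmul {n : ℕ} (v : Fin n → W) :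
    wedge R n (fun l => 1 ⊗ₜ v l) = 1 ⊗ₜ ExteriorAlgebra.ιMulti k n v := by
  have h : (1 : R) ⊗ₜ[k] ExteriorAlgebra.ιMulti k n v =
      Algebra.TensorProduct.includeRight (ExteriorAlgebra.ιMulti k n v) := rfl
  rw [h, ExteriorAlgebra.ιMulti_apply, map_list_prod, List.map_ofFn, wedge_apply]
  rfl

lemma extEnd_wedge {n : ℕ} (f : Module.End R (R ⊗[k] W)) (m : Fin n → R ⊗[k] W) :
    extEnd f (wedge R n m) = wedge R n (fun l => f (m l)) := by
  rw [wedge_apply, wedge_apply, map_list_prod, List.map_ofFn]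
  congr 2
  funext l
  exact extEnd_extι f _

lemma map_wedge {W' : Type*} [AddCommGroup W'] [Module k W'] {n : ℕ} (L : W →ₗ[k] W')
    (m : Fin n → R ⊗[k] W) :
    (ExteriorAlgebra.map L).toLinearMap.baseChange R (wedge R n m) =
      wedge R n (fun l => L.baseChange R (m l)) := by
  have h : ∀ x, (ExteriorAlgebra.map L).toLinearMap.baseChange R x =
      Algebra.TensorProduct.map (AlgHom.id R R) (ExteriorAlgebra.map L) x := fun _ => rfl
  rw [h, wedge_apply, wedge_apply, map_list_prod, List.map_ofFn]
  congr 2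
  funext l
  rw [Function.comp_apply, ← h, extι, extι, ← LinearMap.comp_apply, ← LinearMap.comp_apply,
    ← LinearMap.baseChange_comp, ← LinearMap.baseChange_comp]
  congr 2
  ext v
  simp

lemma rTensor_wedge {S : Type u} [CommRing S] [Algebra k S] (f : R →ₐ[k] S) {n : ℕ}
    (m : Fin n → R ⊗[k] W) :
    f.toLinearMap.rTensor _ (wedge R n m) =
      wedge S n (fun l => f.toLinearMap.rTensor W (m l)) := by
  have h : ∀ x, f.toLinearMap.rTensor (ExteriorAlgebra k W) x =
      Algebra.TensorProduct.map f (AlgHom.id k (ExteriorAlgebra k W)) x := fun _ => rfl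
  rw [h, wedge_apply, wedge_apply, map_list_prod, List.map_ofFn]
  congr 2
  funext l
  exact extι_rTensor f _

variable (R) in
/-- The tensor power of `R ⊗ W` in `R ⊗ ∧(W ^ s)`: the product of `s` elements, the one with
index `l` being placed in the copy of index `l`. -/
def tens (s : ℕ) : MultilinearMap R (fun _ : Fin s => R ⊗[k] W)
    (R ⊗[k] ExteriorAlgebra k (Fin s → W)) :=
  (wedge R s).toMultilinearMap.compLinearMap fun l =>
    (LinearMap.single k (fun _ : Fin s => W) l).baseChange R

lemma tens_apply {s : ℕ} (w : Fin s → R ⊗[k] W) :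
    tens R s w = wedge R s fun l => (LinearMap.single k (fun _ : Fin s => W) l).baseChange R (w l) :=
  rfl

lemma tens_eq_prod {s : ℕ} (w : Fin s → R ⊗[k] W) :
    tens R s w = (List.ofFn fun l => (ExteriorAlgebra.ι k ∘ₗ
      LinearMap.single k (fun _ : Fin s => W) l).baseChange R (w l)).prod := by
  rw [tens_apply, wedge_apply]
  congr 2
  funext l
  rw [LinearMap.baseChange_comp]
  rfl

lemma baseChange_single_proj {s : ℕ} (l l' : Fin s) (x : R ⊗[k] W) :
    (LinearMap.proj l' : (Fin s → W) →ₗ[k] W).baseChange R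
      ((LinearMap.single k (fun _ : Fin s => W) l).baseChange R x) = if l = l' then x else 0 := by
  rw [← LinearMap.comp_apply, ← LinearMap.baseChange_comp]
  split_ifs with h
  · subst h
    rw [LinearMap.proj_comp_single_same, LinearMap.baseChange_id, LinearMap.id_apply]
  · rw [LinearMap.proj_comp_single_ne _ _ _ _ (Ne.symm h), LinearMap.baseChange_zero,
      LinearMap.zero_apply]

end Wedge

section Independence

variable {k : Type w} [Field k] {W : Type v} [AddCommGroup W] [Module k W]
variable {K : Type u} [Field K] [Algebra k K]

/-- Linear forms on the exterior algebra detect the tensor power: the relevant forms are given by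
determinants. -/
lemma exists_form_tens {s : ℕ} (μ : Fin s → (K ⊗[k] W →ₗ[K] K)) :
    ∃ Φ : K ⊗[k] ExteriorAlgebra k (Fin s → W) →ₗ[K] K, ∀ w, Φ (tens K s w) = ∏ l, μ l (w l) := by
  let μ' : K ⊗[k] (Fin s → W) →ₗ[K] (Fin s → K) := LinearMap.pi fun l =>
    μ l ∘ₗ (LinearMap.proj l : (Fin s → W) →ₗ[k] W).baseChange K
  let μ₀ : (Fin s → W) →ₗ[k] (Fin s → K) := (μ'.restrictScalars k) ∘ₗ TensorProduct.mk k K _ 1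
  let alt : (Fin s → W) [⋀^Fin s]→ₗ[k] K :=
    { ((Matrix.detRowAlternating (n := Fin s) (R := K)).toMultilinearMap.restrictScalars
        k).compLinearMap fun _ => μ₀ with
      map_eq_zero_of_eq' := fun v i j h hij =>
        Matrix.detRowAlternating.map_eq_zero_of_eq _ (congrArg μ₀ h) hij }
  let Φ : K ⊗[k] ExteriorAlgebra k (Fin s → W) →ₗ[K] K :=
    LinearMap.liftBaseChange K (ExteriorAlgebra.liftAlternating (Pi.single s alt))
  have hΦ : Φ.compAlternatingMap (wedge K s) =
      (Matrix.detRowAlternating (n := Fin s) (R := K)).compLinearMap μ' := by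
    refine Module.Basis.ext_alternating
      (Algebra.TensorProduct.basis K (Module.Basis.ofVectorSpace k (Fin s → W))) fun v _ => ?_
    rw [LinearMap.compAlternatingMap_apply]
    simp only [Algebra.TensorProduct.basis_apply]
    rw [wedge_one_tmul, LinearMap.liftBaseChange_tmul,
      ExteriorAlgebra.liftAlternating_apply_ιMulti, Pi.single_eq_same, one_smul]
    rfl
  refine ⟨Φ, fun w => ?_⟩
  rw [tens_apply, ← LinearMap.compAlternatingMap_apply, hΦ, AlternatingMap.compLinearMap_apply]
  have h : (fun l => μ' ((LinearMap.single k (fun _ : Fin s => W) l).baseChange K (w l))) =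
      Matrix.diagonal fun l => μ l (w l) := by
    funext l l'
    rw [LinearMap.pi_apply, LinearMap.comp_apply, baseChange_single_proj, Matrix.diagonal_apply]
    split_ifs with h
    · rw [h]
    · exact map_zero _
  change Matrix.det (fun l => μ' _) = _
  rw [h, Matrix.det_diagonal]

/-- Coordinates on the tensor power. -/
def tensCoord {ι : Type*} [Fintype ι] (s : ℕ) (β : ι → K ⊗[k] W) :
    ((Fin s → ι) → K) →ₗ[K] K ⊗[k] ExteriorAlgebra k (Fin s → W) :=
  Fintype.linearCombination K fun κ : Fin s → ι => tens K s (β ∘ κ)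

variable {ι : Type*} [Fintype ι] {s : ℕ} {β : ι → K ⊗[k] W}

lemma tensCoord_apply (f : (Fin s → ι) → K) :
    tensCoord s β f = ∑ κ, f κ • tens K s (β ∘ κ) := rfl

lemma tensCoord_injective [DecidableEq ι] {μ : ι → (K ⊗[k] W →ₗ[K] K)}
    (hμ : ∀ m n, μ m (β n) = if n = m then 1 else 0) :
    Function.Injective (tensCoord (K := K) s β) := by
  rw [injective_iff_map_eq_zero]
  intro f hf
  funext κ
  obtain ⟨Φ, hΦ⟩ := exists_form_tens fun l => μ (κ l)
  have h := congrArg Φ hf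
  rw [tensCoord_apply, map_sum, map_zero, Finset.sum_eq_single κ] at h
  · rw [map_smul, hΦ] at h
    simpa [hμ] using h
  · intro κ' _ hκ
    obtain ⟨l, hl⟩ := Function.ne_iff.1 hκ
    rw [map_smul, hΦ, Finset.prod_eq_zero (Finset.mem_univ l), smul_zero]
    rw [Function.comp_apply, hμ, if_neg hl]
  · simp

/-- The span of the products of elements of a subspace is the range of the coordinate map of a
spanning family. -/
lemma span_tens_eq_range {U : Submodule K (K ⊗[k] W)} (hβ : Submodule.span K (Set.range β) = U) :
    Submodule.span K {x | ∃ w : Fin s → K ⊗[k] W, (∀ l, w l ∈ U) ∧ x = tens K s w} =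
      LinearMap.range (tensCoord (K := K) s β) := by
  classical
  apply le_antisymm
  · rw [Submodule.span_le]
    rintro _ ⟨w, hw, rfl⟩
    subst hβ
    choose c hc using fun l => (Submodule.mem_span_range_iff_exists_fun K).1 (hw l)
    have : w = fun l => ∑ m, c l m • β m := funext fun l => (hc l).symm
    rw [this, MultilinearMap.map_sum]
    refine ⟨fun κ => ∏ l, c l (κ l), ?_⟩
    rw [tensCoord_apply]
    refine Finset.sum_congr rfl fun κ _ => ?_
    rw [MultilinearMap.map_smul_univ]
    rfl
  · rintro _ ⟨f, rfl⟩
    rw [tensCoord_apply]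
    refine Submodule.sum_mem _ fun κ _ => Submodule.smul_mem _ _ (Submodule.subset_span ?_)
    exact ⟨_, fun l => hβ ▸ Submodule.subset_span ⟨κ l, rfl⟩, rfl⟩

end Independence

section Equivariance

variable {k : Type w} [CommRing k] {G : GroupFunctor.{u, w} k}
variable {V : Type v} [AddCommGroup V] [Module k V] {V' : Type v} [AddCommGroup V'] [Module k V']
variable {ρ : AlgRep G V} {ρ' : AlgRep G V'}

/-- The exterior algebra of a morphism of representations. -/
lemma IsEquivariant.exterior {f : V →ₗ[k] V'} (h : IsEquivariant ρ ρ' f) :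
    IsEquivariant ρ.exterior ρ'.exterior (ExteriorAlgebra.map f).toLinearMap := by
  intro R _ _ g x
  let F : R ⊗[k] ExteriorAlgebra k V →ₐ[R] R ⊗[k] ExteriorAlgebra k V' :=
    Algebra.TensorProduct.map (AlgHom.id R R) (ExteriorAlgebra.map f)
  have hF : ∀ y, F (extι k V R y) = extι k V' R (f.baseChange R y) := by
    intro y
    change (ExteriorAlgebra.map f).toLinearMap.baseChange R _ = _
    rw [extι, extι, ← LinearMap.comp_apply, ← LinearMap.comp_apply, ← LinearMap.baseChange_comp,
      ← LinearMap.baseChange_comp]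
    congr 2
    ext v
    simp
  have key : F.comp (extEnd (ρ.act R g)) = (extEnd (ρ'.act R g)).comp F := by
    refine ext_algHom fun y => ?_
    rw [AlgHom.comp_apply, AlgHom.comp_apply, extEnd_extι, hF, hF, extEnd_extι, h]
  exact DFunLike.congr_fun key x

end Equivariance

end AlgRep

namespace AlgRep

section TensPerm

variable {k : Type w} [CommRing k] {W : Type v} [AddCommGroup W] [Module k W]
variable {R : Type u} [CommRing R] [Algebra k R]

/-- Placing the factors in permuted copies amounts to permuting them, up to the sign coming from
the exterior algebra. -/
lemma wedge_single_perm {s : ℕ} (σ : Equiv.Perm (Fin s)) (w : Fin s → R ⊗[k] W) :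
    wedge R s (fun l => (LinearMap.single k (fun _ : Fin s => W) (σ l)).baseChange R (w l)) =
      Equiv.Perm.sign σ • tens R s (w ∘ σ.symm) := by
  rw [tens_apply, ← AlternatingMap.map_perm]
  congr 1
  funext l
  simp

lemma map_tens {s : ℕ} (L : (Fin s → W) →ₗ[k] (Fin s → W)) (w : Fin s → R ⊗[k] W) :
    (ExteriorAlgebra.map L).toLinearMap.baseChange R (tens R s w) =
      wedge R s fun l => (L ∘ₗ LinearMap.single k (fun _ : Fin s => W) l).baseChange R (w l) := by
  rw [tens_apply, map_wedge]
  simp only [LinearMap.baseChange_comp, LinearMap.comp_apply]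

lemma rTensor_tens {S : Type u} [CommRing S] [Algebra k S] (f : R →ₐ[k] S) {s : ℕ}
    (w : Fin s → R ⊗[k] W) :
    f.toLinearMap.rTensor _ (tens R s w) = tens S s (fun l => f.toLinearMap.rTensor W (w l)) := by
  rw [tens_apply, rTensor_wedge, tens_apply]
  congr 1
  funext l
  rw [LinearMap.rTensor_baseChange]

lemma exterior_act_tens {G : GroupFunctor.{u, w} k} (ρ : AlgRep G W) {s : ℕ} (x : G.pts R)
    (w : Fin s → R ⊗[k] W) :
    ((ρ.pow s).exterior).act R x (tens R s w) = tens R s fun l => ρ.act R x (w l) := by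
  rw [tens_apply, tens_apply]
  refine (extEnd_wedge _ _).trans ?_
  congr 1
  funext l
  exact (isEquivariant_single l R x (w l)).symm

section BaseChange

variable {G : GroupFunctor.{u, w} k} (K : Type u) [CommRing K] [Algebra k K]
  {R : Type u} [CommRing R] [Algebra K R]

/-- The action on a tensor power, in terms of matrix coefficients of the action on the factors. -/
lemma baseChange_exterior_act_tens (ρ : AlgRep G W) {s : ℕ}
    {ι : Type*} [Fintype ι] (x : (G.baseChange K).pts R) (β : ι → K ⊗[k] W)
    (A : ι → ι → R)
    (h : ∀ m, (ρ.baseChange K).act R x (1 ⊗ₜ β m) = ∑ n, A n m • ((1 : R) ⊗ₜ[K] β n))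
    (κ : Fin s → ι) :
    (((ρ.pow s).exterior).baseChange K).act R x (1 ⊗ₜ tens K s (β ∘ κ)) =
      ∑ κ' : Fin s → ι, (∏ l, A (κ' l) (κ l)) • ((1 : R) ⊗ₜ[K] tens K s (β ∘ κ')) := by
  classical
  let : Algebra k R := Algebra.compHom R (algebraMap k K)
  have : IsScalarTower k K R := IsScalarTower.of_algebraMap_eq fun _ => rfl
  apply (TensorProduct.AlgebraTensorModule.cancelBaseChange k K R R
    (ExteriorAlgebra k (Fin s → W))).injective
  have h' : ∀ m, ρ.act R (show G.pts R from x)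
      (((Algebra.ofId K R).restrictScalars k).toLinearMap.rTensor W (β m)) =
      ∑ n, A n m • ((Algebra.ofId K R).restrictScalars k).toLinearMap.rTensor W (β n) := by
    intro m
    rw [← baseChange_act_one_tmul K ρ x (β m), h, map_sum]
    exact Finset.sum_congr rfl fun n _ => cancelBaseChange_smul_tmul K _ _
  refine (baseChange_act_one_tmul K _ x _).trans ?_
  rw [rTensor_tens, exterior_act_tens, map_sum]
  simp only [Function.comp_apply, h']
  rw [MultilinearMap.map_sum]
  refine Finset.sum_congr rfl fun κ' _ => ?_
  rw [MultilinearMap.map_smul_univ]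
  refine Eq.trans ?_ (cancelBaseChange_smul_tmul K _ _).symm
  rw [rTensor_tens]
  rfl

end BaseChange

end TensPerm

end AlgRep

namespace UnitaryDatum

variable {E 𝔙 : Type u} [Field E] [CharZero E] [AddCommGroup 𝔙] [Module E 𝔙] [Module ℚ 𝔙]
  [IsScalarTower ℚ E 𝔙] {s : ℕ}

open AlgRep

lemma tensorPart_eq_span (W : Submodule E (V0 𝔙 E)) :
    tensorPart s W = Submodule.span E {x | ∃ w : Fin s → V0 𝔙 E, (∀ l, w l ∈ W) ∧
      x = tens E s w} := by
  simp only [tensorPart, tens_eq_prod]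

variable (𝔙) in
/-- The endomorphism of `(𝒱₀ ⊗ ℚ) ^ s` given by an integral matrix. -/
def matrixMap (s : ℕ) (m : Matrix (Fin s) (Fin s) ℤ) :
    (Fin s → Module.Dual ℚ 𝔙) →ₗ[ℚ] (Fin s → Module.Dual ℚ 𝔙) :=
  LinearMap.pi fun l => ∑ l' : Fin s, m l l' •
    (LinearMap.proj l' : (Fin s → Module.Dual ℚ 𝔙) →ₗ[ℚ] Module.Dual ℚ 𝔙)

lemma matrixAct_eq (m : Matrix (Fin s) (Fin s) ℤ) :
    matrixAct 𝔙 s m = (ExteriorAlgebra.map (matrixMap 𝔙 s m)).toLinearMap := rfl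

lemma matrixMap_diagonal_single (d : Fin s → ℤ) (l : Fin s) :
    matrixMap 𝔙 s (Matrix.diagonal d) ∘ₗ LinearMap.single ℚ (fun _ => Module.Dual ℚ 𝔙) l =
      (d l : ℚ) • LinearMap.single ℚ (fun _ => Module.Dual ℚ 𝔙) l := by
  refine LinearMap.ext fun φ => funext fun l' => ?_
  rw [LinearMap.comp_apply, matrixMap, LinearMap.pi_apply, LinearMap.sum_apply,
    Finset.sum_eq_single l]
  · rw [LinearMap.smul_apply, LinearMap.proj_apply, LinearMap.smul_apply, LinearMap.single_apply,
      Pi.single_eq_same, Pi.smul_apply, Matrix.diagonal_apply]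
    split_ifs with h
    · subst h
      rw [Pi.single_eq_same, Int.cast_smul_eq_zsmul]
    · rw [Pi.single_eq_of_ne h, zero_smul, smul_zero]
  · intro m _ hm
    rw [LinearMap.smul_apply, LinearMap.proj_apply, LinearMap.single_apply,
      Pi.single_eq_of_ne hm, smul_zero]
  · simp

lemma matrixMap_perm_single (σ : Equiv.Perm (Fin s)) (l : Fin s) :
    matrixMap 𝔙 s (σ⁻¹.permMatrix ℤ) ∘ₗ LinearMap.single ℚ (fun _ => Module.Dual ℚ 𝔙) l =
      LinearMap.single ℚ (fun _ => Module.Dual ℚ 𝔙) (σ l) := by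
  refine LinearMap.ext fun φ => funext fun l' => ?_
  rw [LinearMap.comp_apply, matrixMap, LinearMap.pi_apply, LinearMap.sum_apply,
    Finset.sum_eq_single l]
  · rw [LinearMap.smul_apply, LinearMap.proj_apply, LinearMap.single_apply,
      Pi.single_eq_same, LinearMap.single_apply, Equiv.Perm.permMatrix, PEquiv.toMatrix_apply]
    by_cases h : l' = σ l
    · subst h
      simp
    · have h' : σ⁻¹ l' ≠ l := fun e => h (by rw [← e]; simp)
      have h'' : l ∉ (σ⁻¹ : Equiv.Perm (Fin s)).toPEquiv l' := by simpa [eq_comm] using h'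
      rw [Pi.single_eq_of_ne h, if_neg h'', zero_smul]
  · intro m _ hm
    rw [LinearMap.smul_apply, LinearMap.proj_apply, LinearMap.single_apply,
      Pi.single_eq_of_ne hm, smul_zero]
  · simp

lemma symAct_single (σ : Equiv.Perm (Fin s)) (r : ℚ) :
    symAct 𝔙 s (MonoidAlgebra.single σ r) =
      r • (ExteriorAlgebra.map (matrixMap 𝔙 s (σ⁻¹.permMatrix ℤ))).toLinearMap := by
  rw [symAct, MonoidAlgebra.lift_single]
  rfl

lemma symAct_single_tens (σ : Equiv.Perm (Fin s)) (r : ℚ) (w : Fin s → V0 𝔙 E) :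
    (symAct 𝔙 s (MonoidAlgebra.single σ r)).baseChange E (tens E s w) =
      (algebraMap ℚ E r) • Equiv.Perm.sign σ • tens E s (w ∘ σ.symm) := by
  rw [symAct_single, LinearMap.baseChange_smul, LinearMap.smul_apply, algebraMap_smul, map_tens,
    ← wedge_single_perm]
  simp only [matrixMap_perm_single]

/-- Through tensor coordinates, the action of `ℚ[𝔖_s]` is the signed permutation action. -/
lemma symAct_tensCoord {ι : Type*} [Fintype ι] [DecidableEq ι] (β : ι → V0 𝔙 E)
    (C : MonoidAlgebra ℚ (Equiv.Perm (Fin s))) (f : (Fin s → ι) → E) :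
    (symAct 𝔙 s C).baseChange E (tensCoord s β f) =
      tensCoord s β (TensorCoord.signedPerm (Fin s) ι E C f) := by
  induction C using MonoidAlgebra.induction_linear with
  | zero => simp
  | add C C' h h' => simp only [map_add, LinearMap.baseChange_add, LinearMap.add_apply, h, h']
  | single σ r =>
    rw [tensCoord_apply, map_sum, tensCoord_apply]
    refine Fintype.sum_equiv (σ.arrowCongr (Equiv.refl ι)) _ _ fun κ => ?_
    have e : (σ.arrowCongr (Equiv.refl ι)) κ = κ ∘ σ.symm := rfl
    have e' : (κ ∘ σ.symm) ∘ σ = κ := by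
      funext l
      simp
    rw [e, TensorCoord.signedPerm_single, e', map_smul, symAct_single_tens, Units.smul_def,
      ← Int.cast_smul_eq_zsmul E, smul_smul, smul_smul]
    congr 1
    ring

end UnitaryDatum

/-! ### The projectors in the algebra generated by the integral matrices and the order -/

/-- A polynomial in an endomorphism acts on an eigenvector through its value at the
eigenvalue. -/
lemma Polynomial.aeval_end_apply_of_eq_smul {k K M : Type*} [Field k] [Field K] [Algebra k K]
    [AddCommGroup M] [Module K M] [Module k M] [IsScalarTower k K M] {f : Module.End K M} {r : K}
    {x : M} (h : f x = r • x) (p : Polynomial k) :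
    Polynomial.aeval f p x = Polynomial.aeval r p • x := by
  induction p using Polynomial.induction_on' with
  | add p q hp hq => rw [map_add, map_add, LinearMap.add_apply, hp, hq, add_smul]
  | monomial n a =>
    have e : ∀ n : ℕ, (f ^ n) x = r ^ n • x := by
      intro n
      induction n with
      | zero => simp
      | succ n ih => rw [pow_succ', Module.End.mul_apply, ih, map_smul, h, smul_smul, pow_succ]
    rw [Polynomial.aeval_monomial, Polynomial.aeval_monomial, Module.End.mul_apply, e,
      Module.algebraMap_end_apply, mul_smul, algebraMap_smul]

/-- A polynomial taking the value `1` at a point and `0` at finitely many others. -/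
lemma Polynomial.exists_eval_eq_ite {K : Type*} [Field K] [DecidableEq K] (T : Finset K) (x₀ : K) :
    ∃ p : Polynomial K, ∀ x ∈ T, p.eval x = if x = x₀ then 1 else 0 :=
  ⟨Lagrange.interpolate T id fun x => if x = x₀ then 1 else 0, fun x hx =>
    Lagrange.eval_interpolate_at_node (v := id) _ Function.injective_id.injOn hx⟩

/-- Distinct primes detect bijectivity. -/
lemma bijective_of_prod_prime_eq {s n : ℕ} {d : Fin s → ℕ} (hd : ∀ l, (d l).Prime)
    (hd' : Function.Injective d) {l : Fin n → Fin s} (h : ∏ k, d (l k) = ∏ m, d m) :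
    Function.Bijective l := by
  have h1 : (List.ofFn (d ∘ l)).Perm (List.ofFn d) := by
    have e1 : (List.ofFn (d ∘ l)).prod = ∏ m, d m := by rw [List.prod_ofFn, ← h]; rfl
    have e2 : (List.ofFn d).prod = ∏ m, d m := List.prod_ofFn
    refine (Nat.primeFactorsList_unique e1 ?_).trans (Nat.primeFactorsList_unique e2 ?_).symm
    · simp [List.forall_mem_ofFn_iff, hd]
    · simp [List.forall_mem_ofFn_iff, hd]
  constructor
  · have h2 : (List.ofFn (d ∘ l)).Nodup := h1.nodup_iff.2 (List.nodup_ofFn.2 hd')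
    exact (List.nodup_ofFn.1 h2).of_comp
  · intro m
    have h2 : d m ∈ List.ofFn (d ∘ l) := h1.mem_iff.2 (List.mem_ofFn.2 ⟨m, rfl⟩)
    obtain ⟨k, hk⟩ := List.mem_ofFn.1 h2
    exact ⟨k, hd' hk⟩

namespace UnitaryDatum

variable {E 𝔙 : Type u} [Field E] [CharZero E] [AddCommGroup 𝔙] [Module E 𝔙] [Module ℚ 𝔙]
  [IsScalarTower ℚ E 𝔙] {s : ℕ}

open AlgRep

section Projector

/-- Products of elements of the copies of `𝒱₀ ⊗ ℚ`. -/
def monom (s : ℕ) {n : ℕ} (l : Fin n → Fin s) (φ : Fin n → Module.Dual ℚ 𝔙) : Ext 𝔙 s :=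
  ExteriorAlgebra.ιMulti ℚ n fun k => LinearMap.single ℚ (fun _ => Module.Dual ℚ 𝔙) (l k) (φ k)

lemma span_monom : Submodule.span ℚ {x : Ext 𝔙 s | ∃ (n : ℕ) (l : Fin n → Fin s)
    (φ : Fin n → Module.Dual ℚ 𝔙), x = monom s l φ} = ⊤ := by
  rw [eq_top_iff, ← ExteriorAlgebra.ιMulti_span, Submodule.span_le]
  rintro _ ⟨⟨n, v⟩, rfl⟩
  have e : v = fun k => ∑ l : Fin s, LinearMap.single ℚ (fun _ => Module.Dual ℚ 𝔙) l (v k l) :=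
    funext fun k => (LinearMap.sum_single_apply _ (v k)).symm
  rw [e]
  change (ExteriorAlgebra.ιMulti ℚ n).toMultilinearMap _ ∈ _
  rw [MultilinearMap.map_sum]
  exact Submodule.sum_mem _ fun l _ => Submodule.subset_span ⟨n, l, _, rfl⟩

lemma ext_monom {f f' : Module.End ℚ (Ext 𝔙 s)}
    (h : ∀ (n : ℕ) (l : Fin n → Fin s) (φ : Fin n → Module.Dual ℚ 𝔙),
      f (monom s l φ) = f' (monom s l φ)) : f = f' := by
  refine LinearMap.ext_on span_monom ?_
  rintro _ ⟨n, l, φ, rfl⟩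
  exact h n l φ

lemma matrixAct_diagonal_monom (d : Fin s → ℤ) {n : ℕ} (l : Fin n → Fin s)
    (φ : Fin n → Module.Dual ℚ 𝔙) :
    matrixAct 𝔙 s (Matrix.diagonal d) (monom s l φ) = (∏ k, (d (l k) : ℚ)) • monom s l φ := by
  rw [matrixAct_eq, monom, AlgHom.toLinearMap_apply, ExteriorAlgebra.map_apply_ιMulti,
    ← AlternatingMap.map_smul_univ]
  congr 1
  funext k
  exact LinearMap.congr_fun (matrixMap_diagonal_single d (l k)) (φ k)

lemma symAct_single_monom (σ : Equiv.Perm (Fin s)) (r : ℚ) {n : ℕ} (l : Fin n → Fin s)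
    (φ : Fin n → Module.Dual ℚ 𝔙) :
    symAct 𝔙 s (MonoidAlgebra.single σ r) (monom s l φ) = r • monom s (σ ∘ l) φ := by
  rw [symAct_single, LinearMap.smul_apply, monom, AlgHom.toLinearMap_apply,
    ExteriorAlgebra.map_apply_ιMulti, monom]
  congr 2
  funext k
  exact LinearMap.congr_fun (matrixMap_perm_single σ (l k)) (φ k)

/-- The condition that `q` is the projector onto the tensor power which annihilates the products
in which some copy of `𝒱₀ ⊗ ℚ` is missing or repeated. -/
def IsTensorProjector (q : Module.End ℚ (Ext 𝔙 s)) : Prop :=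
  ∀ (n : ℕ) (l : Fin n → Fin s) (φ : Fin n → Module.Dual ℚ 𝔙),
    (Function.Bijective l → q (monom s l φ) = monom s l φ) ∧
    (¬ Function.Bijective l → q (monom s l φ) = 0)

/-- The projector onto the tensor power, in the algebra generated by the action of the diagonal
matrices: the spaces of multihomogeneous elements are the eigenspaces of a diagonal matrix whose
entries are distinct primes. -/
lemma exists_tensor_projector [Module.Finite ℚ 𝔙] (O : Subring E) (s : ℕ) :
    ∃ q ∈ EA 𝔙 O s, IsTensorProjector q := by
  classical
  let d : Fin s → ℕ := fun l => Nat.nth Nat.Prime l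
  have hd : ∀ l, (d l).Prime := fun l => Nat.prime_nth_prime l
  have hd' : Function.Injective d := fun l m h =>
    Fin.ext (Nat.nth_injective Nat.infinite_setOfPred_prime h)
  let v₀ : ℚ := ∏ m, (d m : ℚ)
  -- products of more factors than the dimension vanish, so that there are finitely many
  -- eigenvalues
  let N := Module.finrank ℚ (Fin s → Module.Dual ℚ 𝔙)
  let T : Finset ℚ := (Finset.range (N + 1)).biUnion fun n =>
    (Finset.univ : Finset (Fin n → Fin s)).image fun l => ∏ k, (d (l k) : ℚ)
  obtain ⟨p, hp⟩ := Polynomial.exists_eval_eq_ite T v₀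
  let D := matrixAct 𝔙 s (Matrix.diagonal fun l => (d l : ℤ))
  refine ⟨Polynomial.aeval D p, ?_, fun n l φ => ?_⟩
  · have h : D ∈ EA 𝔙 O s := Algebra.subset_adjoin (Or.inl ⟨_, rfl⟩)
    exact Algebra.adjoin_le (Set.singleton_subset_iff.2 h)
      (Polynomial.aeval_mem_adjoin_singleton ℚ D)
  have h1 : Polynomial.aeval D p (monom s l φ) =
      p.eval (∏ k, (d (l k) : ℚ)) • monom s l φ := by
    rw [← Polynomial.coe_aeval_eq_eval]
    refine Polynomial.aeval_end_apply_of_eq_smul ?_ p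
    have := matrixAct_diagonal_monom (𝔙 := 𝔙) (fun l => (d l : ℤ)) l φ
    simpa using this
  rw [h1]
  by_cases hn : n ≤ N
  · rw [hp _ (Finset.mem_biUnion.2 ⟨n, Finset.mem_range.2 (by omega),
      Finset.mem_image.2 ⟨l, Finset.mem_univ _, rfl⟩⟩)]
    constructor
    · intro hl
      rw [if_pos (hl.prod_comp fun m => (d m : ℚ)), one_smul]
    · intro hl
      rw [if_neg, zero_smul]
      intro h
      exact hl (bijective_of_prod_prime_eq hd hd' (by simp only [v₀] at h; exact_mod_cast h))
  · have h0 : monom s l φ = 0 := by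
      refine AlternatingMap.map_linearDependent _ _ fun hli => hn ?_
      simpa using hli.fintype_card_le_finrank
    simp [h0]

variable {q : Module.End ℚ (Ext 𝔙 s)}

lemma IsTensorProjector.isIdempotentElem (hq : IsTensorProjector q) : IsIdempotentElem q := by
  refine ext_monom fun n l φ => ?_
  rw [Module.End.mul_apply]
  by_cases hl : Function.Bijective l
  · rw [(hq n l φ).1 hl, (hq n l φ).1 hl]
  · rw [(hq n l φ).2 hl, map_zero]

lemma IsTensorProjector.commute_symAct (hq : IsTensorProjector q) (x : MonoidAlgebra ℚ (Equiv.Perm (Fin s))) :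
    Commute q (symAct 𝔙 s x) := by
  induction x using MonoidAlgebra.induction_linear with
  | zero => rw [map_zero]; exact Commute.zero_right _
  | add x y hx hy => rw [map_add]; exact hx.add_right hy
  | single σ r =>
    refine ext_monom fun n l φ => ?_
    have e : Function.Bijective (σ ∘ l) ↔ Function.Bijective l := σ.bijective.of_comp_iff' l
    rw [Module.End.mul_apply, Module.End.mul_apply, symAct_single_monom, map_smul]
    by_cases hl : Function.Bijective l
    · rw [(hq n l φ).1 hl, (hq n _ φ).1 (e.2 hl), symAct_single_monom]
    · rw [(hq n l φ).2 hl, (hq n _ φ).2 (mt e.1 hl), smul_zero, map_zero]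

lemma IsTensorProjector.range_le (hq : IsTensorProjector q) :
    LinearMap.range q ≤ ⋀[ℚ]^s (Fin s → Module.Dual ℚ 𝔙) := by
  rw [LinearMap.range_eq_map, ← span_monom, Submodule.map_span, Submodule.span_le]
  rintro _ ⟨_, ⟨n, l, φ, rfl⟩, rfl⟩
  by_cases hl : Function.Bijective l
  · obtain rfl : n = s := by simpa using Fintype.card_of_bijective hl
    rw [(hq _ l φ).1 hl]
    exact ExteriorAlgebra.ιMulti_range ℚ n ⟨_, rfl⟩
  · rw [(hq n l φ).2 hl]
    exact Submodule.zero_mem _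

lemma IsTensorProjector.baseChange_tens (hq : IsTensorProjector q) (w : Fin s → V0 𝔙 E) :
    q.baseChange E (tens E s w) = tens E s w := by
  have h : (q.baseChange E).compMultilinearMap (tens E s) = tens E s := by
    refine Module.Basis.ext_multilinear
      (fun _ => Algebra.TensorProduct.basis E (Module.Basis.ofVectorSpace ℚ (Module.Dual ℚ 𝔙)))
      fun v => ?_
    rw [LinearMap.compMultilinearMap_apply]
    simp only [Algebra.TensorProduct.basis_apply, tens_apply, LinearMap.baseChange_tmul]
    rw [wedge_one_tmul, LinearMap.baseChange_tmul]
    congr 1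
    exact (hq s id _).1 Function.bijective_id
  exact MultilinearMap.congr_fun h w

/-- After extension of scalars the image of the projector is `V₀ ^ ⊗ s`. -/
lemma IsTensorProjector.range_baseChange (hq : IsTensorProjector q) :
    LinearMap.range (q.baseChange E) = tensorPart s ⊤ := by
  rw [tensorPart_eq_span]
  apply le_antisymm
  · rintro _ ⟨y, rfl⟩
    induction y with
    | zero => rw [map_zero]; exact Submodule.zero_mem _
    | add y z hy hz => rw [map_add]; exact Submodule.add_mem _ hy hz
    | tmul r x =>
      have hx : x ∈ Submodule.span ℚ {x : Ext 𝔙 s | ∃ (n : ℕ) (l : Fin n → Fin s)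
        (φ : Fin n → Module.Dual ℚ 𝔙), x = monom s l φ} := by
        rw [span_monom]
        exact Submodule.mem_top
      rw [LinearMap.baseChange_tmul]
      induction hx using Submodule.span_induction with
      | zero => rw [map_zero, TensorProduct.tmul_zero]; exact Submodule.zero_mem _
      | add x x' _ _ h h' => rw [map_add, TensorProduct.tmul_add]; exact Submodule.add_mem _ h h'
      | smul t x _ h =>
        rw [map_smul, TensorProduct.tmul_smul, ← algebraMap_smul E]
        exact Submodule.smul_mem _ _ h
      | mem x hx =>
        obtain ⟨n, l, φ, rfl⟩ := hx
        by_cases hl : Function.Bijective l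
        · obtain rfl : n = s := by simpa using Fintype.card_of_bijective hl
          have e : r ⊗ₜ[ℚ] (monom n l φ : Ext 𝔙 n) = r • wedge E n fun k =>
              (LinearMap.single ℚ (fun _ => Module.Dual ℚ 𝔙) (Equiv.ofBijective l hl k)).baseChange E
                ((1 : E) ⊗ₜ[ℚ] φ k) := by
            simp only [LinearMap.baseChange_tmul]
            rw [wedge_one_tmul, TensorProduct.smul_tmul', smul_eq_mul, mul_one]
            rfl
          rw [(hq _ l φ).1 hl, e, wedge_single_perm, Units.smul_def,
            ← Int.cast_smul_eq_zsmul E]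
          refine Submodule.smul_mem _ _ (Submodule.smul_mem _ _ (Submodule.subset_span ?_))
          exact ⟨_, fun _ => Submodule.mem_top, rfl⟩
        · rw [(hq n l φ).2 hl, TensorProduct.tmul_zero]
          exact Submodule.zero_mem _
  · rw [Submodule.span_le]
    rintro _ ⟨w, -, rfl⟩
    exact ⟨_, hq.baseChange_tens w⟩

end Projector

end UnitaryDatum

namespace AlgRep

variable {k : Type w} [CommRing k] {G : GroupFunctor.{u, w} k}
variable {V : Type*} [AddCommGroup V] [Module k V] {V' : Type*} [AddCommGroup V'] [Module k V']
variable {ρ : AlgRep G V} {ρ' : AlgRep G V'}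

lemma isEquivariant_zero : IsEquivariant ρ ρ' 0 := by
  intro R _ _ g x
  simp

lemma isEquivariant_sum {ι : Type*} (t : Finset ι) {f : ι → V →ₗ[k] V'}
    (h : ∀ m ∈ t, IsEquivariant ρ ρ' (f m)) : IsEquivariant ρ ρ' (∑ m ∈ t, f m) :=
  Finset.sum_induction f (IsEquivariant ρ ρ') (fun _ _ => IsEquivariant.add) isEquivariant_zero h

end AlgRep

namespace UnitaryDatum

variable {E 𝔙 : Type u} [Field E] [CharZero E] [AddCommGroup 𝔙] [Module E 𝔙] [Module ℚ 𝔙]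
  [IsScalarTower ℚ E 𝔙] {s : ℕ}

open AlgRep

section Equivariance

variable (D : UnitaryDatum E 𝔙)

lemma isEquivariant_scalarAct (z : E) : IsEquivariant D.dualRep D.dualRep (scalarAct 𝔙 z) := by
  intro R _ _ c x
  have e : ∀ y : R ⊗[ℚ] Module.Dual ℚ 𝔙, (scalarAct 𝔙 z).baseChange R y =
      transpose E 𝔙 R (1 ⊗ₜ algebraMap E (Module.End E 𝔙) z) y := by
    intro y
    induction y with
    | zero => simp
    | add a b ha hb => simp only [map_add, ha, hb]
    | tmul r φ =>
      rw [LinearMap.baseChange_tmul, transpose_tmul, one_mul]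
      rfl
  have hc : ∀ y : R ⊗[ℚ] Module.End E 𝔙,
      Commute ((1 : R) ⊗ₜ[ℚ] algebraMap E (Module.End E 𝔙) z) y := by
    intro y
    induction y with
    | zero => exact Commute.zero_right _
    | add a b ha hb => exact ha.add_right hb
    | tmul r f =>
      rw [commute_iff_eq, Algebra.TensorProduct.tmul_mul_tmul, Algebra.TensorProduct.tmul_mul_tmul,
        one_mul, mul_one, Algebra.commutes]
  rw [e, e]
  change transpose E 𝔙 R _ (transpose E 𝔙 R _ x) = transpose E 𝔙 R _ (transpose E 𝔙 R _ x)
  rw [← Module.End.mul_apply, ← transpose_mul, ← Module.End.mul_apply, ← transpose_mul,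
    (hc _).eq]

/-- The elements of `E(A)_s ⊗ ℚ` are endomorphisms of the representation. -/
lemma isEquivariant_of_mem_EA {O : Subring E} {x : Module.End ℚ (Ext 𝔙 s)} (hx : x ∈ EA 𝔙 O s) :
    IsEquivariant (D.extRep s) (D.extRep s) x := by
  induction hx using Algebra.adjoin_induction with
  | mem x hx =>
    rcases hx with ⟨m, rfl⟩ | ⟨z, -, rfl⟩
    · rw [matrixAct_eq]
      refine IsEquivariant.exterior ?_
      have e : matrixMap 𝔙 s m = ∑ l, ∑ l', (m l l' : ℚ) •
          (LinearMap.single ℚ (fun _ : Fin s => Module.Dual ℚ 𝔙) l ∘ₗ LinearMap.proj l') := by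
        refine LinearMap.ext fun φ => funext fun n => ?_
        simp only [matrixMap, LinearMap.pi_apply, LinearMap.sum_apply, LinearMap.smul_apply,
          LinearMap.comp_apply, LinearMap.proj_apply, Finset.sum_apply, Pi.smul_apply,
          LinearMap.single_apply]
        rw [Finset.sum_eq_single (a := n) (s := Finset.univ) (f := fun l => ∑ l', _)]
        · simp only [Pi.single_eq_same, Int.cast_smul_eq_zsmul]
        · intro l _ hl
          refine Finset.sum_eq_zero fun l' _ => ?_
          rw [Pi.single_eq_of_ne (Ne.symm hl), smul_zero]
        · simp
      rw [e]
      exact isEquivariant_sum _ fun l _ => isEquivariant_sum _ fun l' _ =>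
        ((isEquivariant_single l).comp (isEquivariant_proj l')).smul _
    · refine IsEquivariant.exterior ?_
      have e : LinearMap.compLeft (scalarAct 𝔙 z) (Fin s) = ∑ l,
          (LinearMap.single ℚ (fun _ : Fin s => Module.Dual ℚ 𝔙) l ∘ₗ
            scalarAct 𝔙 z ∘ₗ LinearMap.proj l) := by
        refine LinearMap.ext fun φ => funext fun n => ?_
        simp only [LinearMap.compLeft_apply, LinearMap.sum_apply, Function.comp_apply,
          LinearMap.comp_apply, LinearMap.proj_apply, Finset.sum_apply, LinearMap.single_apply]
        rw [Finset.sum_eq_single n]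
        · rw [Pi.single_eq_same]
        · intro l _ hl
          rw [Pi.single_eq_of_ne (Ne.symm hl)]
        · simp
      rw [e]
      exact isEquivariant_sum _ fun l _ => (isEquivariant_single l).comp
        ((D.isEquivariant_scalarAct z).comp (isEquivariant_proj l))
  | algebraMap r =>
    rw [Algebra.algebraMap_eq_smul_one]
    exact isEquivariant_id.smul r
  | add x y _ _ hx hy => exact hx.add hy
  | mul x y _ _ hx hy => exact hx.comp hy

end Equivariance

lemma commute_scalarExtAct (z : E) {O : Subring E} {x : Module.End ℚ (Ext 𝔙 s)}
    (hx : x ∈ EA 𝔙 O s) : Commute (scalarExtAct 𝔙 s z) x := by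
  have key : ∀ L L' : (Fin s → Module.Dual ℚ 𝔙) →ₗ[ℚ] (Fin s → Module.Dual ℚ 𝔙),
      L ∘ₗ L' = L' ∘ₗ L → Commute (ExteriorAlgebra.map L).toLinearMap
        (ExteriorAlgebra.map L').toLinearMap := by
    intro L L' h
    rw [commute_iff_eq, Module.End.mul_eq_comp, Module.End.mul_eq_comp,
      ← AlgHom.comp_toLinearMap, ← AlgHom.comp_toLinearMap, ExteriorAlgebra.map_comp_map,
      ExteriorAlgebra.map_comp_map, h]
  induction hx using Algebra.adjoin_induction with
  | mem x hx =>
    rcases hx with ⟨m, rfl⟩ | ⟨z', -, rfl⟩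
    · refine key _ _ (LinearMap.ext fun φ => funext fun n => ?_)
      simp [map_sum]
    · refine key _ _ (LinearMap.ext fun φ => funext fun n => ?_)
      refine LinearMap.ext fun v => ?_
      change φ n (z' • z • v) = φ n (z • z' • v)
      rw [smul_comm]
  | algebraMap r => exact (Algebra.commutes r _).symm
  | add x y _ _ hx hy => exact hx.add_right hy
  | mul x y _ _ hx hy => exact hx.mul_right hy

lemma scalarExtAct_tens {z : E} {w : Fin s → V0 𝔙 E} {c : Fin s → E}
    (h : ∀ l, (scalarAct 𝔙 z).baseChange E (w l) = c l • w l) :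
    (scalarExtAct 𝔙 s z).baseChange E (tens E s w) = (∏ l, c l) • tens E s w := by
  rw [scalarExtAct, map_tens, tens_apply, ← AlternatingMap.map_smul_univ]
  congr 1
  funext l
  have e : LinearMap.compLeft (scalarAct 𝔙 z) (Fin s) ∘ₗ
      LinearMap.single ℚ (fun _ : Fin s => Module.Dual ℚ 𝔙) l =
      LinearMap.single ℚ (fun _ : Fin s => Module.Dual ℚ 𝔙) l ∘ₗ scalarAct 𝔙 z := by
    refine LinearMap.ext fun φ => funext fun n => ?_
    simp only [LinearMap.comp_apply, LinearMap.compLeft_apply, Function.comp_apply,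
      LinearMap.single_apply]
    by_cases hn : n = l
    · subst hn
      simp
    · simp [hn]
  rw [e, LinearMap.baseChange_comp, LinearMap.comp_apply, h, map_smul]

section CentralElement

variable {D : UnitaryDatum E 𝔙} {i j : E →ₐ[ℚ] E} (Δ : SqrtGenerator D i j)

/-- An element of the order none of whose powers up to a given one is equal to the power of its
conjugate. -/
lemma SqrtGenerator.exists_mem_pow_ne (Δ : SqrtGenerator D i j) (O : Subring E)
    (hO : Submodule.span ℚ (O : Set E) = ⊤) (s : ℕ) :
    ∃ z ∈ O, z ≠ 0 ∧ ∀ k, 0 < k → k ≤ s → z ^ k ≠ D.conj z ^ k := by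
  obtain ⟨o, ho, hne⟩ : ∃ o ∈ O, D.conj o ≠ o := by
    by_contra! h
    have h1 : D.conj.toLinearMap = LinearMap.id := LinearMap.ext_on hO fun o ho => h o ho
    have h2 := LinearMap.congr_fun h1 Δ.δ
    have h3 : -Δ.δ = Δ.δ := Δ.conj_neg.symm.trans h2
    exact Δ.ne_zero (neg_eq_self.1 h3)
  let f : Polynomial E := (Polynomial.X + Polynomial.C o) * ∏ k ∈ Finset.Icc 1 s,
    ((Polynomial.X + Polynomial.C o) ^ k - (Polynomial.X + Polynomial.C (D.conj o)) ^ k)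
  have hf : f ≠ 0 := by
    refine mul_ne_zero (Polynomial.X_add_C_ne_zero o) (Finset.prod_ne_zero_iff.2 fun k hk h => ?_)
    have h1 := congrArg (Polynomial.eval (-D.conj o)) h
    have hk' : k ≠ 0 := by have := (Finset.mem_Icc.1 hk).1; omega
    simp only [Polynomial.eval_sub, Polynomial.eval_pow, Polynomial.eval_add, Polynomial.eval_X,
      Polynomial.eval_C, neg_add_cancel, zero_pow hk', sub_zero, Polynomial.eval_zero] at h1
    have h2 := pow_eq_zero_iff hk' |>.1 h1
    exact hne (neg_add_eq_zero.1 h2)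
  obtain ⟨N, hN⟩ : ∃ N : ℕ, f.eval (N : E) ≠ 0 := by
    by_contra! h
    refine hf (Polynomial.eq_zero_of_infinite_isRoot f
      ((Set.infinite_range_of_injective (Nat.cast_injective (R := E))).mono ?_))
    rintro _ ⟨N, rfl⟩
    exact h N
  rw [Polynomial.eval_mul, Polynomial.eval_prod, mul_ne_zero_iff, Finset.prod_ne_zero_iff] at hN
  refine ⟨N + o, O.add_mem (natCast_mem O N) ho, by simpa using hN.1, fun k hk hks h => ?_⟩
  refine hN.2 k (Finset.mem_Icc.2 ⟨hk, hks⟩) ?_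
  rw [map_add, map_natCast] at h
  simp [h]

/-- A rational polynomial which vanishes at an element and its conjugate and nowhere else. -/
lemma SqrtGenerator.exists_aeval_eq (Δ : SqrtGenerator D i j) (y : E) :
    ∃ p : Polynomial ℚ, ∀ t : E, Polynomial.aeval t p = (t - y) * (t - D.conj y) := by
  obtain ⟨x, r, rfl⟩ := Δ.exists_eq y
  refine ⟨Polynomial.X ^ 2 - Polynomial.C (2 * x) * Polynomial.X +
    Polynomial.C (x ^ 2 - r ^ 2 * Δ.norm), fun t => ?_⟩
  simp only [map_add, map_sub, map_mul, map_pow, Polynomial.aeval_X, Polynomial.aeval_C,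
    AlgEquiv.commutes, Δ.conj_neg, ← Δ.sq, map_ofNat]
  ring

/-- A rational polynomial separating the eigenvalues of `z` on `V₁ ^ ⊗ s` and `V₂ ^ ⊗ s`, on which
it takes the value `1`, from those on the other parts of `V₀ ^ ⊗ s`. -/
lemma SqrtGenerator.exists_separating_polynomial [Module.Finite ℚ E] (Δ : SqrtGenerator D i j) {s : ℕ} {z : E}
    (hz : z ≠ 0) (hz' : ∀ k, 0 < k → k ≤ s → z ^ k ≠ D.conj z ^ k) :
    ∃ p : Polynomial ℚ, ∀ d ≤ s, Polynomial.aeval (i z ^ d * j z ^ (s - d)) p =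
      if 0 < d ∧ d < s then 0 else 1 := by
  have hzc : D.conj z ≠ 0 := by simpa using hz
  choose f hf using Δ.exists_aeval_eq
  let A : Polynomial ℚ := ∏ d ∈ Finset.Ioo 0 s, f (z ^ d * D.conj z ^ (s - d))
  have hA : ∀ t, Polynomial.aeval t A = ∏ d ∈ Finset.Ioo 0 s,
      (t - z ^ d * D.conj z ^ (s - d)) * (t - D.conj z ^ d * z ^ (s - d)) := by
    intro t
    rw [map_prod]
    refine Finset.prod_congr rfl fun d _ => ?_
    rw [hf, map_mul, map_pow, map_pow, D.conj_conj]
  have hA0 : Polynomial.aeval (z ^ s) A ≠ 0 := by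
    rw [hA, Finset.prod_ne_zero_iff]
    intro d hd
    obtain ⟨h0, hs⟩ := Finset.mem_Ioo.1 hd
    have e : z ^ s = z ^ d * z ^ (s - d) := by rw [← pow_add, Nat.add_sub_cancel' hs.le]
    rw [e, ← mul_sub, ← sub_mul]
    refine mul_ne_zero (mul_ne_zero (pow_ne_zero _ hz) (sub_ne_zero.2 (hz' _ (by omega) (by omega))))
      (mul_ne_zero (sub_ne_zero.2 (hz' _ h0 hs.le)) (pow_ne_zero _ hz))
  obtain ⟨U, hU⟩ : ∃ U : Polynomial ℚ,
      Polynomial.aeval (z ^ s) U = (Polynomial.aeval (z ^ s) A)⁻¹ := by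
    have h := (Algebra.IsIntegral.isIntegral (R := ℚ)
      (Polynomial.aeval (z ^ s) A)).inv_mem_adjoin
    rw [Algebra.adjoin_singleton_eq_range_aeval] at h
    obtain ⟨V, hV⟩ := h
    exact ⟨V.comp A, by rw [Polynomial.aeval_comp]; exact hV⟩
  have h1 : Polynomial.aeval (z ^ s) (A * U) = 1 := by
    rw [map_mul, hU, mul_inv_cancel₀ hA0]
  have hj : ∀ x, i (D.conj x) = j x := fun x => Δ.swap.map_conj x
  refine ⟨A * U, fun d hd => ?_⟩
  have e : i z ^ d * j z ^ (s - d) = i (z ^ d * D.conj z ^ (s - d)) := by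
    rw [map_mul, map_pow, map_pow, hj]
  rw [e, Polynomial.aeval_algHom_apply]
  split_ifs with h
  · have h2 : Polynomial.aeval (z ^ d * D.conj z ^ (s - d)) A = 0 := by
      rw [hA]
      exact Finset.prod_eq_zero (Finset.mem_Ioo.2 h) (by rw [sub_self, zero_mul])
    rw [map_mul, h2, zero_mul, map_zero]
  · rcases (show d = 0 ∨ d = s by omega) with rfl | rfl
    · have e' : z ^ 0 * D.conj z ^ (s - 0) = D.conj (z ^ s) := by simp
      rw [e', show Polynomial.aeval (D.conj (z ^ s)) (A * U) =
        D.conj (Polynomial.aeval (z ^ s) (A * U)) from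
        Polynomial.aeval_algHom_apply D.conj.toAlgHom _ _, h1, map_one, map_one]
    · rw [Nat.sub_self, pow_zero, mul_one, h1, map_one]

/-- The central projector onto `V₁ ^ ⊗ s ⊕ V₂ ^ ⊗ s` is a polynomial in the action of a suitable
element of the order. -/
lemma SqrtGenerator.exists_central_projector [Module.Finite ℚ E] (Δ : SqrtGenerator D i j) (O : Subring E)
    (hO : Submodule.span ℚ (O : Set E) = ⊤) (s : ℕ) :
    ∃ q' ∈ EA 𝔙 O s, (∀ x ∈ EA 𝔙 O s, Commute q' x) ∧
      (∀ x ∈ tensorPart s ⊤, q'.baseChange E x ∈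
        tensorPart s (eigenPart 𝔙 i) ⊔ tensorPart s (eigenPart 𝔙 j)) ∧
      (∀ x ∈ tensorPart s (eigenPart 𝔙 i) ⊔ tensorPart s (eigenPart 𝔙 j),
        q'.baseChange E x = x) := by
  classical
  obtain ⟨z, hzO, hz, hz'⟩ := Δ.exists_mem_pow_ne O hO s
  obtain ⟨p, hp⟩ := Δ.exists_separating_polynomial hz hz'
  let T := scalarExtAct 𝔙 s z
  have hT : Polynomial.aeval T p ∈ Algebra.adjoin ℚ {T} :=
    Polynomial.aeval_mem_adjoin_singleton ℚ T
  have h1 : ∀ (S : Finset (Fin s)) (u u' : Fin s → V0 𝔙 E), (∀ l, u l ∈ eigenPart 𝔙 i) →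
      (∀ l, u' l ∈ eigenPart 𝔙 j) →
      (Polynomial.aeval T p).baseChange E (tens E s (S.piecewise u u')) =
        (if 0 < S.card ∧ S.card < s then (0 : E) else 1) • tens E s (S.piecewise u u') := by
    intro S u u' hu hu'
    have e : (Polynomial.aeval T p).baseChange E = Polynomial.aeval (T.baseChange E) p :=
      (Polynomial.aeval_algHom_apply (Module.End.baseChangeHom ℚ E (Ext 𝔙 s)) T p).symm
    rw [e, ← hp S.card (by simpa using S.card_le_univ)]
    refine Polynomial.aeval_end_apply_of_eq_smul ?_ p
    have h2 : ∀ l, (scalarAct 𝔙 z).baseChange E (S.piecewise u u' l) =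
        (S.piecewise (fun _ => i z) (fun _ => j z) l) • S.piecewise u u' l := by
      intro l
      rw [scalarAct_baseChange]
      by_cases hl : l ∈ S
      · rw [Finset.piecewise_eq_of_mem _ _ _ hl, Finset.piecewise_eq_of_mem _ _ _ hl]
        exact mem_eigenPart.1 (hu l) z
      · rw [Finset.piecewise_eq_of_notMem _ _ _ hl, Finset.piecewise_eq_of_notMem _ _ _ hl]
        exact mem_eigenPart.1 (hu' l) z
    rw [scalarExtAct_tens h2, Finset.prod_piecewise]
    congr 2
    · simp
    · simp [← Finset.compl_eq_univ_sdiff, Finset.card_compl]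
  have hi : ∀ u : Fin s → V0 𝔙 E, (∀ l, u l ∈ eigenPart 𝔙 i) →
      (Polynomial.aeval T p).baseChange E (tens E s u) = tens E s u := by
    intro u hu
    have h2 := h1 Finset.univ u 0 hu fun _ => Submodule.zero_mem _
    simpa using h2
  have hj : ∀ u : Fin s → V0 𝔙 E, (∀ l, u l ∈ eigenPart 𝔙 j) →
      (Polynomial.aeval T p).baseChange E (tens E s u) = tens E s u := by
    intro u hu
    have h2 := h1 ∅ 0 u (fun _ => Submodule.zero_mem _) hu
    simpa using h2
  refine ⟨Polynomial.aeval T p, ?_, fun x hx => ?_, ?_, ?_⟩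
  · have h : T ∈ EA 𝔙 O s := Algebra.subset_adjoin (Or.inr ⟨z, hzO, rfl⟩)
    exact Algebra.adjoin_le (Set.singleton_subset_iff.2 h) hT
  · have h : Algebra.adjoin ℚ {T} ≤ Subalgebra.centralizer ℚ {x} :=
      Algebra.adjoin_le (by
        rw [Set.singleton_subset_iff, SetLike.mem_coe, Subalgebra.mem_centralizer_iff]
        rintro _ rfl
        exact (commute_scalarExtAct z hx).eq.symm)
    exact (Subalgebra.mem_centralizer_iff ℚ |>.1 (h hT) x rfl).symm
  · rw [tensorPart_eq_span]
    intro x hx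
    induction hx using Submodule.span_induction with
    | zero => rw [map_zero]; exact Submodule.zero_mem _
    | add x y _ _ hx hy => rw [map_add]; exact Submodule.add_mem _ hx hy
    | smul r x _ hx => rw [map_smul]; exact Submodule.smul_mem _ _ hx
    | mem x hx =>
      obtain ⟨w, -, rfl⟩ := hx
      have e : w = (fun l => transpose E 𝔙 E (Δ.idem E) (w l)) +
          fun l => transpose E 𝔙 E (Δ.swap.idem E) (w l) := by
        funext l
        rw [Pi.add_apply, ← LinearMap.add_apply, ← map_add, Δ.idem_add_swap, transpose_one,
          Module.End.one_apply]
      have hu : ∀ l, transpose E 𝔙 E (Δ.idem E) (w l) ∈ eigenPart 𝔙 i :=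
        fun l => Δ.transpose_idem_mem _
      have hu' : ∀ l, transpose E 𝔙 E (Δ.swap.idem E) (w l) ∈ eigenPart 𝔙 j :=
        fun l => Δ.swap.transpose_idem_mem _
      rw [e, MultilinearMap.map_add_univ, map_sum]
      refine Submodule.sum_mem _ fun S _ => ?_
      rw [h1 S _ _ hu hu']
      split_ifs with h
      · rw [zero_smul]
        exact Submodule.zero_mem _
      · rw [one_smul]
        have hS : S.card ≤ s := by simpa using S.card_le_univ
        rcases (show S.card = 0 ∨ S.card = s by omega) with h0 | h0
        · rw [Finset.card_eq_zero] at h0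
          rw [h0, Finset.piecewise_empty]
          refine Submodule.mem_sup_right ?_
          rw [tensorPart_eq_span]
          exact Submodule.subset_span ⟨_, hu', rfl⟩
        · have h0' : S = Finset.univ := by
            rw [← Finset.card_eq_iff_eq_univ, h0, Fintype.card_fin]
          rw [h0', Finset.piecewise_univ]
          refine Submodule.mem_sup_left ?_
          rw [tensorPart_eq_span]
          exact Submodule.subset_span ⟨_, hu, rfl⟩
  · have h : tensorPart s (eigenPart 𝔙 i) ⊔ tensorPart s (eigenPart 𝔙 j) ≤
        LinearMap.eqLocus ((Polynomial.aeval T p).baseChange E) LinearMap.id := by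
      rw [tensorPart_eq_span, tensorPart_eq_span, sup_le_iff, Submodule.span_le, Submodule.span_le]
      constructor
      · rintro _ ⟨u, hu, rfl⟩
        exact hi u hu
      · rintro _ ⟨u, hu, rfl⟩
        exact hj u hu
    exact fun x hx => h hx

end CentralElement

end UnitaryDatum

/-! ### The irreducible representations cut out by Young symmetrizers -/

namespace UnitaryDatum

variable {E 𝔙 : Type u} [Field E] [CharZero E] [AddCommGroup 𝔙] [Module E 𝔙] [Module ℚ 𝔙]
  [IsScalarTower ℚ E 𝔙] {s g : ℕ} {D : UnitaryDatum E 𝔙}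

open AlgRep

variable (D) in
/-- `x ∈ G(R)` acts on the members of the family `β` through the matrix `A`. -/
def ActsBy (β : Fin g → V0 𝔙 E) {R : Type u} [CommRing R] [Algebra E R] (x : D.groupE.pts R)
    (A : Matrix (Fin g) (Fin g) R) : Prop :=
  ∀ m, (D.dualRep.baseChange E).act R x (1 ⊗ₜ β m) = ∑ n, A n m • ((1 : R) ⊗ₜ[E] β n)

variable (D) in
/-- The family `β` of vectors of `V₀` is linearly independent, its span is stable, and all
invertible matrices occur in the action of `G_E` on this span. -/
structure IsFullFamily (β : Fin g → V0 𝔙 E) : Prop where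
  exists_dual : ∃ μ : Fin g → (V0 𝔙 E →ₗ[E] E), ∀ m n, μ m (β n) = if n = m then 1 else 0
  exists_matrix : ∀ (R : Type u) [CommRing R] [Algebra E R] (x : D.groupE.pts R),
    ∃ A, D.ActsBy β x A
  exists_point : ∀ (R : Type u) [CommRing R] [Algebra E R] (A : Matrix (Fin g) (Fin g) R),
    IsUnit A.det → ∃ x : D.groupE.pts R, D.ActsBy β x A

variable {β : Fin g → V0 𝔙 E}

/-- The action on the tensor power in coordinates. -/
lemma ActsBy.act_tensCoord {R : Type u} [CommRing R] [Algebra E R] {x : D.groupE.pts R}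
    {A : Matrix (Fin g) (Fin g) R} (h : D.ActsBy β x A) (f : (Fin s → Fin g) → E) :
    ((D.extRep s).baseChange E).act R x (1 ⊗ₜ tensCoord s β f) =
      ∑ κ', (∑ κ, algebraMap E R (f κ) * ∏ l, A (κ' l) (κ l)) •
        ((1 : R) ⊗ₜ[E] tens E s (β ∘ κ')) := by
  have e : (1 : R) ⊗ₜ[E] tensCoord s β f =
      ∑ κ, algebraMap E R (f κ) • ((1 : R) ⊗ₜ[E] tens E s (β ∘ κ)) := by
    rw [tensCoord_apply, TensorProduct.tmul_sum]
    refine Finset.sum_congr rfl fun κ _ => ?_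
    rw [TensorProduct.tmul_smul, algebraMap_smul]
  rw [e, map_sum]
  simp only [Finset.sum_smul]
  rw [Finset.sum_comm]
  refine Finset.sum_congr rfl fun κ _ => ?_
  rw [map_smul]
  refine (congrArg _ (baseChange_exterior_act_tens E D.dualRep x β A h κ)).trans ?_
  rw [Finset.smul_sum]
  refine Finset.sum_congr rfl fun κ' _ => ?_
  rw [smul_smul]

lemma map_symAct_tensorPart {U : Submodule E (V0 𝔙 E)}
    (hU : Submodule.span E (Set.range β) = U) (C : MonoidAlgebra ℚ (Equiv.Perm (Fin s))) :
    (tensorPart s U).map ((symAct 𝔙 s C).baseChange E) =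
      (LinearMap.range (TensorCoord.signedPerm (Fin s) (Fin g) E C)).map (tensCoord s β) := by
  rw [tensorPart_eq_span, span_tens_eq_range hU, ← LinearMap.range_comp, ← LinearMap.range_comp]
  congr 1
  refine LinearMap.ext fun f => ?_
  exact symAct_tensCoord β C f

lemma symAct_mem_EA (O : Subring E) (C : MonoidAlgebra ℚ (Equiv.Perm (Fin s))) :
    symAct 𝔙 s C ∈ EA 𝔙 O s := by
  induction C using MonoidAlgebra.induction_linear with
  | zero => rw [map_zero]; exact Subalgebra.zero_mem _
  | add x y hx hy => rw [map_add]; exact Subalgebra.add_mem _ hx hy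
  | single σ r =>
    rw [symAct_single]
    have h : (ExteriorAlgebra.map (matrixMap 𝔙 s (σ⁻¹.permMatrix ℤ))).toLinearMap ∈ EA 𝔙 O s :=
      Algebra.subset_adjoin (Or.inl ⟨_, rfl⟩)
    exact Subalgebra.smul_mem _ h r

namespace IsFullFamily

variable {U : Submodule E (V0 𝔙 E)}

lemma isStable_tensorPart (hβ : D.IsFullFamily β) (hU : Submodule.span E (Set.range β) = U) :
    ((D.extRep s).baseChange E).IsStable (tensorPart s U) := by
  rw [tensorPart_eq_span, span_tens_eq_range hU, isStable_iff]
  rintro R _ _ x _ ⟨f, rfl⟩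
  obtain ⟨A, hA⟩ := hβ.exists_matrix R x
  rw [hA.act_tensCoord]
  classical
  refine Submodule.sum_mem _ fun κ' _ => Submodule.smul_mem _ _
    (Submodule.tmul_mem_baseChange_of_mem 1 ⟨Pi.single κ' 1, ?_⟩)
  rw [tensCoord_apply, Finset.sum_eq_single κ']
  · rw [Pi.single_eq_same, one_smul]
  · intro κ _ hκ
    rw [Pi.single_eq_of_ne hκ, zero_smul]
  · simp

lemma isStable_map_symAct (hβ : D.IsFullFamily β) (hU : Submodule.span E (Set.range β) = U)
    (C : MonoidAlgebra ℚ (Equiv.Perm (Fin s))) :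
    ((D.extRep s).baseChange E).IsStable
      ((tensorPart s U).map ((symAct 𝔙 s C).baseChange E)) :=
  (hβ.isStable_tensorPart hU).map
    ((D.isEquivariant_of_mem_EA (symAct_mem_EA ⊤ C)).baseChange E)

/-- The image of a primitive idempotent in a tensor power is irreducible, by Schur–Weyl duality. -/
lemma map_symAct_le_of_isStable (hβ : D.IsFullFamily β) (hU : Submodule.span E (Set.range β) = U)
    {C : MonoidAlgebra ℚ (Equiv.Perm (Fin s))} {n : ℚ} (hn : n ≠ 0) (hC : IsIdempotentElem C)
    (hprim : ∀ σ, C * MonoidAlgebra.single σ 1 * C = (C.coeff σ⁻¹ / n) • C)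
    {W : Submodule E (E ⊗[ℚ] Ext 𝔙 s)}
    (hW : W ≤ (tensorPart s U).map ((symAct 𝔙 s C).baseChange E))
    (hstab : ((D.extRep s).baseChange E).IsStable W) (h0 : W ≠ ⊥) :
    (tensorPart s U).map ((symAct 𝔙 s C).baseChange E) ≤ W := by
  classical
  rw [map_symAct_tensorPart hU] at hW ⊢
  obtain ⟨μ, hμ⟩ := hβ.exists_dual
  have hinj := tensCoord_injective (s := s) hμ
  have hWmap : (W.comap (tensCoord s β)).map (tensCoord s β) = W := by
    rw [Submodule.map_comap_eq, inf_eq_right]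
    exact hW.trans (Submodule.map_le_iff_le_comap.2 fun f _ => ⟨f, rfl⟩)
  rw [Submodule.map_le_iff_le_comap]
  refine TensorCoord.range_le_of_stable C n hn hC hprim _ ?_ ?_ ?_
  · intro A hA f hf ξ hξ
    obtain ⟨x, hx⟩ := hβ.exists_point _ A hA
    obtain ⟨p, hp⟩ := LinearMap.exists_leftInverse_of_injective _ (LinearMap.ker_eq_bot.2 hinj)
    have h1 := (isStable_iff _ W).1 hstab _ x _ hf
    have h2 : ∀ y ∈ W, (ξ ∘ₗ p) y = 0 := by
      intro y hy
      rw [← hWmap] at hy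
      obtain ⟨f', hf', rfl⟩ := hy
      rw [LinearMap.comp_apply, ← LinearMap.comp_apply p, hp]
      exact hξ _ hf'
    have h3 := ev_eq_zero_of_mem h1 h2
    have h4 : ∀ κ', (ξ ∘ₗ p) (tens E s (β ∘ κ')) = ξ (Pi.single κ' 1) := by
      intro κ'
      have e : tens E s (β ∘ κ') = tensCoord s β (Pi.single κ' 1) := by
        rw [tensCoord_apply, Finset.sum_eq_single κ']
        · rw [Pi.single_eq_same, one_smul]
        · intro κ _ hκ
          rw [Pi.single_eq_of_ne hκ, zero_smul]
        · simp
      rw [e, LinearMap.comp_apply, ← LinearMap.comp_apply p, hp, LinearMap.id_apply]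
    rw [hx.act_tensCoord, map_sum] at h3
    rw [Finset.sum_comm, ← h3]
    refine Finset.sum_congr rfl fun κ' _ => ?_
    rw [map_smul, ev_tmul, h4, smul_eq_mul, Finset.sum_mul]
    refine Finset.sum_congr rfl fun κ _ => ?_
    rw [Algebra.smul_def, mul_one, map_mul]
    ring
  · intro f hf
    obtain ⟨f', hf', e⟩ := hW hf
    rwa [← hinj e]
  · intro h
    apply h0
    rw [← hWmap, h, Submodule.map_bot]

end IsFullFamily

/-- The highest weight vector of the representation attached to a Young symmetrizer. -/
def youngVector (row : Fin s → Fin g) (col : Fin s → ℕ) (β : Fin g → V0 𝔙 E) :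
    E ⊗[ℚ] Ext 𝔙 s :=
  tensCoord s β (TensorCoord.signedPerm (Fin s) (Fin g) E (IsTableau.symmetrizer row col)
    (Pi.single row 1))

variable {a : Fin g → ℕ} {row : Fin s → Fin g} {col : Fin s → ℕ}

/-- Upper triangular matrices multiply the highest weight vector by the character of weight `a`. -/
lemma ActsBy.act_youngVector (ht : IsTableau a row col) (ha : Antitone a) {R : Type u} [CommRing R]
    [Algebra E R] {x : D.groupE.pts R} {A : Matrix (Fin g) (Fin g) R} (h : D.ActsBy β x A)
    (hA : ∀ l' l, l < l' → A l' l = 0) :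
    ((D.extRep s).baseChange E).act R x (1 ⊗ₜ youngVector row col β) =
      (∏ l, A l l ^ a l) • (1 ⊗ₜ youngVector row col β) := by
  let : Algebra ℚ R := Algebra.compHom R (algebraMap ℚ E)
  rw [youngVector, h.act_tensCoord, tensCoord_apply, TensorProduct.tmul_sum,
    Finset.smul_sum]
  refine Finset.sum_congr rfl fun κ' _ => ?_
  rw [TensorCoord.prod_mul_symmetrizer_single_row ht ha A hA, mul_smul, algebraMap_smul,
    TensorProduct.tmul_smul]

lemma youngVector_ne_zero (hβ : D.IsFullFamily β) (ht : IsTableau a row col) :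
    youngVector row col β ≠ 0 := by
  obtain ⟨μ, hμ⟩ := hβ.exists_dual
  rw [youngVector, ← map_zero (tensCoord (K := E) s β)]
  exact (tensCoord_injective hμ).ne (TensorCoord.symmetrizer_single_row_ne_zero ht)

lemma youngVector_mem {U : Submodule E (V0 𝔙 E)} (hU : Submodule.span E (Set.range β) = U)
    {n : ℚ} (hn : n ≠ 0) : youngVector row col β ∈ (tensorPart s U).map
      ((symAct 𝔙 s (n • IsTableau.symmetrizer row col)).baseChange E) := by
  rw [map_symAct_tensorPart hU, youngVector]
  refine Submodule.mem_map_of_mem ⟨algebraMap ℚ E n⁻¹ • Pi.single row 1, ?_⟩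
  rw [map_smul, map_smul, LinearMap.smul_apply, algebraMap_smul, smul_smul, inv_mul_cancel₀ hn,
    one_smul]

end UnitaryDatum

namespace AlgRep

variable {K : Type w} [Field K] {G : GroupFunctor.{u, w} K}
variable {V : Type*} [AddCommGroup V] [Module K V] {V' : Type*} [AddCommGroup V'] [Module K V']
variable {M : Type*} [AddCommGroup M] [Module K M]
variable {ρ : AlgRep G V} {ρ' : AlgRep G V'} {ρM : AlgRep G M}

lemma baseChange_injective {f : V →ₗ[K] V'} (hf : Function.Injective f) (R : Type*) [CommRing R]
    [Algebra K R] : Function.Injective (f.baseChange R) :=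
  Module.Flat.lTensor_preserves_injective_linearMap f hf

/-- Two representations embedded in a third one with the same image are isomorphic. -/
lemma isIso_of_range_eq {f : V →ₗ[K] M} {f' : V' →ₗ[K] M} (hf : Function.Injective f)
    (hf' : Function.Injective f') (h : IsEquivariant ρ ρM f) (h' : IsEquivariant ρ' ρM f')
    (hr : LinearMap.range f = LinearMap.range f') : IsIso ρ ρ' := by
  let e : V ≃ₗ[K] V' := (LinearEquiv.ofInjective f hf).trans
    ((LinearEquiv.ofEq _ _ hr).trans (LinearEquiv.ofInjective f' hf').symm)
  have he : f' ∘ₗ e.toLinearMap = f := by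
    refine LinearMap.ext fun v => ?_
    have h1 : LinearEquiv.ofInjective f' hf' (e v) =
        LinearEquiv.ofEq _ _ hr (LinearEquiv.ofInjective f hf v) :=
      LinearEquiv.apply_symm_apply _ _
    exact congrArg Subtype.val h1
  refine ⟨e, fun R _ _ g x => baseChange_injective hf' R ?_⟩
  have he' : ∀ y, f'.baseChange R (e.toLinearMap.baseChange R y) = f.baseChange R y := by
    intro y
    rw [← LinearMap.comp_apply, ← LinearMap.baseChange_comp, he]
  rw [h', he', he', h]

/-- The direct sum of two representations isomorphic to `τ ⊗ K` is isomorphic to `τ ^ 2 ⊗ K`. -/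
lemma isIso_prod_pow {k : Type w} [CommRing k] {G : GroupFunctor.{u, w} k} {K : Type u} [CommRing K]
    [Algebra k K] {W : Type*} [AddCommGroup W] [Module k W] {τ : AlgRep G W}
    {V V' : Type*} [AddCommGroup V] [Module K V] [AddCommGroup V'] [Module K V']
    {ρ : AlgRep (G.baseChange K) V} {ρ' : AlgRep (G.baseChange K) V'}
    (h : IsIso ρ (τ.baseChange K)) (h' : IsIso ρ' (τ.baseChange K)) :
    IsIso (ρ.prod ρ') ((τ.pow 2).baseChange K) := by
  obtain ⟨e, he⟩ := h
  obtain ⟨e', he'⟩ := h'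
  let incl : Fin 2 → (K ⊗[k] W →ₗ[K] K ⊗[k] (Fin 2 → W)) := fun l =>
    (LinearMap.single k (fun _ : Fin 2 => W) l).baseChange K
  let pr : Fin 2 → (K ⊗[k] (Fin 2 → W) →ₗ[K] K ⊗[k] W) := fun l =>
    (LinearMap.proj l : (Fin 2 → W) →ₗ[k] W).baseChange K
  have h1 : ∀ l l' x, pr l' (incl l x) = if l = l' then x else 0 := fun l l' x =>
    baseChange_single_proj l l' x
  have h2 : ∀ x, incl 0 (pr 0 x) + incl 1 (pr 1 x) = x := by
    intro x
    induction x with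
    | zero => simp
    | add x y hx hy =>
      simp only [map_add]
      rw [add_add_add_comm, hx, hy]
    | tmul r v =>
      simp only [incl, pr, LinearMap.baseChange_tmul]
      rw [← TensorProduct.tmul_add]
      congr 1
      funext l
      fin_cases l <;> simp
  let F : V × V' →ₗ[K] K ⊗[k] (Fin 2 → W) :=
    incl 0 ∘ₗ e.toLinearMap ∘ₗ LinearMap.fst K V V' +
      incl 1 ∘ₗ e'.toLinearMap ∘ₗ LinearMap.snd K V V'
  let F' : K ⊗[k] (Fin 2 → W) →ₗ[K] V × V' :=
    (e.symm.toLinearMap ∘ₗ pr 0).prod (e'.symm.toLinearMap ∘ₗ pr 1)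
  have hF : ∀ x, F x = incl 0 (e x.1) + incl 1 (e' x.2) := fun _ => rfl
  have hF' : ∀ y, F' y = (e.symm (pr 0 y), e'.symm (pr 1 y)) := fun _ => rfl
  refine ⟨LinearEquiv.ofLinear F F' (LinearMap.ext fun y => ?_) (LinearMap.ext fun x => ?_), ?_⟩
  · rw [LinearMap.comp_apply, hF, hF', LinearEquiv.apply_symm_apply, LinearEquiv.apply_symm_apply,
      h2, LinearMap.id_apply]
  · rw [LinearMap.comp_apply, hF', hF, map_add, map_add (pr 1), h1, h1, h1, h1]
    simp
  · exact (((isEquivariant_single 0).baseChange K).comp (he.comp isEquivariant_fst)).add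
      (((isEquivariant_single 1).baseChange K).comp (he'.comp isEquivariant_snd))

lemma isIrreducible_of_span_singleton {v : V} (hv : v ≠ 0) (h : ∀ y : V, ∃ z : K, y = z • v) :
    ρ.IsIrreducible := by
  refine ⟨⟨v, 0, hv⟩, fun W _ => ?_⟩
  by_cases hW : W = ⊥
  · exact Or.inl hW
  right
  obtain ⟨w, hw, hw0⟩ := W.ne_bot_iff.1 hW
  obtain ⟨z, rfl⟩ := h w
  have hz : z ≠ 0 := fun h => hw0 (by rw [h, zero_smul])
  rw [eq_top_iff]
  rintro y -
  obtain ⟨t, rfl⟩ := h y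
  have := W.smul_mem (t * z⁻¹) hw
  rwa [smul_smul, mul_assoc, inv_mul_cancel₀ hz, mul_one] at this

lemma subrep_act_of_eq_smul {W : Submodule K V} (hW : ρ.IsStable W) {R : Type u} [CommRing R]
    [Algebra K R] {x : G.pts R} {w : W} {χ : R}
    (h : ρ.act R x (1 ⊗ₜ (w : V)) = χ • (1 ⊗ₜ (w : V))) :
    (ρ.subrep W hW).act R x (1 ⊗ₜ w) = χ • (1 ⊗ₜ w) := by
  apply baseChange_injective W.injective_subtype R
  rw [subrep_subtype W hW R x, map_smul, LinearMap.baseChange_tmul]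
  exact h

end AlgRep

namespace UnitaryDatum

open Matrix

variable {E 𝔙 : Type u} [Field E] [CharZero E] [AddCommGroup 𝔙] [Module E 𝔙] [Module ℚ 𝔙]
  [IsScalarTower ℚ E 𝔙] {s g : ℕ} {D : UnitaryDatum E 𝔙} {i j : E →ₐ[ℚ] E}
  {Δ : SqrtGenerator D i j} {b : Module.Basis (Fin g) E (eigenPart 𝔙 i)} (F : Frame Δ b)

open AlgRep

section Frame

/-- The basis of `V₂` in which upper triangular matrices on `V₁` act through upper triangular
matrices. -/
def Frame.revBasis (m : Fin g) : V0 𝔙 E := F.b' m.rev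

lemma Frame.span_revBasis : Submodule.span E (Set.range F.revBasis) = eigenPart 𝔙 j := by
  have h : Set.range F.revBasis = (eigenPart 𝔙 j).subtype '' Set.range F.b' := by
    ext x
    constructor
    · rintro ⟨m, rfl⟩
      exact ⟨_, ⟨m.rev, rfl⟩, rfl⟩
    · rintro ⟨_, ⟨m, rfl⟩, rfl⟩
      exact ⟨m.rev, by rw [Frame.revBasis, Fin.rev_rev]; rfl⟩
  rw [h, ← Submodule.map_span, F.b'.span_eq, Submodule.map_subtype_top]

lemma span_basis_coe (b : Module.Basis (Fin g) E (eigenPart 𝔙 i)) :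
    Submodule.span E (Set.range fun l => (b l : V0 𝔙 E)) = eigenPart 𝔙 i := by
  have h : (Set.range fun l => (b l : V0 𝔙 E)) = (eigenPart 𝔙 i).subtype '' Set.range b := by
    rw [← Set.range_comp]
    rfl
  rw [h, ← Submodule.map_span, b.span_eq, Submodule.map_subtype_top]

variable [Module.Finite ℚ 𝔙] {R : Type u} [CommRing R] [Algebra E R]

lemma Frame.actsBy (A : GL (Fin g) R) (ν : Rˣ) :
    D.ActsBy (fun l => (b l : V0 𝔙 E)) (F.param.pt R (A, ν)) A.1 := fun m => F.act_basis A ν m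

lemma Frame.actsBy_revBasis (A : GL (Fin g) R) (ν : Rˣ) :
    D.ActsBy F.revBasis (F.param.pt R (A, ν))
      (Matrix.of fun n m => (ν : R) * (A⁻¹).1 m.rev n.rev) := by
  intro m
  refine (F.act_basis' A ν m.rev).trans ?_
  exact (Fintype.sum_equiv Fin.revPerm _ _ fun n => rfl).symm

lemma Frame.isFullFamily (F : Frame Δ b) : D.IsFullFamily fun l => (b l : V0 𝔙 E) where
  exists_dual := ⟨fun m => pair (F.w m), fun m n => F.pair_w n m⟩
  exists_matrix R _ _ x := by
    obtain ⟨⟨A, ν⟩, rfl⟩ := F.param.surjective R x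
    exact ⟨_, F.actsBy A ν⟩
  exists_point R _ _ A hA :=
    ⟨_, F.actsBy (Matrix.nonsingInvUnit A hA) 1⟩

lemma Frame.isFullFamily_revBasis : D.IsFullFamily F.revBasis where
  exists_dual := ⟨fun m => pair (F.w' m.rev), fun m n => by
    rw [Frame.revBasis, F.pair_w']
    simp [Fin.rev_inj]⟩
  exists_matrix R _ _ x := by
    obtain ⟨⟨A, ν⟩, rfl⟩ := F.param.surjective R x
    exact ⟨_, F.actsBy_revBasis A ν⟩
  exists_point R _ _ A hA := by
    have hB : IsUnit (Aᵀ.submatrix Fin.revPerm Fin.revPerm).det := by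
      rwa [Matrix.det_submatrix_equiv_self, Matrix.det_transpose]
    have h := F.actsBy_revBasis (Matrix.nonsingInvUnit _ hB)⁻¹ 1
    have e : (Matrix.of fun n m => ((1 : Rˣ) : R) *
        (((Matrix.nonsingInvUnit (Aᵀ.submatrix Fin.revPerm Fin.revPerm) hB)⁻¹)⁻¹).1
          (Fin.rev m) (Fin.rev n)) = A := by
      ext n m
      simp [Matrix.nonsingInvUnit]
    rw [e] at h
    exact ⟨_, h⟩

lemma inv_apply_of_upperTriangular {A : GL (Fin g) R} (hA : ∀ l' l, l < l' → A l' l = 0) :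
    (∀ l' l, l < l' → (A⁻¹).1 l' l = 0) ∧ ∀ l, A l l * (A⁻¹).1 l l = 1 := by
  have h1 : (A⁻¹).1 = A.1⁻¹ := Matrix.coe_units_inv A
  have : Invertible A.1 := A.invertible
  have h2 : ∀ l' l, l < l' → (A⁻¹).1 l' l = 0 := by
    have h3 : Matrix.BlockTriangular A.1 (id : Fin g → Fin g) := fun l' l h => hA l' l h
    have h4 := Matrix.blockTriangular_inv_of_blockTriangular h3
    intro l' l h
    rw [h1]
    exact h4 h
  refine ⟨h2, fun l => ?_⟩
  have h3 : (A.1 * (A⁻¹).1) l l = 1 := by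
    rw [← Units.val_mul, mul_inv_cancel, Units.val_one, Matrix.one_apply_eq]
  rw [Matrix.mul_apply, Finset.sum_eq_single l] at h3
  · exact h3
  · intro k _ hk
    rcases lt_or_gt_of_ne hk with h | h
    · rw [hA l k h, zero_mul]
    · rw [h2 k l h, mul_zero]
  · simp

end Frame

section HighestWeight

variable [Module.Finite ℚ 𝔙]

/-- The irreducible representation of `G_E` with a given highest weight is unique. -/
lemma IsIrreducibleOfHighestWeight.isIso (F : Frame Δ b) (hg : 0 < g) {V : Type v} {V' : Type w}
    [AddCommGroup V] [Module E V] [AddCommGroup V'] [Module E V'] {ρ : AlgRep D.groupE V}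
    {ρ' : AlgRep D.groupE V'} {a : Fin g → ℤ} {c : ℤ} (h : D.IsIrreducibleOfHighestWeight b ρ a c)
    (h' : D.IsIrreducibleOfHighestWeight b ρ' a c) : IsIso ρ ρ' := by
  obtain ⟨hfin, hirr, n, hn, v, hv0, hv⟩ := h
  obtain ⟨hfin', hirr', n', hn', v', hv0', hv'⟩ := h'
  obtain rfl : n = n' := by omega
  refine isIso_of_haveCommonWeight (P := F.param) hirr hirr' hv0 hv0' fun R _ _ A ν hA => ?_
  have ht := (inv_apply_of_upperTriangular hA).2
  have hU : D.IsUpperTriangular b (F.param.pt R (A, ν))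
      (fun l => ⟨A l l, (A⁻¹).1 l l, ht l, by rw [mul_comm, ht l]⟩) ν :=
    (F.isUpperTriangular_iff hg _ _ _).2 ⟨A, rfl, hA, fun _ => rfl⟩
  exact ⟨_, hv R _ _ ν hU, hv' R _ _ ν hU⟩

variable {a : Fin g → ℕ} {row : Fin s → Fin g} {col : Fin s → ℕ}

/-- The representation `C_a V₁ ^ ⊗ s` has highest weight `a`. -/
lemma isIrreducibleOfHighestWeight_young (F : Frame Δ b) (hg : 0 < g) (ht : IsTableau a row col)
    (ha : Antitone a) {n : ℚ} (hn : n ≠ 0)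
    (hC : IsIdempotentElem (n • IsTableau.symmetrizer row col))
    (hprim : ∀ σ, (n • IsTableau.symmetrizer row col) * MonoidAlgebra.single σ 1 *
      (n • IsTableau.symmetrizer row col) =
        ((n • IsTableau.symmetrizer row col).coeff σ⁻¹ / n) • (n • IsTableau.symmetrizer row col))
    (hst) :
    D.IsIrreducibleOfHighestWeight b (((D.extRep s).baseChange E).subrep
      ((tensorPart s (eigenPart 𝔙 i)).map
        ((symAct 𝔙 s (n • IsTableau.symmetrizer row col)).baseChange E)) hst)
      (fun l => (a l : ℤ)) (∑ l, (a l : ℤ)) := by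
  have hβ := F.isFullFamily
  have hspan := span_basis_coe b
  have hmem := youngVector_mem (s := s) (row := row) (col := col) hspan hn
  have hne := youngVector_ne_zero hβ ht
  refine ⟨?_, subrep_isIrreducible _ _ ?_ ?_, 0, by ring, ⟨_, hmem⟩, ?_, ?_⟩
  · rw [map_symAct_tensorPart hspan]
    infer_instance
  · exact fun h => hne ((Submodule.eq_bot_iff _).1 h _ hmem)
  · exact fun W hW hW' hW0 => hβ.map_symAct_le_of_isStable hspan hn hC hprim hW hW' hW0
  · exact fun h => hne (congrArg Subtype.val h)
  · intro R _ _ x t ν hx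
    obtain ⟨A, rfl, hA, hAt⟩ := (F.isUpperTriangular_iff hg x t ν).1 hx
    refine subrep_act_of_eq_smul hst ?_
    rw [(F.actsBy A ν).act_youngVector ht ha hA]
    congr 1
    rw [zpow_zero, mul_one, Units.coe_prod]
    refine Finset.prod_congr rfl fun l _ => ?_
    rw [zpow_natCast, Units.val_pow_eq_pow_val, ← hAt]

/-- The representation `C_a V₂ ^ ⊗ s` has highest weight `a*`. -/
lemma isIrreducibleOfHighestWeight_young_rev (F : Frame Δ b) (hg : 0 < g)
    (ht : IsTableau a row col) (ha : Antitone a) {n : ℚ} (hn : n ≠ 0)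
    (hC : IsIdempotentElem (n • IsTableau.symmetrizer row col))
    (hprim : ∀ σ, (n • IsTableau.symmetrizer row col) * MonoidAlgebra.single σ 1 *
      (n • IsTableau.symmetrizer row col) =
        ((n • IsTableau.symmetrizer row col).coeff σ⁻¹ / n) • (n • IsTableau.symmetrizer row col))
    (hst) :
    D.IsIrreducibleOfHighestWeight b (((D.extRep s).baseChange E).subrep
      ((tensorPart s (eigenPart 𝔙 j)).map
        ((symAct 𝔙 s (n • IsTableau.symmetrizer row col)).baseChange E)) hst)
      (fun l => -(a l.rev : ℤ)) (∑ l, (a l : ℤ)) := by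
  have hβ := F.isFullFamily_revBasis
  have hspan := F.span_revBasis
  have hmem := youngVector_mem (s := s) (row := row) (col := col) hspan hn
  have hne := youngVector_ne_zero hβ ht
  have hrev : ∑ l : Fin g, (a l.rev : ℤ) = ∑ l, (a l : ℤ) :=
    Fintype.sum_equiv Fin.revPerm _ _ fun _ => rfl
  refine ⟨?_, subrep_isIrreducible _ _ ?_ ?_, ∑ l, (a l : ℤ), ?_, ⟨_, hmem⟩, ?_, ?_⟩
  · rw [map_symAct_tensorPart hspan]
    infer_instance
  · exact fun h => hne ((Submodule.eq_bot_iff _).1 h _ hmem)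
  · exact fun W hW hW' hW0 => hβ.map_symAct_le_of_isStable hspan hn hC hprim hW hW' hW0
  · rw [Finset.sum_neg_distrib, hrev]
    ring
  · exact fun h => hne (congrArg Subtype.val h)
  · intro R _ _ x t ν hx
    obtain ⟨A, rfl, hA, hAt⟩ := (F.isUpperTriangular_iff hg x t ν).1 hx
    obtain ⟨h1, h2⟩ := inv_apply_of_upperTriangular hA
    have h3 : ∀ l, (A⁻¹).1 l l = ((t l)⁻¹ : Rˣ) := by
      intro l
      rw [← Units.mul_right_inj (t l), ← hAt, h2, hAt, Units.mul_inv]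
    refine subrep_act_of_eq_smul hst ?_
    rw [(F.actsBy_revBasis A ν).act_youngVector ht ha fun l' l hl => ?_]
    · congr 1
      have e : (∏ l, t l ^ (-(a l.rev : ℤ))) * ν ^ (∑ l, (a l : ℤ)) =
          ∏ l, (ν * (t l.rev)⁻¹) ^ a l := by
        rw [← Fintype.prod_equiv Fin.revPerm (fun l : Fin g => t l.rev ^ (-(a l : ℤ)))
          (fun l => t l ^ (-(a l.rev : ℤ))) (fun l => by simp), ← Nat.cast_sum, zpow_natCast,
          ← Finset.prod_pow_eq_pow_sum, ← Finset.prod_mul_distrib]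
        refine Finset.prod_congr rfl fun l _ => ?_
        rw [_root_.zpow_neg, zpow_natCast, mul_pow, inv_pow, mul_comm]
      rw [e, Units.coe_prod]
      refine Finset.prod_congr rfl fun l _ => ?_
      rw [Matrix.of_apply, h3, Units.val_pow_eq_pow_val, Units.val_mul]
    · rw [Matrix.of_apply, h1 _ _ (Fin.rev_lt_rev.2 hl), mul_zero]

end HighestWeight

end UnitaryDatum

/-! ### Attainable representations -/

lemma IsTableau.exists_of_sum_eq {g s : ℕ} (a : Fin g → ℕ) (h : ∑ l, a l = s) :
    ∃ (row : Fin s → Fin g) (col : Fin s → ℕ), IsTableau a row col := by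
  let e : Fin s ≃ Σ l, Fin (a l) := (finCongr h.symm).trans finSigmaFinEquiv.symm
  refine ⟨fun x => (e x).1, fun x => (e x).2, fun x y h1 h2 => ?_, fun l k hk => ?_, fun x => ?_⟩
  · apply e.injective
    refine Sigma.ext h1 ?_
    rw [Fin.heq_ext_iff (by rw [h1])]
    exact h2
  · exact ⟨e.symm ⟨l, k, hk⟩, by rw [Equiv.apply_symm_apply], by rw [Equiv.apply_symm_apply]⟩
  · exact (e x).2.2

namespace UnitaryDatum

variable {E 𝔙 : Type u} [Field E] [CharZero E] [AddCommGroup 𝔙] [Module E 𝔙] [Module ℚ 𝔙]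
  [IsScalarTower ℚ E 𝔙] {s g : ℕ} {D : UnitaryDatum E 𝔙} {i j : E →ₐ[ℚ] E}
  {Δ : SqrtGenerator D i j} {b : Module.Basis (Fin g) E (eigenPart 𝔙 i)}

open AlgRep

/-- The image of a homogeneous projector, as a representation. -/
lemma IsHomogeneousProjector.isAttainable {O : Subring E} {t : ℕ} {Q : Module.End ℚ (Ext 𝔙 s)}
    (hQ : IsHomogeneousProjector 𝔙 O s t Q) (hs : 1 ≤ s)
    (hst : (D.extRep s).IsStable (LinearMap.range Q)) :
    D.IsAttainable O ((D.extRep s).subrep _ hst) :=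
  ⟨1, fun _ => s, fun _ => t, fun _ => Q, fun _ => ⟨hs, hQ⟩,
    (LinearEquiv.funUnique (Fin 1) ℚ (LinearMap.range Q)).symm, fun _ => subrep_subtype _ hst⟩

/-- A representation embedded in `∧ V₀ ^ s` with the same image as a homogeneous projector. -/
lemma IsHomogeneousProjector.isAttainableE {O : Subring E} {t : ℕ} {Q : Module.End ℚ (Ext 𝔙 s)}
    (hQ : IsHomogeneousProjector 𝔙 O s t Q) (hs : 1 ≤ s) {V : Type v} [AddCommGroup V] [Module E V]
    {ρ : AlgRep D.groupE V} {f : V →ₗ[E] E ⊗[ℚ] Ext 𝔙 s} (hf : Function.Injective f)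
    (hf' : IsEquivariant ρ ((D.extRep s).baseChange E) f)
    (hr : LinearMap.range f = LinearMap.range (Q.baseChange E)) : D.IsAttainableE O ρ := by
  have hst : (D.extRep s).IsStable (LinearMap.range Q) :=
    isStable_range (D.isEquivariant_of_mem_EA hQ.1)
  refine ⟨_, _, _, _, hQ.isAttainable hs hst, isIso_of_range_eq hf
    (baseChange_injective (LinearMap.range Q).injective_subtype E) hf'
    ((subrep_subtype _ hst).baseChange E) ?_⟩
  rw [hr]
  have e : Q = (LinearMap.range Q).subtype ∘ₗ Q.rangeRestrict := rfl
  have hsurj : Function.Surjective (Q.rangeRestrict.baseChange E) :=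
    LinearMap.lTensor_surjective E Q.surjective_rangeRestrict
  conv_lhs => rw [e, LinearMap.baseChange_comp]
  rw [LinearMap.range_comp, LinearMap.range_eq_top.2 hsurj, Submodule.map_top]

section WeightZero

variable (𝔙) in
/-- The projector onto `∧⁰`. -/
lemma isHomogeneousProjector_matrixAct_zero (O : Subring E) :
    IsHomogeneousProjector 𝔙 O s 0 (matrixAct 𝔙 s 0) := by
  refine ⟨Algebra.subset_adjoin (Or.inl ⟨_, rfl⟩), ?_, ?_⟩
  · rw [IsIdempotentElem, ← matrixAct_mul, mul_zero]
  · rw [LinearMap.range_eq_map, ← span_monom, Submodule.map_span, Submodule.span_le]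
    rintro _ ⟨_, ⟨n, l, φ, rfl⟩, rfl⟩
    have e : (0 : Matrix (Fin s) (Fin s) ℤ) = Matrix.diagonal fun _ => 0 :=
      Matrix.diagonal_zero.symm
    rw [e, matrixAct_diagonal_monom]
    rcases Nat.eq_zero_or_pos n with rfl | hn
    · exact Submodule.smul_mem _ _ (ExteriorAlgebra.ιMulti_range ℚ 0 ⟨_, rfl⟩)
    · have h0 : ∏ k, (((0 : ℤ)) : ℚ) = (0 : ℚ) :=
        Finset.prod_eq_zero (Finset.mem_univ (⟨0, hn⟩ : Fin n)) Int.cast_zero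
      rw [h0, zero_smul]
      exact Submodule.zero_mem _

lemma one_mem_range_matrixAct_zero : (1 : Ext 𝔙 s) ∈ LinearMap.range (matrixAct 𝔙 s 0) :=
  ⟨1, map_one (ExteriorAlgebra.map (matrixMap 𝔙 s 0))⟩

/-- The representation on `∧⁰` is the irreducible representation of highest weight zero. -/
lemma isIrreducibleOfHighestWeight_zero
    (hst : (D.extRep s).IsStable (LinearMap.range (matrixAct 𝔙 s 0))) :
    D.IsIrreducibleOfHighestWeight b (((D.extRep s).subrep _ hst).baseChange E) 0 0 := by
  let o : LinearMap.range (matrixAct 𝔙 s 0) := ⟨1, one_mem_range_matrixAct_zero⟩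
  have ho : ∀ x : LinearMap.range (matrixAct 𝔙 s 0), ∃ r : ℚ, x = r • o := by
    rintro ⟨x, hx⟩
    have h1 := (isHomogeneousProjector_matrixAct_zero 𝔙 (⊤ : Subring E)).2.2 hx
    rw [ExteriorAlgebra.exteriorPower, pow_zero, Submodule.mem_one] at h1
    obtain ⟨r, rfl⟩ := h1
    exact ⟨r, Subtype.ext (Algebra.algebraMap_eq_smul_one r)⟩
  have hspan : ∀ y : E ⊗[ℚ] LinearMap.range (matrixAct 𝔙 s 0), ∃ z : E, y = z • (1 ⊗ₜ o) := by
    intro y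
    induction y with
    | zero => exact ⟨0, (zero_smul _ _).symm⟩
    | add x y hx hy =>
      obtain ⟨z, rfl⟩ := hx
      obtain ⟨t, rfl⟩ := hy
      exact ⟨z + t, (add_smul _ _ _).symm⟩
    | tmul z x =>
      obtain ⟨r, rfl⟩ := ho x
      refine ⟨algebraMap ℚ E r * z, ?_⟩
      rw [TensorProduct.tmul_smul, TensorProduct.smul_tmul', TensorProduct.smul_tmul',
        smul_eq_mul, mul_one, Algebra.smul_def]
  have hne : (1 : E) ⊗ₜ[ℚ] o ≠ 0 := by
    intro h
    have h1 := congrArg ((LinearMap.range (matrixAct 𝔙 s 0)).subtype.baseChange E) h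
    rw [map_zero, LinearMap.baseChange_tmul] at h1
    exact one_ne_zero h1
  refine ⟨⟨⟨{1 ⊗ₜ o}, ?_⟩⟩, isIrreducible_of_span_singleton hne hspan, 0, by simp, _, hne, ?_⟩
  · rw [eq_top_iff]
    rintro y -
    obtain ⟨z, rfl⟩ := hspan y
    exact Submodule.smul_mem _ _ (Submodule.subset_span (by simp))
  · intro R _ _ x t ν _
    let : Algebra ℚ R := Algebra.compHom R (algebraMap ℚ E)
    have : IsScalarTower ℚ E R := IsScalarTower.of_algebraMap_eq fun _ => rfl
    have e : (((∏ l, t l ^ (0 : Fin g → ℤ) l) * ν ^ (0 : ℤ) : Rˣ) : R) = 1 := by simp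
    rw [e, one_smul]
    apply (TensorProduct.AlgebraTensorModule.cancelBaseChange ℚ E R R
      (LinearMap.range (matrixAct 𝔙 s 0))).injective
    refine (baseChange_act_one_tmul E _ x _).trans ?_
    have h1 : ((Algebra.ofId E R).restrictScalars ℚ).toLinearMap.rTensor
        (LinearMap.range (matrixAct 𝔙 s 0)) ((1 : E) ⊗ₜ o) = 1 ⊗ₜ o := by
      rw [LinearMap.rTensor_tmul]
      congr 1
      exact map_one (Algebra.ofId E R)
    have h2 := subrep_act_of_eq_smul hst (R := R) (x := x) (w := o) (χ := 1) (by
      rw [one_smul]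
      exact map_one (extEnd ((D.dualRep.pow s).act R (show D.group.pts R from x))))
    rw [h1, TensorProduct.AlgebraTensorModule.cancelBaseChange_tmul, one_smul]
    exact h2.trans (one_smul _ _)

/-- The sum of two trivial representations is attainable, as two copies of `∧⁰`. -/
lemma isAttainableE_prod_zero [Module.Finite ℚ 𝔙] (F : Frame Δ b) (hg : 0 < g) (O : Subring E)
    {V V' : Type v} [AddCommGroup V] [Module E V] [AddCommGroup V'] [Module E V']
    {ρ : AlgRep D.groupE V} {ρ' : AlgRep D.groupE V'}
    (h : D.IsIrreducibleOfHighestWeight b ρ 0 0) (h' : D.IsIrreducibleOfHighestWeight b ρ' 0 0) :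
    D.IsAttainableE O (ρ.prod ρ') := by
  have hQ := isHomogeneousProjector_matrixAct_zero (s := 1) 𝔙 O
  have hst : (D.extRep 1).IsStable (LinearMap.range (matrixAct 𝔙 1 0)) :=
    isStable_range (D.isEquivariant_of_mem_EA hQ.1)
  have h0 := isIrreducibleOfHighestWeight_zero (b := b) hst
  refine ⟨_, _, _, ((D.extRep 1).subrep _ hst).pow 2, ?_,
    isIso_prod_pow (h.isIso F hg h0) (h'.isIso F hg h0)⟩
  exact ⟨2, fun _ => 1, fun _ => 0, fun _ => matrixAct 𝔙 1 0, fun _ => ⟨le_rfl, hQ⟩,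
    LinearEquiv.refl ℚ _, fun m => (subrep_subtype _ hst).comp (isEquivariant_proj m)⟩

end WeightZero

section Projectors

lemma baseChange_end_injective {f f' : Module.End ℚ (Ext 𝔙 s)}
    (h : f.baseChange E = f'.baseChange E) : f = f' := by
  refine LinearMap.ext fun x => ?_
  have h1 := LinearMap.congr_fun h (1 ⊗ₜ x)
  rw [LinearMap.baseChange_tmul, LinearMap.baseChange_tmul] at h1
  exact Algebra.TensorProduct.includeRight_injective (algebraMap ℚ E).injective h1

variable {O : Subring E} {C : MonoidAlgebra ℚ (Equiv.Perm (Fin s))}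
  {q q' : Module.End ℚ (Ext 𝔙 s)}

lemma tensorPart_mono {U U' : Submodule E (V0 𝔙 E)} (h : U ≤ U') :
    tensorPart s U ≤ tensorPart s U' :=
  Submodule.span_mono fun _ ⟨w, hw, e⟩ => ⟨w, fun l => h (hw l), e⟩

/-- The image of `C q' q` on `∧ V₀ ^ s` is `C V₁ ^ ⊗ s + C V₂ ^ ⊗ s`. -/
lemma range_young_projector (hq : LinearMap.range (q.baseChange E) = tensorPart s ⊤)
    (h1 : ∀ x ∈ tensorPart s ⊤, q'.baseChange E x ∈
        tensorPart s (eigenPart 𝔙 i) ⊔ tensorPart s (eigenPart 𝔙 j))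
    (h2 : ∀ x ∈ tensorPart s (eigenPart 𝔙 i) ⊔ tensorPart s (eigenPart 𝔙 j),
        q'.baseChange E x = x) :
    LinearMap.range ((symAct 𝔙 s C * q' * q).baseChange E) =
      (tensorPart s (eigenPart 𝔙 i)).map ((symAct 𝔙 s C).baseChange E) ⊔
      (tensorPart s (eigenPart 𝔙 j)).map ((symAct 𝔙 s C).baseChange E) := by
  rw [Module.End.mul_eq_comp, Module.End.mul_eq_comp, LinearMap.baseChange_comp,
    LinearMap.baseChange_comp, LinearMap.range_comp, hq, Submodule.map_comp, ← Submodule.map_sup]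
  congr 1
  apply le_antisymm
  · rw [Submodule.map_le_iff_le_comap]
    exact h1
  · intro x hx
    refine ⟨x, ?_, h2 x hx⟩
    have h : tensorPart s (eigenPart 𝔙 i) ⊔ tensorPart s (eigenPart 𝔙 j) ≤ tensorPart s ⊤ :=
      sup_le (tensorPart_mono le_top) (tensorPart_mono le_top)
    exact h hx

/-- The product `C q' q` is a homogeneous projector, since its three factors commute and `q'` is
idempotent on the image of `q`. -/
lemma isHomogeneousProjector_young (hC : IsIdempotentElem C) (hqO : q ∈ EA 𝔙 O s)
    (hq : IsTensorProjector q) (hqO' : q' ∈ EA 𝔙 O s) (hq' : ∀ x ∈ EA 𝔙 O s, Commute q' x)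
    (h1 : ∀ x ∈ tensorPart s ⊤, q'.baseChange E x ∈
        tensorPart s (eigenPart 𝔙 i) ⊔ tensorPart s (eigenPart 𝔙 j))
    (h2 : ∀ x ∈ tensorPart s (eigenPart 𝔙 i) ⊔ tensorPart s (eigenPart 𝔙 j),
        q'.baseChange E x = x) :
    IsHomogeneousProjector 𝔙 O s s (symAct 𝔙 s C * q' * q) := by
  have hCO : symAct 𝔙 s C ∈ EA 𝔙 O s := symAct_mem_EA O C
  have hC' : symAct 𝔙 s C * symAct 𝔙 s C = symAct 𝔙 s C := by rw [← map_mul, hC.eq]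
  have hqC := (hq.commute_symAct C).eq
  have hq'C := (hq' _ hCO).eq
  have hq'q := (hq' _ hqO).eq
  have hqq := hq.isIdempotentElem.eq
  have hqqq : q' * (q' * q) = q' * q := by
    apply baseChange_end_injective (E := E)
    rw [Module.End.mul_eq_comp, Module.End.mul_eq_comp, LinearMap.baseChange_comp,
      LinearMap.baseChange_comp]
    refine LinearMap.ext fun x => h2 _ (h1 _ ?_)
    rw [← hq.range_baseChange]
    exact ⟨x, rfl⟩
  refine ⟨Subalgebra.mul_mem _ (Subalgebra.mul_mem _ hCO hqO') hqO, ?_, ?_⟩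
  · change symAct 𝔙 s C * q' * q * (symAct 𝔙 s C * q' * q) = symAct 𝔙 s C * q' * q
    generalize symAct 𝔙 s C = γ at *
    calc γ * q' * q * (γ * q' * q) = γ * q' * (q * γ) * q' * q := by simp only [mul_assoc]
      _ = γ * (q' * γ) * (q * q') * q := by rw [hqC]; simp only [mul_assoc]
      _ = γ * γ * (q' * (q' * (q * q))) := by rw [hq'C, ← hq'q]; simp only [mul_assoc]
      _ = γ * q' * q := by rw [hC', hqq, hqqq, mul_assoc]
  · have e : symAct 𝔙 s C * q' * q = q * (symAct 𝔙 s C * q') := by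
      rw [mul_assoc, hq'q, ← mul_assoc, ← hqC, mul_assoc]
    rw [e]
    exact (LinearMap.range_comp_le_range _ _).trans hq.range_le

/-- The subspaces `V₁ ^ ⊗ s` and `V₂ ^ ⊗ s` have zero intersection for `s ≥ 1`, since suitable
elements of `E` act on them through different scalars. -/
lemma SqrtGenerator.disjoint_tensorPart (Δ : SqrtGenerator D i j) (hs : 1 ≤ s) :
    Disjoint (tensorPart s (eigenPart 𝔙 i)) (tensorPart s (eigenPart 𝔙 j)) := by
  obtain ⟨z, -, -, hz⟩ := Δ.exists_mem_pow_ne (⊤ : Subring E) (by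
    rw [eq_top_iff]
    exact fun x _ => Submodule.subset_span trivial) s
  have key : ∀ i' : E →ₐ[ℚ] E, ∀ x ∈ tensorPart s (eigenPart 𝔙 i'),
      (scalarExtAct 𝔙 s z).baseChange E x = (i' z) ^ s • x := by
    intro i' x hx
    rw [tensorPart_eq_span] at hx
    induction hx using Submodule.span_induction with
    | zero => rw [map_zero, smul_zero]
    | add x y _ _ hx hy => rw [map_add, hx, hy, smul_add]
    | smul r x _ hx => rw [map_smul, hx, smul_comm]
    | mem x hx =>
      obtain ⟨w, hw, rfl⟩ := hx
      rw [scalarExtAct_tens (c := fun _ => i' z) fun l => by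
        rw [scalarAct_baseChange]; exact mem_eigenPart.1 (hw l) z]
      simp
  rw [Submodule.disjoint_def]
  intro x hx hx'
  have h1 := (key i x hx).symm.trans (key j x hx')
  rw [← sub_eq_zero, ← sub_smul, smul_eq_zero, sub_eq_zero] at h1
  refine h1.resolve_left fun h => hz s hs le_rfl (i.injective ?_)
  change i (z ^ s) = i (D.conj z ^ s)
  rw [map_pow, map_pow, Δ.swap.map_conj, h]

end Projectors

end UnitaryDatum

namespace UnitaryDatum

variable {E 𝔙 : Type u} [Field E] [CharZero E] [AddCommGroup 𝔙] [Module E 𝔙] [Module ℚ 𝔙]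
  [IsScalarTower ℚ E 𝔙] {s g : ℕ} {D : UnitaryDatum E 𝔙} {i j : E →ₐ[ℚ] E}
  {Δ : SqrtGenerator D i j} {b : Module.Basis (Fin g) E (eigenPart 𝔙 i)}

open AlgRep

/-- The sum of two isomorphisms onto independent subspaces. -/
lemma exists_prod_embedding {K : Type u} [Field K] {G : GroupFunctor.{u, u} K} {V V' M : Type*}
    [AddCommGroup V] [Module K V] [AddCommGroup V'] [Module K V'] [AddCommGroup M] [Module K M]
    {ρ : AlgRep G V} {ρ' : AlgRep G V'} {ρM : AlgRep G M} {U U' : Submodule K M}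
    (hU : ρM.IsStable U) (hU' : ρM.IsStable U') (hd : Disjoint U U')
    (h : IsIso ρ (ρM.subrep U hU)) (h' : IsIso ρ' (ρM.subrep U' hU')) :
    ∃ f : V × V' →ₗ[K] M, Function.Injective f ∧ IsEquivariant (ρ.prod ρ') ρM f ∧
      LinearMap.range f = U ⊔ U' ∧ LinearMap.range (f ∘ₗ LinearMap.inl K V V') = U ∧
      LinearMap.range (f ∘ₗ LinearMap.inr K V V') = U' := by
  obtain ⟨e, he⟩ := h
  obtain ⟨e', he'⟩ := h'
  have h1 : LinearMap.range (U.subtype ∘ₗ e.toLinearMap) = U := by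
    rw [LinearMap.range_comp, LinearEquiv.range, Submodule.map_subtype_top]
  have h1' : LinearMap.range (U'.subtype ∘ₗ e'.toLinearMap) = U' := by
    rw [LinearMap.range_comp, LinearEquiv.range, Submodule.map_subtype_top]
  have h2 : Function.Injective (U.subtype ∘ₗ e.toLinearMap) := U.injective_subtype.comp e.injective
  have h2' : Function.Injective (U'.subtype ∘ₗ e'.toLinearMap) :=
    U'.injective_subtype.comp e'.injective
  refine ⟨(U.subtype ∘ₗ e.toLinearMap).coprod (U'.subtype ∘ₗ e'.toLinearMap), ?_, ?_, ?_, ?_, ?_⟩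
  · rw [← LinearMap.ker_eq_bot, LinearMap.ker_coprod_of_disjoint_range _ _ (by rwa [h1, h1']),
      LinearMap.ker_eq_bot.2 h2, LinearMap.ker_eq_bot.2 h2', Submodule.prod_bot]
  · exact (((subrep_subtype U hU).comp he).comp isEquivariant_fst).add
      (((subrep_subtype U' hU').comp he').comp isEquivariant_snd)
  · rw [LinearMap.range_coprod, h1, h1']
  · rw [LinearMap.coprod_inl, h1]
  · rw [LinearMap.coprod_inr, h1']

lemma map_symAct_tensorPart_le (C : MonoidAlgebra ℚ (Equiv.Perm (Fin s)))
    (U : Submodule E (V0 𝔙 E)) :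
    (tensorPart s U).map ((symAct 𝔙 s C).baseChange E) ≤ tensorPart s U := by
  rw [tensorPart_eq_span, Submodule.map_span, Submodule.span_le]
  rintro _ ⟨_, ⟨w, hw, rfl⟩, rfl⟩
  induction C using MonoidAlgebra.induction_linear with
  | zero =>
    rw [map_zero, LinearMap.baseChange_zero]
    exact Submodule.zero_mem _
  | add x y hx hy =>
    rw [map_add, LinearMap.baseChange_add]
    exact Submodule.add_mem _ hx hy
  | single σ r =>
    rw [symAct_single_tens, Units.smul_def, ← Int.cast_smul_eq_zsmul E]
    exact Submodule.smul_mem _ _ (Submodule.smul_mem _ _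
      (Submodule.subset_span ⟨_, fun l => hw _, rfl⟩))

end UnitaryDatum

end

theorem mainTheorem5 {E 𝔙 : Type u} [Field E] [NumberField E] [AddCommGroup 𝔙] [Module E 𝔙]
    [Module ℚ 𝔙] [IsScalarTower ℚ E 𝔙]
    -- `E` is an imaginary quadratic field
    (hE : Module.finrank ℚ E = 2) (hE' : NumberField.IsTotallyComplex E)
    -- the unitary group, attached to a hermitian space of dimension `g` over `E`
    (D : UnitaryDatum E 𝔙) (g : ℕ) (hg : 0 < g) (h𝔙 : Module.finrank ℚ 𝔙 = 2 * g)
    -- an order `O` of `E` (e.g. over `ℤ`, or over `ℤ_(p)`)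
    (O : Subring E) (hO : Submodule.span ℚ (O : Set E) = ⊤)
    -- the two embeddings `E → E`, and the choice of an isomorphism `G_E ≅ GL_g × 𝔾_m`
    (i j : E →ₐ[ℚ] E) (hij : i ≠ j)
    (b : Module.Basis (Fin g) E (UnitaryDatum.eigenPart 𝔙 i))
    -- the dominant weight `a = (a₁, …, a_g; c)` with `a_g ≥ 0` and `c = ∑ a_l = s`
    (a : Fin g → ℤ) (ha : Antitone a) (ha0 : ∀ l, 0 ≤ a l)
    (c : ℤ) (s : ℕ) (hc : c = ∑ l, a l) (hs : c = s) :
    -- the representations `V(a)` and `V(a*)` exist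
    (∃ (V : Type u) (_ : AddCommGroup V) (_ : Module E V) (ρ : AlgRep D.groupE V),
      D.IsIrreducibleOfHighestWeight b ρ a c) ∧
    (∃ (V' : Type u) (_ : AddCommGroup V') (_ : Module E V') (ρ' : AlgRep D.groupE V'),
      D.IsIrreducibleOfHighestWeight b ρ' (fun l => -a l.rev) c) ∧
    -- `V(a) ⊕ V(a*)` belongs to `Rep^a_E(G)`
    (∀ (V V' : Type v) [AddCommGroup V] [Module E V] [AddCommGroup V'] [Module E V']
      (ρ : AlgRep D.groupE V) (ρ' : AlgRep D.groupE V'),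
      D.IsIrreducibleOfHighestWeight b ρ a c →
      D.IsIrreducibleOfHighestWeight b ρ' (fun l => -a l.rev) c →
      D.IsAttainableE O (ρ.prod ρ')) ∧
    -- and, for `s ≥ 1`, it is the image of a homogeneous projector `C_a q' q` of `E(A)_s ⊗ ℚ`
    (1 ≤ s → ∃ (C : MonoidAlgebra ℚ (Equiv.Perm (Fin s)))
        (q q' : Module.End ℚ (UnitaryDatum.Ext 𝔙 s)),
      IsIdempotentElem C ∧
      -- `q` is a projector of `E(A)_s ⊗ ℚ` onto `V₀ ^ ⊗ s`, commuting with `𝔖_s`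
      (q ∈ UnitaryDatum.EA 𝔙 O s ∧ IsIdempotentElem q ∧
        (∀ x, Commute q (UnitaryDatum.symAct 𝔙 s x)) ∧
        LinearMap.range (q.baseChange E) = UnitaryDatum.tensorPart s ⊤) ∧
      -- `q'` is central in `E(A)_s ⊗ ℚ`; on `V₀ ^ ⊗ s` it projects onto `V₁ ^ ⊗ s ⊕ V₂ ^ ⊗ s`
      (q' ∈ UnitaryDatum.EA 𝔙 O s ∧ (∀ x ∈ UnitaryDatum.EA 𝔙 O s, Commute q' x) ∧
        (∀ x ∈ UnitaryDatum.tensorPart s ⊤, q'.baseChange E x ∈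
          UnitaryDatum.tensorPart s (UnitaryDatum.eigenPart 𝔙 i) ⊔
            UnitaryDatum.tensorPart s (UnitaryDatum.eigenPart 𝔙 j)) ∧
        (∀ x ∈ UnitaryDatum.tensorPart s (UnitaryDatum.eigenPart 𝔙 i) ⊔
          UnitaryDatum.tensorPart s (UnitaryDatum.eigenPart 𝔙 j), q'.baseChange E x = x)) ∧
      UnitaryDatum.IsHomogeneousProjector 𝔙 O s s (UnitaryDatum.symAct 𝔙 s C * q' * q) ∧
      ∀ (V V' : Type v) [AddCommGroup V] [Module E V] [AddCommGroup V'] [Module E V']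
        (ρ : AlgRep D.groupE V) (ρ' : AlgRep D.groupE V'),
        D.IsIrreducibleOfHighestWeight b ρ a c →
        D.IsIrreducibleOfHighestWeight b ρ' (fun l => -a l.rev) c →
        ∃ f : V × V' →ₗ[E] E ⊗[ℚ] UnitaryDatum.Ext 𝔙 s,
          Function.Injective f ∧
          AlgRep.IsEquivariant (ρ.prod ρ') ((D.extRep s).baseChange E) f ∧
          LinearMap.range f =
            LinearMap.range ((UnitaryDatum.symAct 𝔙 s C * q' * q).baseChange E) ∧
          (LinearMap.range (f ∘ₗ LinearMap.inl E V V') =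
            (UnitaryDatum.tensorPart s (UnitaryDatum.eigenPart 𝔙 i)).map
              ((UnitaryDatum.symAct 𝔙 s C).baseChange E)) ∧
          (LinearMap.range (f ∘ₗ LinearMap.inr E V V') =
            (UnitaryDatum.tensorPart s (UnitaryDatum.eigenPart 𝔙 j)).map
              ((UnitaryDatum.symAct 𝔙 s C).baseChange E))) := by
  open UnitaryDatum AlgRep in
  have : Module.Finite ℚ 𝔙 := Module.finite_of_finrank_pos (by omega)
  have : Module.Finite E 𝔙 := Module.Finite.of_restrictScalars_finite ℚ E 𝔙
  have hgE : Module.finrank E 𝔙 = g := by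
    have h := Module.finrank_mul_finrank ℚ E 𝔙
    rw [hE, h𝔙] at h
    omega
  obtain ⟨Δ⟩ := nonempty_sqrtGenerator hE hE' D i j hij
  obtain ⟨F⟩ := nonempty_frame Δ hgE b
  lift a to Fin g → ℕ using ha0
  have ha' : Antitone a := fun l l' h => Int.ofNat_le.1 (ha h)
  obtain ⟨row, col, ht⟩ := IsTableau.exists_of_sum_eq a (s := s) (by
    rw [hc] at hs
    have h : ∑ l, (a l : ℤ) = s := hs
    exact_mod_cast h)
  subst hc
  obtain ⟨n, hn, hC, hprim⟩ := ht.exists_idempotent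
  set C := n • IsTableau.symmetrizer row col with hCdef
  -- the representations `C V₁ ^ ⊗ s` and `C V₂ ^ ⊗ s`
  have hst := F.isFullFamily.isStable_map_symAct (s := s) (span_basis_coe b) C
  have hst' := F.isFullFamily_revBasis.isStable_map_symAct (s := s) F.span_revBasis C
  have hV := isIrreducibleOfHighestWeight_young F hg ht ha' hn hC hprim hst
  have hV' := isIrreducibleOfHighestWeight_young_rev F hg ht ha' hn hC hprim hst'
  obtain ⟨q, hqO, hq⟩ := exists_tensor_projector (𝔙 := 𝔙) O s
  obtain ⟨q', hqO', hcomm, hq1, hq2⟩ := Δ.exists_central_projector O hO s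
  have hproj := isHomogeneousProjector_young hC hqO hq hqO' hcomm hq1 hq2
  have hrange := range_young_projector (C := C) hq.range_baseChange hq1 hq2
  -- any two representations of these highest weights embed onto the image of the projector
  have hembed : 1 ≤ s → ∀ (V V' : Type v) [AddCommGroup V] [Module E V] [AddCommGroup V']
      [Module E V'] (ρ : AlgRep D.groupE V) (ρ' : AlgRep D.groupE V'),
      D.IsIrreducibleOfHighestWeight b ρ (fun l => (a l : ℤ)) (∑ l, (a l : ℤ)) →
      D.IsIrreducibleOfHighestWeight b ρ' (fun l => -(a l.rev : ℤ)) (∑ l, (a l : ℤ)) → _ :=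
    fun hs1 V V' _ _ _ _ ρ ρ' h h' =>
      exists_prod_embedding hst hst' ((Δ.disjoint_tensorPart hs1).mono
        (map_symAct_tensorPart_le C _) (map_symAct_tensorPart_le C _)) (h.isIso F hg hV) (h'.isIso F hg hV')
  refine ⟨⟨_, _, _, _, hV⟩, ⟨_, _, _, _, hV'⟩, ?_, fun hs1 => ?_⟩
  · intro V V' _ _ _ _ ρ ρ' h h'
    rcases Nat.eq_zero_or_pos s with hs0 | hs1
    · -- the two highest weights are both zero, and `q`, `q'`, `C` play no role
      subst hs0
      have hsum : ∑ l, (a l : ℤ) = 0 := hs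
      have ha0 : ∀ l, a l = 0 := by
        have h0 : ∑ l, a l = 0 := by exact_mod_cast hsum
        exact fun l => Finset.sum_eq_zero_iff.1 h0 l (Finset.mem_univ l)
      have e : (fun l => (a l : ℤ)) = 0 := funext fun l => by rw [ha0]; rfl
      have e' : (fun l : Fin g => -(a l.rev : ℤ)) = 0 := funext fun l => by rw [ha0]; rfl
      change D.IsIrreducibleOfHighestWeight b ρ (fun l => (a l : ℤ)) (∑ l, (a l : ℤ)) at h
      change D.IsIrreducibleOfHighestWeight b ρ' (fun l => -(a l.rev : ℤ)) (∑ l, (a l : ℤ)) at h'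
      rw [hsum, e] at h
      rw [hsum, e'] at h'
      exact isAttainableE_prod_zero F hg O h h'
    · obtain ⟨f, hf, hf', hr, -⟩ := hembed hs1 V V' ρ ρ' h h'
      exact hproj.isAttainableE hs1 hf hf' (hr.trans hrange.symm)
  · refine ⟨C, q, q', hC, ⟨hqO, hq.isIdempotentElem, hq.commute_symAct, hq.range_baseChange⟩,
      ⟨hqO', hcomm, hq1, hq2⟩, hproj, ?_⟩
    intro V V' _ _ _ _ ρ ρ' h h'
    obtain ⟨f, hf, hf', hr, hl, hl'⟩ := hembed hs1 V V' ρ ρ' h h'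
    exact ⟨f, hf, hf', hr.trans hrange.symm, hl, hl'⟩
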